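/- All manifolds are smooth, Hausdorff and finite-dimensional; Lie groups are finite-dimensional. A map $[0,1]^k\to M$ is smooth if its partial derivatives of every order exist and are continuous on $[0,1]^k$ (one-sided at the boundary). **Setting.** Let $\mathcal G=(\partial\colon E\to G,\triangleright)$ be a Lie crossed module: $E,G$ are Lie groups with Lie algebras $\mathfrak e,\mathfrak g$, $\partial$ is a smooth homomorphism, $\triangleright$ is a smooth left action of $G$ on $E$ by automorphisms, $\partial(g\triangleright e)=g\,\partial(e)\,g^{-1}$ and $\partial(e)\triangleright f=efe^{-1}$. The induced maps $\mathfrak e\to\mathfrak g$ and $G\times\mathfrak e\to\mathfrak e$ are also written $\partial$ and $\triangleright$. Let $\pi\colon P\to M$ be a smooth principal $G$-bundle (right action, $R_g(p)=pg$) and let $(\omega,m)$ be a $\mathcal G$-categorical connection on $P$, that is: $\omega$ is a smooth $\mathfrak g$-valued connection $1$-form on $P$ ($R_g^*\omega=g^{-1}\omega g$ and $\omega(A^\#)=A$ for $A\in\mathfrak g$, where $A^\#$ is the associated vertical vector field), and $m$ is a smooth $\mathfrak e$-valued $2$-form on $P$ with $R_g^*m=g^{-1}\triangleright m$, $m(X,Y)=m(X^H,Y^H)$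 (where $X^H=X-\omega(X)^\#$ is the horizontal projection), and $\partial(m)=d\omega+\tfrac12\,\omega\wedge^{\mathrm{ad}}\omega$, i.e. $\partial(m(X,Y))=d\omega(X,Y)+[\omega(X),\omega(Y)]$. Its 2-curvature $3$-form is $\mathcal M=Dm$, $\mathcal M(X,Y,Z)=dm(X^H,Y^H,Z^H)$. For $X\in T_{\pi(p)}M$ let $\widetilde X\in T_pP$ be the horizontal lift, and for a (piecewise) smooth curve $\gamma\colon[0,1]\to M$ and $u\in P_{\gamma(0)}$ let $t\mapsto\mathcal H_\omega(\gamma,t,u)$ be the horizontal lift of $\gamma$ starting at $u$. **Theorem.** Let $J\colon[0,1]^3\to M$ be a smooth map and write $J(t,s,x)=\Gamma^x(t,s)=\gamma^x_s(t)=\gamma^{x,t}(s)$. Put $q(x)=\Gamma^x(0,0)$, choose $u\in P_{q(0)}$, and let $u(x)=\mathcal H_\omega(q,x,u)$ and $u(x,s)=\mathcal H_\omega(\gamma^{x,0},s,u(x))$. For each $x\in[0,1]$ the initial value problem $$\frac{\partial}{\partial s}e_{\Gamma^x}(s)=e_{\Gamma^x}(s)\int_0^1 m\Big(\widetilde{\tfrac{\partial}{\partial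 t}\gamma^x_s(t)},\widetilde{\tfrac{\partial}{\partial s}\gamma^x_s(t)}\Big)_{\mathcal H_\omega(\gamma^x_s,t,u(x,s))}dt,\qquad e_{\Gamma^x}(0)=1_E,$$ has a solution $s\mapsto e_{\Gamma^x}(s)\in E$ on $[0,1]$; write $e_{\Gamma^x}=e_{\Gamma^x}(1)$. Let $\hat\gamma^x=\partial\Gamma^x\colon[0,1]\to M$ be the boundary loop of $\Gamma^x$, starting at $\Gamma^x(0,0)$ and oriented clockwise: it runs successively along $s\mapsto\Gamma^x(0,s)$, $t\mapsto\Gamma^x(t,1)$, the reverse of $s\mapsto\Gamma^x(1,s)$ and the reverse of $t\mapsto\Gamma^x(t,0)$, each on a quarter of $[0,1]$. Then for every $x\in[0,1]$ the function $x\mapsto e_{\Gamma^x}$ is differentiable at $x$ (one-sidedly at the end points), the integrand of the double integral below is continuous in $(t,s)\in[0,1]^2$, the integrand of the boundary integral is integrable, and $$\frac{d}{dx}e_{\Gamma^x}=e_{\Gamma^x}\left(\int_0^1\!\!\int_0^1\mathcal M\Big(\widetilde{\tfrac{\partial}{\partial x}\gamma^x_s(t)},\widetilde{\tfrac{\partial}{\partial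 t}\gamma^x_s(t)},\widetilde{\tfrac{\partial}{\partial s}\gamma^x_s(t)}\Big)_{\mathcal H_\omega(\gamma^x_s,t,u(x,s))}dt\,ds+\int_0^1 m\Big(\widetilde{\tfrac{\partial}{\partial n}\hat\gamma^x(n)},\widetilde{\tfrac{\partial}{\partial x}\hat\gamma^x(n)}\Big)_{\mathcal H_\omega(\hat\gamma^x,n,u(x))}dn\right).$$ Here $eA\in T_eE$ denotes the left translate of $A\in\mathfrak e=T_{1}E$ by $e\in E$. -/

import Mathlib

open Set MeasureTheory
open scoped Manifold ContDiff RightActions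

noncomputable section

/-! Conventions.  All manifolds are modelled on finite-dimensional real normed spaces.  For a Lie
group `G` modelled on `𝔤`, the Lie algebra `T₁G = GroupLieAlgebra 𝓘(ℝ, 𝔤) G` is by definition the
model space `𝔤`; we write `𝔤` for it when a norm is needed (integrals, differentiability). -/

section Lie

variable {𝔤 : Type*} [NormedAddCommGroup 𝔤] [NormedSpace ℝ 𝔤]
  {G : Type*} [TopologicalSpace G] [ChartedSpace 𝔤 G] [Group G]
  {𝔢 : Type*} [NormedAddCommGroup 𝔢] [NormedSpace ℝ 𝔢]
  {E : Type*} [TopologicalSpace E] [ChartedSpace 𝔢 E] [Group E]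

variable (G) in
/-- The Lie bracket of `𝔤 = T₁G`, computed from left invariant vector fields. -/
def lieBr (X Y : 𝔤) : 𝔤 :=
  Bracket.bracket (L := GroupLieAlgebra 𝓘(ℝ, 𝔤) G) (M := GroupLieAlgebra 𝓘(ℝ, 𝔤) G) X Y

/-- The adjoint action `X ↦ g X g⁻¹` of `G` on its Lie algebra. -/
def lieAd (g : G) (X : 𝔤) : 𝔤 :=
  mfderiv 𝓘(ℝ, 𝔤) 𝓘(ℝ, 𝔤) (fun h : G => g * h * g⁻¹) 1 X

/-- The tangent vector `a X ∈ T_a G`, the left translate of `X ∈ 𝔤 = T₁G` by `a ∈ G`. -/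
def leftMul (a : G) (X : 𝔤) : TangentSpace 𝓘(ℝ, 𝔤) a :=
  mulInvariantVectorField (I := 𝓘(ℝ, 𝔤)) (G := G) X a

/-- The Lie algebra map `𝔢 → 𝔤` induced by a group morphism `∂ : E → G`. -/
def lieMap (d : E →* G) (v : 𝔢) : 𝔤 :=
  mfderiv 𝓘(ℝ, 𝔢) 𝓘(ℝ, 𝔤) (fun e : E => d e) 1 v

variable (E) in
/-- The action `g ▷ v` of `G` on the Lie algebra `𝔢` of `E` induced by an action of `G` on `E`. -/
def lieAct [MulDistribMulAction G E] (g : G) (v : 𝔢) : 𝔢 :=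
  mfderiv 𝓘(ℝ, 𝔢) 𝓘(ℝ, 𝔢) (fun e : E => g • e) 1 v

/-- `(∂ : E → G, ▷)` is a Lie crossed module; the left action `g ▷ e = g • e` of `G` on `E` by
automorphisms is the `MulDistribMulAction`. -/
structure IsLieCrossedModule [MulDistribMulAction G E] (d : E →* G) : Prop where
  smooth_map : ContMDiff 𝓘(ℝ, 𝔢) 𝓘(ℝ, 𝔤) ∞ (fun e : E => d e)
  smooth_act : ContMDiff (𝓘(ℝ, 𝔤).prod 𝓘(ℝ, 𝔢)) 𝓘(ℝ, 𝔢) ∞ (fun z : G × E => z.1 • z.2)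
  equivariant : ∀ (g : G) (e : E), d (g • e) = g * d e * g⁻¹
  peiffer : ∀ e f : E, d e • f = e * f * e⁻¹

end Lie

section Forms

variable {EP : Type*} [NormedAddCommGroup EP] [NormedSpace ℝ EP]
  {V : Type*} [NormedAddCommGroup V] [NormedSpace ℝ V]

variable (EP) in
/-- (Not necessarily smooth) `V`-valued differential `n`-forms on a manifold `P`. -/
abbrev PreForm (P : Type*) [TopologicalSpace P] [ChartedSpace EP P] (n : ℕ)
    (V : Type*) [NormedAddCommGroup V] [NormedSpace ℝ V] :=
  ∀ p : P, TangentSpace 𝓘(ℝ, EP) p [⋀^Fin n]→L[ℝ] V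

variable {P : Type*} [TopologicalSpace P] [ChartedSpace EP P] {n : ℕ}

/-- The expression of a form in a chart `φ`: the pullback of the form by `φ⁻¹`. -/
def chartRep (α : PreForm EP P n V) (φ : OpenPartialHomeomorph P EP) :
    EP → EP [⋀^Fin n]→L[ℝ] V :=
  fun y => (α (φ.symm y)).compContinuousLinearMap
    (mfderiv 𝓘(ℝ, EP) 𝓘(ℝ, EP) φ.symm y :
      EP →L[ℝ] TangentSpace 𝓘(ℝ, EP) (φ.symm y))

/-- A form is smooth if it is smooth in every chart of the atlas. -/
def IsSmoothForm (α : PreForm EP P n V) : Prop :=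
  ∀ φ ∈ atlas EP P, ContDiffOn ℝ ∞ (chartRep α φ) φ.target

/-- The exterior derivative, with the convention
`dα(X₀, …, Xₙ) = ∑ (-1)ⁱ Xᵢ α(…) + ⋯`, computed at `p` in the preferred chart at `p`. -/
def extD (α : PreForm EP P n V) : PreForm EP P (n + 1) V :=
  fun p => (extDeriv (chartRep α (chartAt EP p)) (chartAt EP p p)).compContinuousLinearMap
    (mfderiv 𝓘(ℝ, EP) 𝓘(ℝ, EP) (chartAt EP p) p :
      TangentSpace 𝓘(ℝ, EP) p →L[ℝ] EP)

end Forms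

section Bundle

variable {𝔤 : Type*} [NormedAddCommGroup 𝔤] [NormedSpace ℝ 𝔤]
  {G : Type*} [TopologicalSpace G] [ChartedSpace 𝔤 G] [Group G]
  {𝔢 : Type*} [NormedAddCommGroup 𝔢] [NormedSpace ℝ 𝔢]
  {E : Type*} [TopologicalSpace E] [ChartedSpace 𝔢 E] [Group E]
  {EM : Type*} [NormedAddCommGroup EM] [NormedSpace ℝ EM]
  {M : Type*} [TopologicalSpace M] [ChartedSpace EM M]
  {EP : Type*} [NormedAddCommGroup EP] [NormedSpace ℝ EP]
  {P : Type*} [TopologicalSpace P] [ChartedSpace EP P]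

variable (G) in
/-- `π : P → M` is a smooth principal `G`-bundle, for the right action `p <• g` of `G` on `P`. -/
structure IsPrincipalBundle [MulAction Gᵐᵒᵖ P] (π : P → M) : Prop where
  smooth_proj : ContMDiff 𝓘(ℝ, EP) 𝓘(ℝ, EM) ∞ π
  smooth_act : ContMDiff (𝓘(ℝ, EP).prod 𝓘(ℝ, 𝔤)) 𝓘(ℝ, EP) ∞ (fun z : P × G => z.1 <• z.2)
  proj_act : ∀ (p : P) (g : G), π (p <• g) = π p
  locally_trivial : ∀ x : M, ∃ U : Set M, x ∈ U ∧ IsOpen U ∧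
    ∃ Φ : PartialDiffeomorph 𝓘(ℝ, EP) (𝓘(ℝ, EM).prod 𝓘(ℝ, 𝔤)) P (M × G) ∞,
      Φ.source = π ⁻¹' U ∧ Φ.target = U ×ˢ univ ∧
      ∀ p ∈ π ⁻¹' U, (Φ p).1 = π p ∧ ∀ g : G, Φ (p <• g) = ((Φ p).1, (Φ p).2 * g)

variable (G) in
/-- The value at `p` of the vertical vector field `A^#` associated with `A ∈ 𝔤`. -/
def fundVec [MulAction Gᵐᵒᵖ P] (A : 𝔤) (p : P) : TangentSpace 𝓘(ℝ, EP) p :=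
  (mfderiv 𝓘(ℝ, 𝔤) 𝓘(ℝ, EP) (fun g : G => p <• g) 1 A : EP)

/-- The push-forward `(R_g)_* X` of a tangent vector `X` by right translation by `g`. -/
def rightPush [MulAction Gᵐᵒᵖ P] (g : G) (p : P) (X : TangentSpace 𝓘(ℝ, EP) p) :
    TangentSpace 𝓘(ℝ, EP) (p <• g) :=
  mfderiv 𝓘(ℝ, EP) 𝓘(ℝ, EP) (fun q : P => q <• g) p X

variable (G) in
/-- The horizontal projection `X^H = X - η(X)^#`. -/
def horProj [MulAction Gᵐᵒᵖ P] (η : PreForm EP P 1 𝔤) (p : P) (X : TangentSpace 𝓘(ℝ, EP) p) :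
    TangentSpace 𝓘(ℝ, EP) p :=
  X - fundVec G (η p ![X]) p

/-- `η` is a connection 1-form on `P`. -/
structure IsConnectionForm [MulAction Gᵐᵒᵖ P] (η : PreForm EP P 1 𝔤) : Prop where
  smooth : IsSmoothForm η
  equivariant : ∀ (g : G) (p : P) (X : TangentSpace 𝓘(ℝ, EP) p),
    η (p <• g) ![rightPush g p X] = lieAd g⁻¹ (η p ![X])
  vertical : ∀ (A : 𝔤) (p : P), η p ![fundVec G A p] = A

variable (G) in
/-- The curvature `Ω = dη + ½ η ∧^ad η`, where
`(η ∧^ad η)(X, Y) = [η(X), η(Y)] - [η(Y), η(X)]`. -/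
def curvature (η : PreForm EP P 1 𝔤) (p : P) (X Y : TangentSpace 𝓘(ℝ, EP) p) : 𝔤 :=
  extD η p ![X, Y] +
    (1 / 2 : ℝ) • (lieBr G (η p ![X]) (η p ![Y]) - lieBr G (η p ![Y]) (η p ![X]))

/-- `(η, m)` is a categorical connection on `P` for the Lie crossed module `(∂ : E → G, ▷)`. -/
structure IsCategoricalConnection [MulAction Gᵐᵒᵖ P] [MulDistribMulAction G E] (d : E →* G)
    (η : PreForm EP P 1 𝔤) (m : PreForm EP P 2 𝔢) : Prop where
  connection : IsConnectionForm (G := G) η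
  smooth : IsSmoothForm m
  equivariant : ∀ (g : G) (p : P) (X Y : TangentSpace 𝓘(ℝ, EP) p),
    m (p <• g) ![rightPush g p X, rightPush g p Y] = lieAct E g⁻¹ (m p ![X, Y])
  horizontal : ∀ (p : P) (X Y : TangentSpace 𝓘(ℝ, EP) p),
    m p ![X, Y] = m p ![horProj G η p X, horProj G η p Y]
  fake_curvature : ∀ (p : P) (X Y : TangentSpace 𝓘(ℝ, EP) p),
    lieMap d (m p ![X, Y]) = curvature G η p X Y

variable (G) in
/-- The 2-curvature 3-form `Dm = dm ∘ (H × H × H)` (written as a function of three vectors). -/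
def twoCurvature [MulAction Gᵐᵒᵖ P] (η : PreForm EP P 1 𝔤) (m : PreForm EP P 2 𝔢) (p : P)
    (X Y Z : TangentSpace 𝓘(ℝ, EP) p) : 𝔢 :=
  extD m p ![horProj G η p X, horProj G η p Y, horProj G η p Z]

end Bundle

section Transport

variable {𝔤 : Type*} [NormedAddCommGroup 𝔤] [NormedSpace ℝ 𝔤]
  {𝔢 : Type*} [NormedAddCommGroup 𝔢] [NormedSpace ℝ 𝔢]
  {E : Type*} [TopologicalSpace E] [ChartedSpace 𝔢 E] [Group E]
  {EM : Type*} [NormedAddCommGroup EM] [NormedSpace ℝ EM]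
  {M : Type*} [TopologicalSpace M] [ChartedSpace EM M]
  {EP : Type*} [NormedAddCommGroup EP] [NormedSpace ℝ EP]
  {P : Type*} [TopologicalSpace P] [ChartedSpace EP P]

/-- A curve `c` defined on `[0,1]` has velocity `v` at time `t ∈ [0,1]`
(one-sided at the end points). -/
def HasVelocityAt {F : Type*} [NormedAddCommGroup F] [NormedSpace ℝ F]
    {N : Type*} [TopologicalSpace N] [ChartedSpace F N] (c : ℝ → N) (t : ℝ)
    (v : TangentSpace 𝓘(ℝ, F) (c t)) : Prop :=
  HasMFDerivWithinAt 𝓘(ℝ, ℝ) 𝓘(ℝ, F) c (Icc (0 : ℝ) 1) t ((1 : ℝ →L[ℝ] ℝ).smulRight v)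

variable (EM) in
/-- The velocity of a curve defined on `[0,1]` (one-sided at the end points). -/
def velocity (c : ℝ → M) (t : ℝ) : TangentSpace 𝓘(ℝ, EM) (c t) :=
  mfderivWithin 𝓘(ℝ, ℝ) 𝓘(ℝ, EM) c (Icc (0 : ℝ) 1) t (1 : ℝ)

/-- The horizontal lift at `p ∈ P` of a vector `X ∈ T_{π(p)} M`: the unique `v ∈ T_p P` which
projects to `X` and satisfies `η(v) = 0`. -/
def horLift (π : P → M) (η : PreForm EP P 1 𝔤) (p : P) (X : TangentSpace 𝓘(ℝ, EM) (π p)) :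
    TangentSpace 𝓘(ℝ, EP) p :=
  Classical.epsilon fun v : TangentSpace 𝓘(ℝ, EP) p =>
    mfderiv 𝓘(ℝ, EP) 𝓘(ℝ, EM) π p v = X ∧ η p ![v] = 0

/-- `h` is the parallel transport of `u` along the curve `γ : [0,1] → M`: it starts at `u`, lies
over `γ`, and its velocity is the horizontal lift of the velocity of `γ`. -/
structure IsParallelTransport (π : P → M) (η : PreForm EP P 1 𝔤) (γ : ℝ → M) (u : P)
    (h : ℝ → P) : Prop where
  start : h 0 = u
  lies_over : ∀ t ∈ Icc (0 : ℝ) 1, π (h t) = γ t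
  hasVelocity : ∀ t ∈ Icc (0 : ℝ) 1,
    HasVelocityAt h t (horLift π η (h t) (velocity EM γ t : EM))

/-- Parallel transport `𝓗(γ, t, u)` along a smooth curve `γ : [0,1] → M`, `u ∈ P_{γ(0)}`. -/
def parTransport (π : P → M) (η : PreForm EP P 1 𝔤) (γ : ℝ → M) (t : ℝ) (u : P) : P :=
  @Classical.epsilon (ℝ → P) ⟨fun _ => u⟩ (fun h => IsParallelTransport (EM := EM) π η γ u h) t

/-- For a square `Γ(t,s)` and `u` over `Γ(0,0)`, the point `𝓗(γ_s, t, u_s)`, where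
`γ_s(t) = γ^t(s) = Γ(t,s)` and `u_s = 𝓗(γ^0, s, u)`. -/
def squareLift (π : P → M) (η : PreForm EP P 1 𝔤) (Γ : ℝ → ℝ → M) (u : P) (t s : ℝ) : P :=
  parTransport (EM := EM) π η (fun t' => Γ t' s) t
    (parTransport (EM := EM) π η (fun s' => Γ 0 s') s u)

/-- `m(∂γ_s/∂t ~, ∂γ_s/∂s ~)` at `𝓗(γ_s, t, u_s)`. -/
def surfIntegrand (π : P → M) (η : PreForm EP P 1 𝔤) (m : PreForm EP P 2 𝔢) (Γ : ℝ → ℝ → M)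
    (u : P) (t s : ℝ) : 𝔢 :=
  m (squareLift (EM := EM) π η Γ u t s)
    ![horLift π η _ (velocity EM (fun t' => Γ t' s) t : EM),
      horLift π η _ (velocity EM (fun s' => Γ t s') s : EM)]

/-- The map `e : [0,1] → E` solves `∂e/∂s = e(s) ∫₀¹ m(∂γ_s/∂t ~, ∂γ_s/∂s ~) dt`, `e(0) = 1`. -/
structure IsCatHolonomy (π : P → M) (η : PreForm EP P 1 𝔤) (m : PreForm EP P 2 𝔢)
    (Γ : ℝ → ℝ → M) (u : P) (e : ℝ → E) : Prop where
  start : e 0 = 1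
  hasVelocity : ∀ s ∈ Icc (0 : ℝ) 1, HasVelocityAt e s
    (leftMul (e s) (∫ t in (0 : ℝ)..1, surfIntegrand (EM := EM) π η m Γ u t s))

variable (E) in
/-- The categorical holonomy `e_Γ(s)` of a smooth square `Γ`, based at `u ∈ P_{Γ(0,0)}`. -/
def catHolonomy (π : P → M) (η : PreForm EP P 1 𝔤) (m : PreForm EP P 2 𝔢) (Γ : ℝ → ℝ → M)
    (u : P) (s : ℝ) : E :=
  Classical.epsilon (fun e : ℝ → E => IsCatHolonomy (EM := EM) π η m Γ u e) s

/-- The clockwise boundary loop `∂Γ : [0,1] → M` of a square, starting at `Γ(0,0)`: up the left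
edge, along the top edge, down the right edge, back along the bottom edge. -/
def boundaryLoop (Γ : ℝ → ℝ → M) (n : ℝ) : M :=
  if n ≤ 1 / 4 then Γ 0 (4 * n)
  else if n ≤ 1 / 2 then Γ (4 * n - 1) 1
  else if n ≤ 3 / 4 then Γ 1 (3 - 4 * n)
  else Γ (4 - 4 * n) 0

/-- Parallel transport `𝓗(∂Γ, n, u)` along the (piecewise smooth) loop `∂Γ`: transport along the
four smooth edges in succession. -/
def boundaryTransport (π : P → M) (η : PreForm EP P 1 𝔤) (Γ : ℝ → ℝ → M) (n : ℝ) (u : P) : P :=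
  let T : (ℝ → M) → ℝ → P → P := parTransport (EM := EM) π η
  let left : ℝ → M := fun r => Γ 0 r
  let top : ℝ → M := fun r => Γ r 1
  let right : ℝ → M := fun r => Γ 1 (1 - r)
  let bottom : ℝ → M := fun r => Γ (1 - r) 0
  if n ≤ 1 / 4 then T left (4 * n) u
  else if n ≤ 1 / 2 then T top (4 * n - 1) (T left 1 u)
  else if n ≤ 3 / 4 then T right (4 * n - 2) (T top 1 (T left 1 u))
  else T bottom (4 * n - 3) (T right 1 (T top 1 (T left 1 u)))

/-- The square `Γ^x(t,s) = J(t,s,x)` of a map `J : [0,1]³ → M`. -/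
def slice (J : ℝ × ℝ × ℝ → M) (x : ℝ) (t s : ℝ) : M := J (t, s, x)

/-- The moving base point `u(x) = 𝓗(q, x, u)` over `q(x) = J(0,0,x)`. -/
def basePt (π : P → M) (η : PreForm EP P 1 𝔤) (J : ℝ × ℝ × ℝ → M) (u : P) (x : ℝ) : P :=
  parTransport (EM := EM) π η (fun x' => slice J x' 0 0) x u

variable (E) in
/-- `e_{Γ^x}(s)`, based at `u(x)`. -/
def catHolFamily (π : P → M) (η : PreForm EP P 1 𝔤) (m : PreForm EP P 2 𝔢)
    (J : ℝ × ℝ × ℝ → M) (u : P) (x s : ℝ) : E :=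
  catHolonomy (EM := EM) E π η m (slice J x) (basePt (EM := EM) π η J u x) s

variable {G : Type*} [TopologicalSpace G] [ChartedSpace 𝔤 G] [Group G]

variable (G) in
/-- `𝓜(∂γ_s^x/∂x ~, ∂γ_s^x/∂t ~, ∂γ_s^x/∂s ~)` at `𝓗(γ_s^x, t, u(x,s))`. -/
def volIntegrand [MulAction Gᵐᵒᵖ P] (π : P → M) (η : PreForm EP P 1 𝔤) (m : PreForm EP P 2 𝔢)
    (J : ℝ × ℝ × ℝ → M) (u : P) (x t s : ℝ) : 𝔢 :=
  twoCurvature G η m (squareLift (EM := EM) π η (slice J x) (basePt (EM := EM) π η J u x) t s)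
    (horLift π η _ (velocity EM (fun x' => slice J x' t s) x : EM))
    (horLift π η _ (velocity EM (fun t' => slice J x t' s) t : EM))
    (horLift π η _ (velocity EM (fun s' => slice J x t s') s : EM))

/-- `m(∂γ̂^x/∂n ~, ∂γ̂^x/∂x ~)` at `𝓗(γ̂^x, n, u(x))`, where `γ̂^x = ∂Γ^x`. -/
def bdryIntegrand (π : P → M) (η : PreForm EP P 1 𝔤) (m : PreForm EP P 2 𝔢)
    (J : ℝ × ℝ × ℝ → M) (u : P) (x n : ℝ) : 𝔢 :=
  m (boundaryTransport (EM := EM) π η (slice J x) n (basePt (EM := EM) π η J u x))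
    ![horLift π η _ (velocity EM (fun n' => boundaryLoop (slice J x) n') n : EM),
      horLift π η _ (velocity EM (fun x' => boundaryLoop (slice J x') n) x : EM)]

end Transport

end

/-!
The derivative of `x ↦ e_{Γ^x}` is computed on a lift `F` of the cube `J` to `P` (`IsCubeLift`): `F`
is horizontal along `t`, on the face `t = 0` also along `s`, and on the edge `t = s = 0` along `x`,
so the surface and volume integrands are evaluated at the points `F(t, s, x)`. Write `μ_ts`,
`μ_tx`, `μ_sx` and `A_s`, `A_x` for the components of `F^* m` and `F^* η`; the component `A_t`
vanishes.

*The derivative.* The holonomy solves `∂ₛe = e K` with `K(s, x) = ∫₀¹ μ_ts dt`. It depends smoothly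
on `x`, and by Duhamel's formula `e⁻¹ ∂ₓe = Ad(e(1)⁻¹) ∫₀¹ Ad(e(s)) ∂ₓK ds`; see
`exists_isLogSol_of_small` for the local solution in a chart, `hasLog_duhamel` for the formula, and
`exists_contMDiffOn_isLogSol`. The same result gives smooth families of horizontal lifts
(`exists_isHorFamily`), and thereby `F`.

*The 2-curvature.* The pullback `V` of `Dm` on horizontal projections is the covariant exterior
derivative of `F^* m`, namely
`V = ∂ₓμ_ts + A_x ▷ μ_ts + ∂ₜμ_sx - ∂ₛμ_tx - A_s ▷ μ_tx`, and `∂(V) = 0`. Both facts hold at a point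
after a gauge transformation that makes the pulled back connection form vanish there
(`IsCategoricalConnection.pullHor_eq`). Integration of the fake curvature condition
`∂(m) = dη + ½ [η ∧ η]` gives `A_s = ∂ ∫₀ᵗ μ_ts` and `A_x = ∂ (∫₀ᵗ μ_tx + ∫₀ˢ μ_sx(0, ·))`. By the
Peiffer identity `∂(a)` acts on `𝔢` as the bracket with `a`, so with
`β = ∫₀¹ μ_tx dt + ∫₀ˢ μ_sx(0, ·)` integration over `t` yields
`∂ₓK = ∫₀¹ V dt - μ_sx(1, ·) + [K, β] + ∂ₛβ` (`IsCubeData.prim_vol`).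

*Integration over `s`.* Elements of `ker ∂` are central, so `Ad(e)` fixes `∫₀¹ V dt`
(`IsLogSol.adT_eq_self`), while `Ad(e)([K, β] + ∂ₛβ) = ∂ₛ(Ad(e) β)`. The derivative is therefore the
integral of `V` over the square plus integrals of `m` over the four edges
(`IsCubeData.integral_adT`).

*The boundary.* The horizontal lift of the boundary loop is `F` along the left and top edges,
`F(1, s, x) ∂(e(s))⁻¹ ∂(e(1))` along the right edge (`IsCubeLift.isHorizontal_right`) and
`F(t, 0, x) ∂(e(1))` along the bottom edge. By equivariance of `m` and the Peiffer identity the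
boundary integral is the sum of these four edge terms (`IsCubeLift.integral_bdryIntegrand`).
-/

noncomputable section

set_option linter.unusedSectionVars false

/-! ### Derivatives of maps from normed spaces to manifolds -/
section TangentMaps

variable {X : Type*} [NormedAddCommGroup X] [NormedSpace ℝ X]
  {X' : Type*} [NormedAddCommGroup X'] [NormedSpace ℝ X']
  {F : Type*} [NormedAddCommGroup F] [NormedSpace ℝ F]
  {N : Type*} [TopologicalSpace N] [ChartedSpace F N]
  {F₁ : Type*} [NormedAddCommGroup F₁] [NormedSpace ℝ F₁]
  {N₁ : Type*} [TopologicalSpace N₁] [ChartedSpace F₁ N₁]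
  {F₂ : Type*} [NormedAddCommGroup F₂] [NormedSpace ℝ F₂]
  {N₂ : Type*} [TopologicalSpace N₂] [ChartedSpace F₂ N₂]

variable (F F₁) in
/-- The tangent map of `f : N → N₁` at `p`, as a linear map between the model spaces. -/
def tmap (f : N → N₁) (p : N) : F →L[ℝ] F₁ := mfderiv 𝓘(ℝ, F) 𝓘(ℝ, F₁) f p

/-- `f : X → N` has derivative `f'` at `x` within `s`; the tangent space of `N` at `f x` is
identified with the model space `F` by the preferred chart at `f x`. -/
def HasTDeriv (f : X → N) (s : Set X) (x : X) (f' : X →L[ℝ] F) : Prop :=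
  HasMFDerivWithinAt 𝓘(ℝ, X) 𝓘(ℝ, F) f s x f'

theorem HasTDeriv.continuousWithinAt {f : X → N} {s : Set X} {x : X} {f' : X →L[ℝ] F}
    (h : HasTDeriv f s x f') : ContinuousWithinAt f s x :=
  HasMFDerivWithinAt.continuousWithinAt h

theorem hasTDeriv_iff_hasFDerivWithinAt {f : X → F} {s : Set X} {x : X} {f' : X →L[ℝ] F} :
    HasTDeriv f s x f' ↔ HasFDerivWithinAt f f' s x :=
  hasMFDerivWithinAt_iff_hasFDerivWithinAt

theorem HasTDeriv.mono {f : X → N} {s t : Set X} {x : X} {f' : X →L[ℝ] F}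
    (h : HasTDeriv f s x f') (hst : t ⊆ s) : HasTDeriv f t x f' :=
  HasMFDerivWithinAt.mono h hst

theorem HasTDeriv.mono_of_mem {f : X → N} {s t : Set X} {x : X} {f' : X →L[ℝ] F}
    (h : HasTDeriv f s x f') (hst : s ∈ nhdsWithin x t) : HasTDeriv f t x f' :=
  HasMFDerivWithinAt.mono_of_mem_nhdsWithin h hst

theorem HasTDeriv.congr_of_eventuallyEq {f g : X → N} {s : Set X} {x : X} {f' : X →L[ℝ] F}
    (h : HasTDeriv f s x f') (hfg : g =ᶠ[nhdsWithin x s] f) (hx : g x = f x) :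
    HasTDeriv g s x f' :=
  HasMFDerivWithinAt.congr_of_eventuallyEq h hfg hx

theorem HasTDeriv.congr {f g : X → N} {s : Set X} {x : X} {f' : X →L[ℝ] F}
    (h : HasTDeriv f s x f') (hfg : EqOn g f s) (hx : x ∈ s) : HasTDeriv g s x f' :=
  h.congr_of_eventuallyEq (hfg.eventuallyEq_of_mem self_mem_nhdsWithin) (hfg hx)

theorem HasTDeriv.congr_deriv {f : X → N} {s : Set X} {x : X} {f' f'' : X →L[ℝ] F}
    (h : HasTDeriv f s x f') (e : f' = f'') : HasTDeriv f s x f'' := e ▸ h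

theorem HasTDeriv.unique {f : X → N} {s : Set X} {x : X} {f' f'' : X →L[ℝ] F}
    (h : HasTDeriv f s x f') (h' : HasTDeriv f s x f'') (hs : UniqueDiffWithinAt ℝ s x) :
    f' = f'' :=
  UniqueMDiffWithinAt.eq (uniqueMDiffWithinAt_iff_uniqueDiffWithinAt.2 hs) h h'

theorem HasTDeriv.comp_tmap {f : X → N} {s : Set X} {x : X} {f' : X →L[ℝ] F}
    (h : HasTDeriv f s x f') {g : N → N₁} (hg : MDifferentiableAt 𝓘(ℝ, F) 𝓘(ℝ, F₁) g (f x)) :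
    HasTDeriv (fun y => g (f y)) s x ((tmap F F₁ g (f x)).comp f') :=
  HasMFDerivAt.comp_hasMFDerivWithinAt x hg.hasMFDerivAt h

theorem HasTDeriv.comp_hasFDerivWithinAt {f : X → N} {s : Set X} {f' : X →L[ℝ] F}
    {φ : X' → X} {t : Set X'} {y : X'} {φ' : X' →L[ℝ] X}
    (h : HasTDeriv f s (φ y) f') (hφ : HasFDerivWithinAt φ φ' t y) (hm : MapsTo φ t s) :
    HasTDeriv (fun y => f (φ y)) t y (f'.comp φ') :=
  HasMFDerivWithinAt.comp (I' := 𝓘(ℝ, X)) y h (hasMFDerivWithinAt_iff_hasFDerivWithinAt.2 hφ) hm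

theorem hasTDeriv_const (c : N) (s : Set X) (x : X) :
    HasTDeriv (fun _ : X => c) s x (0 : X →L[ℝ] F) :=
  hasMFDerivWithinAt_const c s x

variable (F) in
/-- The derivative of `f : X → N` at `x` within `s`, as a linear map to the model space of `N`. -/
def tmapWithin (f : X → N) (s : Set X) (x : X) : X →L[ℝ] F :=
  mfderivWithin 𝓘(ℝ, X) 𝓘(ℝ, F) f s x

theorem ContMDiffWithinAt.hasTDeriv {f : X → N} {s : Set X} {x : X} {n : WithTop ℕ∞}
    (h : ContMDiffWithinAt 𝓘(ℝ, X) 𝓘(ℝ, F) n f s x) (hn : n ≠ 0) :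
    HasTDeriv f s x (tmapWithin F f s x) :=
  (h.mdifferentiableWithinAt hn).hasMFDerivWithinAt

theorem tmap_comp {f : N → N₁} {g : N₁ → N₂} {p : N}
    (hg : MDifferentiableAt 𝓘(ℝ, F₁) 𝓘(ℝ, F₂) g (f p))
    (hf : MDifferentiableAt 𝓘(ℝ, F) 𝓘(ℝ, F₁) f p) :
    tmap F F₂ (fun q => g (f q)) p = (tmap F₁ F₂ g (f p)).comp (tmap F F₁ f p) :=
  mfderiv_comp p hg hf

theorem tmap_id (p : N) : tmap F F (fun q : N => q) p = ContinuousLinearMap.id ℝ F :=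
  mfderiv_id

theorem tmap_const (c : N₁) (p : N) : tmap F F₁ (fun _ : N => c) p = 0 :=
  mfderiv_const

/-- The product rule for a map of two variables. -/
theorem HasTDeriv.map₂ {f : X → N} {g : X → N₁} {s : Set X} {x : X} {f' : X →L[ℝ] F}
    {g' : X →L[ℝ] F₁} (hf : HasTDeriv f s x f') (hg : HasTDeriv g s x g') {μ : N × N₁ → N₂}
    (hμ : MDifferentiableAt (𝓘(ℝ, F).prod 𝓘(ℝ, F₁)) 𝓘(ℝ, F₂) μ (f x, g x)) :
    HasTDeriv (fun y => μ (f y, g y)) s x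
      ((tmap F F₂ (fun p => μ (p, g x)) (f x)).comp f' +
        (tmap F₁ F₂ (fun q => μ (f x, q)) (g x)).comp g') := by
  have h1 : HasMFDerivWithinAt 𝓘(ℝ, X) (𝓘(ℝ, F).prod 𝓘(ℝ, F₁)) (fun y => (f y, g y)) s x
      (f'.prod g') := HasMFDerivWithinAt.prodMk hf hg
  have h2 := HasMFDerivAt.comp_hasMFDerivWithinAt x hμ.hasMFDerivAt h1
  refine HasMFDerivWithinAt.congr_mfderiv h2 ?_
  rw [mfderiv_prod_eq_add_comp hμ]
  rfl

/-- The inverse of the preferred chart at `p` has the identity as derivative at the image of `p`,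
since the tangent space at `p` is identified with the model space by this chart. -/
theorem hasTDeriv_extChartAt_symm [IsManifold 𝓘(ℝ, F) ∞ N] (p : N) :
    HasTDeriv (fun y : F => (extChartAt 𝓘(ℝ, F) p).symm y) univ (extChartAt 𝓘(ℝ, F) p p)
      (ContinuousLinearMap.id ℝ F) := by
  have : IsManifold 𝓘(ℝ, F) 1 N := IsManifold.of_le (n := ∞) (by simp)
  have h2 := (mdifferentiableWithinAt_extChartAt_symm (I := 𝓘(ℝ, F)) (x := p)
    (mem_extChartAt_target p)).hasMFDerivWithinAt
  rw [mfderivWithin_range_extChartAt_symm, ModelWithCorners.range_eq_univ] at h2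
  exact h2

end TangentMaps

/-! ### Left logarithmic derivatives -/
section LieCalculus

variable {X : Type*} [NormedAddCommGroup X] [NormedSpace ℝ X]
  {X' : Type*} [NormedAddCommGroup X'] [NormedSpace ℝ X']
  {𝔤 : Type*} [NormedAddCommGroup 𝔤] [NormedSpace ℝ 𝔤]
  {G : Type*} [TopologicalSpace G] [ChartedSpace 𝔤 G] [Group G]

variable (𝔤) in
/-- The linear isomorphism `X ↦ g X` from `𝔤 = T₁G` to `T_g G`. -/
def leftT (g : G) : 𝔤 →L[ℝ] 𝔤 := tmap 𝔤 𝔤 (fun h : G => g * h) 1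

variable (𝔤) in
/-- The adjoint action of `g` as a continuous linear map. -/
def adT (g : G) : 𝔤 →L[ℝ] 𝔤 := tmap 𝔤 𝔤 (fun h : G => g * h * g⁻¹) 1

/-- `ℓ` is the left logarithmic derivative `f⁻¹ df` of `f : X → G` at `x` within `s`. -/
def HasLog (f : X → G) (s : Set X) (x : X) (ℓ : X →L[ℝ] 𝔤) : Prop :=
  HasTDeriv f s x ((leftT 𝔤 (f x)).comp ℓ)

variable [LieGroup 𝓘(ℝ, 𝔤) ∞ G]

variable (𝔤) in
theorem mdiff_mul (p : G × G) :
    MDifferentiableAt (𝓘(ℝ, 𝔤).prod 𝓘(ℝ, 𝔤)) 𝓘(ℝ, 𝔤) (fun p : G × G => p.1 * p.2) p :=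
  (contMDiff_mul 𝓘(ℝ, 𝔤) ∞).mdifferentiableAt (by simp)

variable (𝔤) in
theorem mdiff_mul_left (g h : G) :
    MDifferentiableAt 𝓘(ℝ, 𝔤) 𝓘(ℝ, 𝔤) (fun x : G => g * x) h :=
  (contMDiff_mul_left (I := 𝓘(ℝ, 𝔤)) (n := ∞)).mdifferentiableAt (by simp)

variable (𝔤) in
theorem mdiff_mul_right (g h : G) :
    MDifferentiableAt 𝓘(ℝ, 𝔤) 𝓘(ℝ, 𝔤) (fun x : G => x * g) h :=
  (contMDiff_mul_right (I := 𝓘(ℝ, 𝔤)) (n := ∞)).mdifferentiableAt (by simp)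

variable (𝔤) in
theorem mdiff_inv (h : G) :
    MDifferentiableAt 𝓘(ℝ, 𝔤) 𝓘(ℝ, 𝔤) (fun x : G => x⁻¹) h :=
  (contMDiff_inv 𝓘(ℝ, 𝔤) ∞).mdifferentiableAt (by simp)

variable (𝔤) in
theorem mdiff_conj (g h : G) :
    MDifferentiableAt 𝓘(ℝ, 𝔤) 𝓘(ℝ, 𝔤) (fun x : G => g * x * g⁻¹) h :=
  (mdiff_mul_right 𝔤 g⁻¹ (g * h)).comp h (mdiff_mul_left 𝔤 g h)

theorem leftT_one : leftT 𝔤 (1 : G) = ContinuousLinearMap.id ℝ 𝔤 := by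
  simp only [leftT, one_mul]
  exact tmap_id _

theorem tmap_mul_left_comp_leftT (g h : G) :
    (tmap 𝔤 𝔤 (fun x : G => g * x) h).comp (leftT 𝔤 h) = (leftT 𝔤 (g * h) : 𝔤 →L[ℝ] 𝔤) := by
  have := tmap_comp (f := fun x : G => h * x) (g := fun x : G => g * x) (p := (1 : G))
    (mdiff_mul_left 𝔤 g _) (mdiff_mul_left 𝔤 h 1)
  simp only [mul_one] at this
  rw [leftT, leftT, ← this]
  simp only [mul_assoc]

theorem leftT_inv_comp_leftT (g : G) :
    (tmap 𝔤 𝔤 (fun x : G => g⁻¹ * x) g).comp (leftT 𝔤 g) = ContinuousLinearMap.id ℝ 𝔤 := by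
  rw [tmap_mul_left_comp_leftT, inv_mul_cancel, leftT_one]

theorem leftT_injective (g : G) : Function.Injective (leftT 𝔤 g : 𝔤 →L[ℝ] 𝔤) := by
  intro a b h
  have := congrArg (tmap 𝔤 𝔤 (fun x : G => g⁻¹ * x) g) h
  simpa [← ContinuousLinearMap.comp_apply, leftT_inv_comp_leftT] using this

theorem leftT_comp_tmap_inv (g : G) :
    (leftT 𝔤 g).comp (tmap 𝔤 𝔤 (fun x : G => g⁻¹ * x) g) = ContinuousLinearMap.id ℝ 𝔤 := by
  have h1 : tmap 𝔤 𝔤 (fun x : G => g * x) (g⁻¹ * g) = (leftT 𝔤 g : 𝔤 →L[ℝ] 𝔤) := by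
    rw [inv_mul_cancel]; rfl
  rw [← h1, ← tmap_comp (mdiff_mul_left 𝔤 g _) (mdiff_mul_left 𝔤 g⁻¹ g)]
  simp only [mul_inv_cancel_left]
  exact tmap_id _

theorem adT_one : adT 𝔤 (1 : G) = ContinuousLinearMap.id ℝ 𝔤 := by
  simp only [adT, one_mul, inv_one, mul_one]
  exact tmap_id _

theorem adT_mul (g h : G) : adT 𝔤 (g * h) = (adT 𝔤 g).comp (adT 𝔤 h : 𝔤 →L[ℝ] 𝔤) := by
  have := tmap_comp (f := fun x : G => h * x * h⁻¹) (g := fun x : G => g * x * g⁻¹) (p := (1 : G))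
    (mdiff_conj 𝔤 g _) (mdiff_conj 𝔤 h 1)
  simp only [mul_one, mul_inv_cancel] at this
  rw [adT, adT, adT, ← this]
  simp only [mul_assoc, mul_inv_rev]

theorem adT_inv_apply (g : G) (v : 𝔤) : adT 𝔤 g⁻¹ (adT 𝔤 g v) = v := by
  rw [← ContinuousLinearMap.comp_apply, ← adT_mul, inv_mul_cancel, adT_one]; rfl

theorem adT_apply_inv (g : G) (v : 𝔤) : adT 𝔤 g (adT 𝔤 g⁻¹ v) = v := by
  simpa using adT_inv_apply g⁻¹ v

theorem tmap_mul_right_comp_leftT (g h : G) :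
    (tmap 𝔤 𝔤 (fun x : G => x * h) g).comp (leftT 𝔤 g) =
      (leftT 𝔤 (g * h)).comp (adT 𝔤 h⁻¹ : 𝔤 →L[ℝ] 𝔤) := by
  have h1 := tmap_comp (f := fun x : G => g * x) (g := fun x : G => x * h) (p := (1 : G))
    (mdiff_mul_right 𝔤 h _) (mdiff_mul_left 𝔤 g 1)
  have h2 := tmap_comp (f := fun x : G => h⁻¹ * x * h⁻¹⁻¹) (g := fun x : G => (g * h) * x)
    (p := (1 : G)) (mdiff_mul_left 𝔤 (g * h) _) (mdiff_conj 𝔤 h⁻¹ 1)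
  simp only [mul_one, mul_inv_cancel] at h1 h2
  rw [leftT, leftT, adT, ← h1, ← h2]
  congr 1
  ext x
  group

theorem HasLog.comp_hasFDerivWithinAt {f : X → G} {s : Set X} {ℓ : X →L[ℝ] 𝔤}
    {φ : X' → X} {t : Set X'} {y : X'} {φ' : X' →L[ℝ] X}
    (h : HasLog f s (φ y) ℓ) (hφ : HasFDerivWithinAt φ φ' t y) (hm : MapsTo φ t s) :
    HasLog (fun y => f (φ y)) t y (ℓ.comp φ') :=
  HasTDeriv.comp_hasFDerivWithinAt h hφ hm

theorem HasLog.congr_deriv {f : X → G} {s : Set X} {x : X} {ℓ κ : X →L[ℝ] 𝔤}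
    (h : HasLog f s x ℓ) (e : ℓ = κ) : HasLog f s x κ := e ▸ h

theorem HasLog.congr {f g : X → G} {s : Set X} {x : X} {ℓ : X →L[ℝ] 𝔤}
    (h : HasLog f s x ℓ) (hfg : EqOn g f s) (hx : x ∈ s) : HasLog g s x ℓ := by
  have := HasTDeriv.congr h hfg hx
  rwa [HasLog, hfg hx]

theorem HasLog.mono {f : X → G} {s t : Set X} {x : X} {ℓ : X →L[ℝ] 𝔤}
    (h : HasLog f s x ℓ) (hst : t ⊆ s) : HasLog f t x ℓ :=
  HasTDeriv.mono h hst

/-- The product rule `(f h)⁻¹ d(f h) = Ad(h⁻¹)(f⁻¹ df) + h⁻¹ dh`. -/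
theorem HasLog.mul {f h : X → G} {s : Set X} {x : X} {ℓ κ : X →L[ℝ] 𝔤}
    (hf : HasLog f s x ℓ) (hh : HasLog h s x κ) :
    HasLog (fun y => f y * h y) s x ((adT 𝔤 (h x)⁻¹).comp ℓ + κ) := by
  refine (HasTDeriv.map₂ hf hh (mdiff_mul 𝔤 _)).congr_deriv ?_
  simp only
  rw [← ContinuousLinearMap.comp_assoc, ← ContinuousLinearMap.comp_assoc,
    tmap_mul_right_comp_leftT, tmap_mul_left_comp_leftT, ContinuousLinearMap.comp_assoc,
    ContinuousLinearMap.comp_add]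

theorem HasLog.unique {f : X → G} {s : Set X} {x : X} {ℓ κ : X →L[ℝ] 𝔤}
    (hf : HasLog f s x ℓ) (hh : HasLog f s x κ) (hs : UniqueDiffWithinAt ℝ s x) : ℓ = κ := by
  have := HasTDeriv.unique hf hh hs
  ext v
  exact leftT_injective (f x) (DFunLike.congr_fun this v)

theorem hasLog_const (c : G) (s : Set X) (x : X) :
    HasLog (fun _ : X => c) s x (0 : X →L[ℝ] 𝔤) := by
  refine (hasTDeriv_const c s x).congr_deriv ?_
  simp

theorem HasTDeriv.hasLog {f : X → G} {s : Set X} {x : X} {f' : X →L[ℝ] 𝔤}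
    (hf : HasTDeriv f s x f') :
    HasLog f s x ((tmap 𝔤 𝔤 (fun y : G => (f x)⁻¹ * y) (f x)).comp f') := by
  refine hf.congr_deriv ?_
  rw [← ContinuousLinearMap.comp_assoc, leftT_comp_tmap_inv]; rfl

/-- The tangent map of the inversion sends `g X` to `-(Ad(g) X)`, translated to `g⁻¹`. -/
theorem tmap_inv_comp_leftT (g : G) :
    (tmap 𝔤 𝔤 (fun x : G => x⁻¹) g).comp (leftT 𝔤 g) = -(leftT 𝔤 g⁻¹).comp (adT 𝔤 g) := by
  -- the derivative of `x * x⁻¹ = 1` at `x = g`, with `x` given by the chart at `g`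
  have h0 : (extChartAt 𝓘(ℝ, 𝔤) g).symm (extChartAt 𝓘(ℝ, 𝔤) g g) = g := extChartAt_to_inv g
  have h1 := hasTDeriv_extChartAt_symm (F := 𝔤) g
  have h2 := h1.comp_tmap (mdiff_inv 𝔤 _)
  have h3 := (h1.hasLog.mul h2.hasLog).unique
    ((hasLog_const (𝔤 := 𝔤) (1 : G) univ (extChartAt 𝓘(ℝ, 𝔤) g g)).congr (fun y _ => by simp)
      (mem_univ _))
    uniqueDiffWithinAt_univ
  rw [h0] at h3
  have h4 := congrArg (fun T => ((leftT 𝔤 g⁻¹).comp T).comp (leftT 𝔤 g)) h3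
  ext v
  have h5 := DFunLike.congr_fun h4 v
  have h6 := DFunLike.congr_fun (leftT_comp_tmap_inv (𝔤 := 𝔤) g⁻¹)
    (tmap 𝔤 𝔤 (fun x : G => x⁻¹) g (leftT 𝔤 g v))
  have h7 := DFunLike.congr_fun (leftT_inv_comp_leftT (𝔤 := 𝔤) g) v
  simp only [ContinuousLinearMap.comp_apply, add_apply, map_add,
    ContinuousLinearMap.id_apply, zero_apply, map_zero, inv_inv] at h5 h6 h7
  rw [h7, h6] at h5
  simpa using eq_neg_of_add_eq_zero_right h5

theorem HasLog.inv {f : X → G} {s : Set X} {x : X} {ℓ : X →L[ℝ] 𝔤}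
    (hf : HasLog f s x ℓ) :
    HasLog (fun y => (f y)⁻¹) s x (-(adT 𝔤 (f x)).comp ℓ) := by
  refine (HasTDeriv.comp_tmap hf (mdiff_inv 𝔤 (f x))).congr_deriv ?_
  rw [← ContinuousLinearMap.comp_assoc, tmap_inv_comp_leftT]
  ext v; simp

end LieCalculus

/-! ### Smoothness of tangent maps, curves with zero derivative -/
section MfderivSmooth

variable {X : Type*} [NormedAddCommGroup X] [NormedSpace ℝ X]
  {F : Type*} [NormedAddCommGroup F] [NormedSpace ℝ F]
  {N : Type*} [TopologicalSpace N] [ChartedSpace F N]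
  {F₁ : Type*} [NormedAddCommGroup F₁] [NormedSpace ℝ F₁]
  {N₁ : Type*} [TopologicalSpace N₁] [ChartedSpace F₁ N₁]
  {F₂ : Type*} [NormedAddCommGroup F₂] [NormedSpace ℝ F₂]
  {N₂ : Type*} [TopologicalSpace N₂] [ChartedSpace F₂ N₂]

/-- The partial tangent map of `f` in the second variable at a fixed point, which is sent to a fixed
point, depends smoothly on the first variable. -/
theorem contMDiffAt_tmap_of_fixed [IsManifold 𝓘(ℝ, F₁) ∞ N₁] [IsManifold 𝓘(ℝ, F₂) ∞ N₂]
    [IsManifold 𝓘(ℝ, F) ∞ N]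
    (f : N → N₁ → N₂) (n₀ : N) (p : N₁) (q : N₂) (hq : ∀ n, f n p = q)
    (hf : ContMDiffAt (𝓘(ℝ, F).prod 𝓘(ℝ, F₁)) 𝓘(ℝ, F₂) ∞ (Function.uncurry f) (n₀, p)) :
    ContMDiffAt 𝓘(ℝ, F) 𝓘(ℝ, F₁ →L[ℝ] F₂) ∞ (fun n => tmap F₁ F₂ (f n) p) n₀ := by
  have h1 : ContMDiffAt 𝓘(ℝ, F) 𝓘(ℝ, F₁ →L[ℝ] F₂) ∞
      (inTangentCoordinates 𝓘(ℝ, F₁) 𝓘(ℝ, F₂) (fun _ => p) (fun n => f n p)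
        (fun n => tmap F₁ F₂ (f n) p) n₀) n₀ :=
    ContMDiffAt.mfderiv (m := ∞) (n := ∞) f (fun _ => p) hf contMDiffAt_const (by simp)
  convert h1 using 1
  funext n
  rw [inTangentCoordinates_eq]
  · simp only [hq]
    ext v
    simp only [ContinuousLinearMap.comp_apply]
    rw [(tangentBundleCore 𝓘(ℝ, F₁) N₁).coordChange_self,
      (tangentBundleCore 𝓘(ℝ, F₂) N₂).coordChange_self]
    all_goals exact mem_achart_source _ _
  · simp
  · simp [hq]

/-- The partial tangent map, in the second variable at a fixed point, of a smooth map to a normed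
space depends smoothly on the first variable. -/
theorem contMDiffAt_tmap_of_fixed' [IsManifold 𝓘(ℝ, F₁) ∞ N₁]
    [IsManifold 𝓘(ℝ, F) ∞ N]
    (f : N → N₁ → F₂) (n₀ : N) (p : N₁)
    (hf : ContMDiffAt (𝓘(ℝ, F).prod 𝓘(ℝ, F₁)) 𝓘(ℝ, F₂) ∞ (Function.uncurry f) (n₀, p)) :
    ContMDiffAt 𝓘(ℝ, F) 𝓘(ℝ, F₁ →L[ℝ] F₂) ∞ (fun n => tmap F₁ F₂ (f n) p) n₀ := by
  have h1 : ContMDiffAt 𝓘(ℝ, F) 𝓘(ℝ, F₁ →L[ℝ] F₂) ∞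
      (inTangentCoordinates 𝓘(ℝ, F₁) 𝓘(ℝ, F₂) (fun _ => p) (fun n => f n p)
        (fun n => tmap F₁ F₂ (f n) p) n₀) n₀ :=
    ContMDiffAt.mfderiv (m := ∞) (n := ∞) f (fun _ => p) hf contMDiffAt_const (by simp)
  convert h1 using 1
  funext n
  rw [inTangentCoordinates_eq]
  · ext v
    simp only [ContinuousLinearMap.comp_apply]
    rw [(tangentBundleCore 𝓘(ℝ, F₁) N₁).coordChange_self,
      tangentBundleCore_coordChange_model_space]
    · rfl
    · exact mem_achart_source _ _
  · simp
  · trivial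

/-- A curve in a manifold with zero derivative is constant. -/
theorem eqOn_of_hasTDeriv_zero {f : ℝ → N} {s : Set ℝ} (hs : s.OrdConnected)
    (hf : ∀ t ∈ s, HasTDeriv f s t (0 : ℝ →L[ℝ] F)) [IsManifold 𝓘(ℝ, F) 1 N]
    {x y : ℝ} (hx : x ∈ s) (hy : y ∈ s) : f x = f y := by
  refine hs.isPreconnected.induction₂ (fun x y => f x = f y) (fun t ht => ?_)
    (fun _ _ _ _ _ _ h h' => h.trans h') (fun _ _ _ _ h => h.symm) hx hy
  have hc := (hf t ht).continuousWithinAt.preimage_mem_nhdsWithin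
    (chart_source_mem_nhds F (f t))
  obtain ⟨ε, hε, hb⟩ := Metric.mem_nhdsWithin_iff.1 hc
  -- near `t` the curve stays in the chart at `f t`, where its expression has zero derivative
  have hconv : Convex ℝ (Metric.ball t ε ∩ s) :=
    (convex_ball t ε).inter hs.convex
  filter_upwards [inter_mem_nhdsWithin s (Metric.ball_mem_nhds t hε)] with y hy
  have hd : ∀ z ∈ Metric.ball t ε ∩ s, HasFDerivWithinAt
      (fun z => extChartAt 𝓘(ℝ, F) (f t) (f z)) (0 : ℝ →L[ℝ] F) (Metric.ball t ε ∩ s) z := by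
    intro z hz
    have h1 := ((hf z hz.2).comp_tmap (N₁ := F)
      (mdifferentiableAt_extChartAt (I := 𝓘(ℝ, F)) (x := f t) (hb hz))).mono
      (inter_subset_right (s := Metric.ball t ε))
    rw [hasTDeriv_iff_hasFDerivWithinAt] at h1
    simpa using h1
  have h2 := hconv.norm_image_sub_le_of_norm_hasFDerivWithin_le (C := 0) hd (by simp)
    ⟨Metric.mem_ball_self hε, ht⟩ hy.symm
  have h3 : extChartAt 𝓘(ℝ, F) (f t) (f y) = extChartAt 𝓘(ℝ, F) (f t) (f t) := by
    simpa [sub_eq_zero] using h2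
  refine ((extChartAt 𝓘(ℝ, F) (f t)).injOn ?_ ?_ h3).symm
  · simpa using hb hy.symm
  · simp

end MfderivSmooth

/-! ### Left logarithmic derivatives in charts -/
section ChartAtOne

variable {X : Type*} [NormedAddCommGroup X] [NormedSpace ℝ X]
  {𝔤 : Type*} [NormedAddCommGroup 𝔤] [NormedSpace ℝ 𝔤]
  {G : Type*} [TopologicalSpace G] [ChartedSpace 𝔤 G] [Group G]

variable (𝔤) in
/-- The derivative at `0` of `v ↦ φ (h * exp v)`, where `φ` is the preferred chart at `g`: it
expresses left logarithmic derivatives in the chart. -/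
def logChart (g h : G) : 𝔤 →L[ℝ] 𝔤 :=
  (tmap 𝔤 𝔤 (extChartAt 𝓘(ℝ, 𝔤) g) h).comp (leftT 𝔤 h)

variable [LieGroup 𝓘(ℝ, 𝔤) ∞ G]

theorem logChart_one : logChart 𝔤 (1 : G) 1 = ContinuousLinearMap.id ℝ 𝔤 := by
  have : tmap 𝔤 𝔤 (extChartAt 𝓘(ℝ, 𝔤) (1 : G)) (1 : G) = ContinuousLinearMap.id ℝ 𝔤 :=
    mfderiv_extChartAt_self
  rw [logChart, leftT_one, this]; rfl

theorem HasLog.hasFDerivWithinAt_chart {f : X → G} {s : Set X} {x : X} {ℓ : X →L[ℝ] 𝔤}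
    (h : HasLog f s x ℓ) {g : G} (hg : f x ∈ (chartAt 𝔤 g).source) :
    HasFDerivWithinAt (fun y => extChartAt 𝓘(ℝ, 𝔤) g (f y)) ((logChart 𝔤 g (f x)).comp ℓ) s x := by
  have : IsManifold 𝓘(ℝ, 𝔤) 1 G := IsManifold.of_le (n := ∞) (by simp)
  have h1 := HasTDeriv.comp_tmap (N₁ := 𝔤) h (mdifferentiableAt_extChartAt (I := 𝓘(ℝ, 𝔤)) hg)
  rwa [hasTDeriv_iff_hasFDerivWithinAt] at h1

theorem tmap_extChartAt_symm_comp {g h : G} (hh : h ∈ (chartAt 𝔤 g).source) :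
    (tmap 𝔤 𝔤 (extChartAt 𝓘(ℝ, 𝔤) g).symm (extChartAt 𝓘(ℝ, 𝔤) g h)).comp
      (tmap 𝔤 𝔤 (extChartAt 𝓘(ℝ, 𝔤) g) h) = ContinuousLinearMap.id ℝ 𝔤 := by
  have : IsManifold 𝓘(ℝ, 𝔤) 1 G := IsManifold.of_le (n := ∞) (by simp)
  have h1 := mfderivWithin_extChartAt_symm_comp_mfderiv_extChartAt' (I := 𝓘(ℝ, 𝔤)) (x := g) (y := h)
    (by simpa using hh)
  rw [ModelWithCorners.range_eq_univ, mfderivWithin_univ] at h1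
  exact h1

/-- A map `z` to the chart at `g` with `dz = logChart g (φ⁻¹(z)) ∘ ℓ` corresponds to a map to the
group with left logarithmic derivative `ℓ`. -/
theorem hasLog_extChartAt_symm {z : X → 𝔤} {s : Set X} {x : X} {ℓ : X →L[ℝ] 𝔤} (g : G)
    (hzx : z x ∈ (extChartAt 𝓘(ℝ, 𝔤) g).target)
    (h : HasFDerivWithinAt z
      ((logChart 𝔤 g ((extChartAt 𝓘(ℝ, 𝔤) g).symm (z x))).comp ℓ) s x) :
    HasLog (fun y => (extChartAt 𝓘(ℝ, 𝔤) g).symm (z y)) s x ℓ := by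
  have : IsManifold 𝓘(ℝ, 𝔤) 1 G := IsManifold.of_le (n := ∞) (by simp)
  have h0 : MDifferentiableAt 𝓘(ℝ, 𝔤) 𝓘(ℝ, 𝔤) (extChartAt 𝓘(ℝ, 𝔤) g).symm (z x) := by
    have := mdifferentiableWithinAt_extChartAt_symm (I := 𝓘(ℝ, 𝔤)) hzx
    rwa [ModelWithCorners.range_eq_univ, mdifferentiableWithinAt_univ] at this
  have h1 := HasTDeriv.comp_tmap (hasTDeriv_iff_hasFDerivWithinAt.2 h) h0
  refine HasTDeriv.congr_deriv h1 ?_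
  have h2 := tmap_extChartAt_symm_comp (𝔤 := 𝔤) (g := g)
    (h := (extChartAt 𝓘(ℝ, 𝔤) g).symm (z x)) (by simpa using (extChartAt 𝓘(ℝ, 𝔤) g).map_target hzx)
  rw [(extChartAt 𝓘(ℝ, 𝔤) g).right_inv hzx] at h2
  rw [logChart, ← ContinuousLinearMap.comp_assoc, ← ContinuousLinearMap.comp_assoc, h2]
  rfl

theorem contMDiffAt_logChart {g h : G} (hh : h ∈ (chartAt 𝔤 g).source) :
    ContMDiffAt 𝓘(ℝ, 𝔤) 𝓘(ℝ, 𝔤 →L[ℝ] 𝔤) ∞ (logChart 𝔤 g) h := by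
  have : IsManifold 𝓘(ℝ, 𝔤) 1 G := IsManifold.of_le (n := ∞) (by simp)
  have h1 : ContMDiffAt (𝓘(ℝ, 𝔤).prod 𝓘(ℝ, 𝔤)) 𝓘(ℝ, 𝔤) ∞
      (Function.uncurry fun a b : G => extChartAt 𝓘(ℝ, 𝔤) g (a * b)) (h, 1) := by
    refine ContMDiffAt.comp (I' := 𝓘(ℝ, 𝔤)) (g := extChartAt 𝓘(ℝ, 𝔤) g) (h, (1 : G)) ?_
      (contMDiff_mul 𝓘(ℝ, 𝔤) ∞).contMDiffAt
    exact contMDiffAt_extChartAt' (by simpa using hh)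
  -- `logChart g a` is the derivative of `b ↦ φ(a b)` at `b = 1`
  refine (contMDiffAt_tmap_of_fixed' _ h 1 h1).congr_of_eventuallyEq ?_
  filter_upwards [(chartAt 𝔤 g).open_source.mem_nhds hh] with a ha
  rw [logChart, leftT, tmap_comp (F := 𝔤) (F₁ := 𝔤) (F₂ := 𝔤) (g := extChartAt 𝓘(ℝ, 𝔤) g)
     (f := fun b : G => a * b), mul_one]
  · rw [mul_one]; exact mdifferentiableAt_extChartAt (I := 𝓘(ℝ, 𝔤)) ha
  · exact mdiff_mul_left 𝔤 a 1

/-- A map to a Lie group is of class `C^{n+1}` if its left logarithmic derivative is `C^n`. -/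
theorem contMDiffOn_succ_of_hasLog {f : X → G} {s : Set X} {ℓ : X → X →L[ℝ] 𝔤} {n : ℕ}
    (hs : UniqueDiffOn ℝ s) (h : ∀ x ∈ s, HasLog f s x (ℓ x)) (hℓ : ContDiffOn ℝ n ℓ s)
    (hf : ContMDiffOn 𝓘(ℝ, X) 𝓘(ℝ, 𝔤) n f s) :
    ContMDiffOn 𝓘(ℝ, X) 𝓘(ℝ, 𝔤) (n + 1 : ℕ) f s := by
  have : IsManifold 𝓘(ℝ, 𝔤) 1 G := IsManifold.of_le (n := ∞) (by simp)
  intro x hx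
  have hcont := (HasTDeriv.continuousWithinAt (h x hx))
  obtain ⟨U, hU, hxU, hUs⟩ := mem_nhdsWithin.1
    (hcont.preimage_mem_nhdsWithin (chart_source_mem_nhds 𝔤 (f x)))
  have hs' : UniqueDiffOn ℝ (s ∩ U) := hs.inter hU
  -- near `x` the expression of `f` in the chart at `f x` has derivative
  -- `logChart (f x) (f y) ∘ ℓ y` at `y`
  suffices h2 : ContDiffOn ℝ (n + 1 : ℕ) (fun y => extChartAt 𝓘(ℝ, 𝔤) (f x) (f y)) (s ∩ U) by
    rw [contMDiffWithinAt_iff_target]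
    refine ⟨hcont, ContDiffWithinAt.contMDiffWithinAt ?_⟩
    exact (h2 x ⟨hx, hxU⟩).mono_of_mem_nhdsWithin (inter_mem_nhdsWithin s (hU.mem_nhds hxU))
  have hsrc : ∀ y ∈ s ∩ U, f y ∈ (chartAt 𝔤 (f x)).source := fun y hy => hUs ⟨hy.2, hy.1⟩
  have hd : ∀ y ∈ s ∩ U, HasFDerivWithinAt (fun y => extChartAt 𝓘(ℝ, 𝔤) (f x) (f y))
      ((logChart 𝔤 (f x) (f y)).comp (ℓ y)) (s ∩ U) y := fun y hy =>
    ((h y hy.1).hasFDerivWithinAt_chart (hsrc y hy)).mono inter_subset_left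
  have h3 : ContDiffOn ℝ n (fun y => (logChart 𝔤 (f x) (f y)).comp (ℓ y)) (s ∩ U) := by
    refine ContDiffOn.clm_comp (fun y hy => ?_) (hℓ.mono inter_subset_left)
    refine ContMDiffWithinAt.contDiffWithinAt ?_
    exact ((contMDiffAt_logChart (hsrc y hy)).of_le
      (by exact_mod_cast le_top)).comp_contMDiffWithinAt y ((hf y hy.1).mono inter_subset_left)
  push_cast
  rw [contDiffOn_succ_iff_fderivWithin hs']
  refine ⟨fun y hy => (hd y hy).differentiableWithinAt, by simp, h3.congr fun y hy => ?_⟩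
  exact (hd y hy).fderivWithin (hs' y hy)

/-- Two curves with the same left logarithmic derivative and the same initial value are equal. -/
theorem HasLog.eq_of_eq {f g : ℝ → G} {s : Set ℝ} (hs : s.OrdConnected) {ℓ : ℝ → ℝ →L[ℝ] 𝔤}
    (hf : ∀ t ∈ s, HasLog f s t (ℓ t)) (hg : ∀ t ∈ s, HasLog g s t (ℓ t))
    {a : ℝ} (ha : a ∈ s) (hfg : f a = g a) {t : ℝ} (ht : t ∈ s) : f t = g t := by
  have : IsManifold 𝓘(ℝ, 𝔤) 1 G := IsManifold.of_le (n := ∞) (by simp)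
  -- the quotient `f g⁻¹` has zero derivative
  have h1 : f a * (g a)⁻¹ = f t * (g t)⁻¹ := by
    refine eqOn_of_hasTDeriv_zero (F := 𝔤) hs (f := fun t => f t * (g t)⁻¹) (fun t ht => ?_) ha ht
    refine HasTDeriv.congr_deriv ((hf t ht).mul (hg t ht).inv) ?_
    simp
  rw [hfg, mul_inv_cancel] at h1
  exact (mul_inv_eq_one.1 h1.symm)

end ChartAtOne

/-! ### The adjoint representation and the bracket -/
section Representations

variable {X : Type*} [NormedAddCommGroup X] [NormedSpace ℝ X]
  {𝔤 : Type*} [NormedAddCommGroup 𝔤] [NormedSpace ℝ 𝔤]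
  {G : Type*} [TopologicalSpace G] [ChartedSpace 𝔤 G] [Group G] [LieGroup 𝓘(ℝ, 𝔤) ∞ G]
  {V : Type*} [NormedAddCommGroup V] [NormedSpace ℝ V]

/-- Differentiation of a representation `ρ` along a map `f` to the group:
`d(ρ ∘ f) = ρ(f) ∘ dρ(f⁻¹ df)`. -/
theorem HasLog.hasFDerivWithinAt_rep {f : X → G} {s : Set X} {x : X} {ℓ : X →L[ℝ] 𝔤}
    (hf : HasLog f s x ℓ) {ρ : G → V →L[ℝ] V} (hρ : ContMDiff 𝓘(ℝ, 𝔤) 𝓘(ℝ, V →L[ℝ] V) ∞ ρ)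
    (hmul : ∀ g h, ρ (g * h) = (ρ g).comp (ρ h)) :
    HasFDerivWithinAt (fun y => ρ (f y))
      ((ContinuousLinearMap.compL ℝ V V V (ρ (f x))).comp
        ((tmap 𝔤 (V →L[ℝ] V) ρ 1).comp ℓ)) s x := by
  have hd : ∀ g, MDifferentiableAt 𝓘(ℝ, 𝔤) 𝓘(ℝ, V →L[ℝ] V) ρ g :=
    fun g => (hρ g).mdifferentiableAt (by simp)
  rw [← hasTDeriv_iff_hasFDerivWithinAt]
  refine (HasTDeriv.comp_tmap hf (hd _)).congr_deriv ?_
  rw [← ContinuousLinearMap.comp_assoc, ← ContinuousLinearMap.comp_assoc]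
  congr 1
  -- `ρ ∘ L_{f(x)} = ρ(f(x)) ∘ ρ`, differentiated at `1`
  have h1 := tmap_comp (F := 𝔤) (F₁ := 𝔤) (F₂ := V →L[ℝ] V) (f := fun h : G => f x * h) (g := ρ)
    (p := 1) (hd _) (mdiff_mul_left 𝔤 (f x) 1)
  rw [mul_one] at h1
  rw [leftT, ← h1]
  simp only [hmul]
  have h2 : MDifferentiableAt 𝓘(ℝ, V →L[ℝ] V) 𝓘(ℝ, V →L[ℝ] V)
      (ContinuousLinearMap.compL ℝ V V V (ρ (f x))) (ρ 1) :=
    (ContinuousLinearMap.differentiableAt _).mdifferentiableAt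
  have h3 := tmap_comp (F := 𝔤) (F₁ := V →L[ℝ] V) (F₂ := V →L[ℝ] V) (f := ρ)
    (g := ContinuousLinearMap.compL ℝ V V V (ρ (f x))) (p := 1) h2 (hd _)
  refine h3.trans ?_
  congr 1
  rw [tmap, mfderiv_eq_fderiv]
  exact ContinuousLinearMap.fderiv _

theorem contMDiff_adT : ContMDiff 𝓘(ℝ, 𝔤) 𝓘(ℝ, 𝔤 →L[ℝ] 𝔤) ∞ (adT 𝔤 : G → 𝔤 →L[ℝ] 𝔤) := by
  intro g
  refine contMDiffAt_tmap_of_fixed (fun g h : G => g * h * g⁻¹) g 1 1 (by simp) ?_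
  have h1 : ContMDiff (𝓘(ℝ, 𝔤).prod 𝓘(ℝ, 𝔤)) 𝓘(ℝ, 𝔤) ∞ (fun p : G × G => p.1 * p.2 * p.1⁻¹) :=
    (contMDiff_fst.mul contMDiff_snd).mul contMDiff_fst.inv
  exact h1.contMDiffAt

variable (𝔤 G) in
/-- The derivative at `1` of the adjoint representation, i.e. the bracket of `𝔤 = T₁G`. -/
def adDer : 𝔤 →L[ℝ] 𝔤 →L[ℝ] 𝔤 := tmap 𝔤 (𝔤 →L[ℝ] 𝔤) (adT 𝔤 : G → 𝔤 →L[ℝ] 𝔤) 1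

theorem HasLog.hasFDerivWithinAt_adT {f : X → G} {s : Set X} {x : X} {ℓ : X →L[ℝ] 𝔤}
    (hf : HasLog f s x ℓ) :
    HasFDerivWithinAt (fun y => adT 𝔤 (f y))
      ((ContinuousLinearMap.compL ℝ 𝔤 𝔤 𝔤 (adT 𝔤 (f x))).comp ((adDer 𝔤 G).comp ℓ)) s x :=
  hf.hasFDerivWithinAt_rep contMDiff_adT adT_mul

variable (G) in
/-- The curve `s ↦ φ⁻¹(φ(1) + s u)` through `1` with velocity `u`, where `φ` is the preferred
chart at `1`. -/
def chartLine (u : 𝔤) (s : ℝ) : G :=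
  (extChartAt 𝓘(ℝ, 𝔤) (1 : G)).symm (extChartAt 𝓘(ℝ, 𝔤) (1 : G) 1 + s • u)

theorem chartLine_zero (u : 𝔤) : chartLine G u 0 = 1 := by
  simp [chartLine]

theorem contMDiffAt_chartLine (u : 𝔤) : ContMDiffAt 𝓘(ℝ, ℝ) 𝓘(ℝ, 𝔤) ∞ (chartLine G u) 0 := by
  have h1 : ContMDiffAt 𝓘(ℝ, 𝔤) 𝓘(ℝ, 𝔤) ∞ (extChartAt 𝓘(ℝ, 𝔤) (1 : G)).symm
      (extChartAt 𝓘(ℝ, 𝔤) (1 : G) 1 + (0 : ℝ) • u) := by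
    have := contMDiffWithinAt_extChartAt_symm_range_self (I := 𝓘(ℝ, 𝔤)) (n := ∞) (1 : G)
    rw [ModelWithCorners.range_eq_univ, contMDiffWithinAt_univ] at this
    simpa using this
  have h2 : ContMDiff 𝓘(ℝ, ℝ) 𝓘(ℝ, 𝔤) ∞
      (fun s : ℝ => extChartAt 𝓘(ℝ, 𝔤) (1 : G) 1 + s • u) := by
    rw [contMDiff_iff_contDiff]; fun_prop
  exact ContMDiffAt.comp (I' := 𝓘(ℝ, 𝔤)) (0 : ℝ) h1 h2.contMDiffAt

theorem hasLog_chartLine (u : 𝔤) :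
    HasLog (chartLine G u) univ 0 ((1 : ℝ →L[ℝ] ℝ).smulRight u) := by
  refine hasLog_extChartAt_symm (X := ℝ) 1 (by simp) ?_
  have : (extChartAt 𝓘(ℝ, 𝔤) (1 : G)).symm (extChartAt 𝓘(ℝ, 𝔤) (1 : G) 1 + (0 : ℝ) • u) = 1 := by
    simp
  rw [this, logChart_one, ContinuousLinearMap.id_comp, hasFDerivWithinAt_univ]
  exact ((hasDerivAt_id (0 : ℝ)).smul_const u).hasFDerivAt.const_add _
    |>.congr_fderiv (by ext; simp)

/-- The bracket is antisymmetric: both mixed second derivatives at `0` of the commutator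
`(s, t) ↦ a(s) b(t) a(s)⁻¹ b(t)⁻¹`, for curves through `1` with velocities `u` and `v`, agree. -/
theorem adDer_antisymm (u v : 𝔤) : adDer 𝔤 G u v = -adDer 𝔤 G v u := by
  let c : ℝ × ℝ → G := fun p =>
    chartLine G u p.1 * chartLine G v p.2 * (chartLine G u p.1)⁻¹ * (chartLine G v p.2)⁻¹
  let κ : ℝ × ℝ → 𝔤 := fun p => extChartAt 𝓘(ℝ, 𝔤) (1 : G) (c p)
  have hc : ContMDiffAt 𝓘(ℝ, ℝ × ℝ) 𝓘(ℝ, 𝔤) ∞ c 0 := by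
    have h1 : ContMDiffAt 𝓘(ℝ, ℝ × ℝ) 𝓘(ℝ, 𝔤) ∞ (fun p : ℝ × ℝ => chartLine G u p.1) 0 :=
      ContMDiffAt.comp (I' := 𝓘(ℝ, ℝ)) (g := chartLine G u) (0 : ℝ × ℝ) (contMDiffAt_chartLine u)
        contDiffAt_fst.contMDiffAt
    have h2 : ContMDiffAt 𝓘(ℝ, ℝ × ℝ) 𝓘(ℝ, 𝔤) ∞ (fun p : ℝ × ℝ => chartLine G v p.2) 0 :=
      ContMDiffAt.comp (I' := 𝓘(ℝ, ℝ)) (g := chartLine G v) (0 : ℝ × ℝ) (contMDiffAt_chartLine v)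
        contDiffAt_snd.contMDiffAt
    exact ((h1.mul h2).mul h1.inv).mul h2.inv
  have hc0 : c 0 = 1 := by simp [c, chartLine_zero]
  have hκ : ContDiffAt ℝ ∞ κ 0 := by
    rw [← contMDiffAt_iff_contDiffAt]
    refine ContMDiffAt.comp (I' := 𝓘(ℝ, 𝔤)) (0 : ℝ × ℝ) ?_ hc
    rw [hc0]; exact contMDiffAt_extChartAt
  have hκ' : ∀ᶠ p in nhds (0 : ℝ × ℝ), DifferentiableAt ℝ κ p :=
    ((hκ.of_le (m := 1) (by exact_mod_cast le_top)).eventually (by simp)).mono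
      fun p hp => hp.differentiableAt (by simp)
  have hD : DifferentiableAt ℝ (fderiv ℝ κ) 0 :=
    (hκ.fderiv_right (m := ∞) (by simp)).differentiableAt (by simp)
  -- the derivative of `κ` along the axes, in the transverse direction
  have e1 : ∀ᶠ s in nhds (0 : ℝ), fderiv ℝ κ (s, 0) (0, 1) = adT 𝔤 (chartLine G u s) v - v := by
    have h0 : Filter.Tendsto (fun s : ℝ => (s, (0 : ℝ))) (nhds 0) (nhds 0) :=
      Continuous.tendsto' (by fun_prop) _ _ rfl
    filter_upwards [h0.eventually hκ'] with s hs
    have h1 := ((((hasLog_const (𝔤 := 𝔤) (chartLine G u s) univ (0 : ℝ)).mul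
      (hasLog_chartLine v)).mul (hasLog_const (𝔤 := 𝔤) (chartLine G u s)⁻¹ univ (0 : ℝ))).mul
      (hasLog_chartLine v).inv).hasFDerivWithinAt_chart (g := 1) (by simp [chartLine_zero])
    have h2 := (hasFDerivWithinAt_univ.1 h1).hasDerivAt
    have h3 : HasDerivAt (fun t : ℝ => κ (s, t)) (fderiv ℝ κ (s, 0) (0, 1)) 0 :=
      HasFDerivAt.comp_hasDerivAt (0 : ℝ) (f := fun t : ℝ => (s, t)) hs.hasFDerivAt
        ((hasDerivAt_const (0 : ℝ) s).prodMk (hasDerivAt_id (0 : ℝ)))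
    rw [h3.unique h2]
    simp [chartLine_zero, logChart_one, adT_one, sub_eq_add_neg]
  have e2 : ∀ᶠ t in nhds (0 : ℝ), fderiv ℝ κ (0, t) (1, 0) = u - adT 𝔤 (chartLine G v t) u := by
    have h0 : Filter.Tendsto (fun t : ℝ => ((0 : ℝ), t)) (nhds 0) (nhds 0) :=
      Continuous.tendsto' (by fun_prop) _ _ rfl
    filter_upwards [h0.eventually hκ'] with t ht
    have h1 := ((((hasLog_chartLine u).mul (hasLog_const (𝔤 := 𝔤) (chartLine G v t) univ
      (0 : ℝ))).mul (hasLog_chartLine u).inv).mul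
      (hasLog_const (𝔤 := 𝔤) (chartLine G v t)⁻¹ univ (0 : ℝ))).hasFDerivWithinAt_chart
      (g := 1) (by simp [chartLine_zero])
    have h2 := (hasFDerivWithinAt_univ.1 h1).hasDerivAt
    have h3 : HasDerivAt (fun s : ℝ => κ (s, t)) (fderiv ℝ κ (0, t) (1, 0)) 0 :=
      HasFDerivAt.comp_hasDerivAt (0 : ℝ) (f := fun s : ℝ => (s, t)) ht.hasFDerivAt
        ((hasDerivAt_id (0 : ℝ)).prodMk (hasDerivAt_const (0 : ℝ) t))
    rw [h3.unique h2]
    simp [chartLine_zero, logChart_one, adT_one, sub_eq_add_neg, adT_apply_inv]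
  -- the remaining derivative is that of the adjoint representation, i.e. the bracket
  have key : ∀ (w w' : 𝔤), HasDerivAt (fun s => adT 𝔤 (chartLine G w s) w')
      (adDer 𝔤 G w w') 0 := by
    intro w w'
    have h1 := (hasFDerivWithinAt_univ.1 (hasLog_chartLine (G := G) w).hasFDerivWithinAt_adT)
    have h2 := (h1.clm_apply (hasFDerivAt_const w' (0 : ℝ))).hasDerivAt
    refine h2.congr_deriv ?_
    simp [chartLine_zero, adT_one]
  have f1 : fderiv ℝ (fderiv ℝ κ) 0 (1, 0) (0, 1) = adDer 𝔤 G u v := by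
    have h1 : HasDerivAt (fun s : ℝ => fderiv ℝ κ (s, 0) (0, 1))
        (fderiv ℝ (fderiv ℝ κ) 0 (1, 0) (0, 1)) 0 :=
      (HasFDerivAt.comp_hasDerivAt (0 : ℝ) (f := fun s : ℝ => (s, (0 : ℝ))) hD.hasFDerivAt
        ((hasDerivAt_id (0 : ℝ)).prodMk (hasDerivAt_const (0 : ℝ) (0 : ℝ)))).clm_apply
        (hasDerivAt_const (0 : ℝ) ((0 : ℝ), (1 : ℝ))) |>.congr_deriv (by simp)
    exact h1.unique (((key u v).sub_const v).congr_of_eventuallyEq e1)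
  have f2 : fderiv ℝ (fderiv ℝ κ) 0 (0, 1) (1, 0) = -adDer 𝔤 G v u := by
    have h1 : HasDerivAt (fun s : ℝ => fderiv ℝ κ (0, s) (1, 0))
        (fderiv ℝ (fderiv ℝ κ) 0 (0, 1) (1, 0)) 0 :=
      (HasFDerivAt.comp_hasDerivAt (0 : ℝ) (f := fun s : ℝ => ((0 : ℝ), s)) hD.hasFDerivAt
        ((hasDerivAt_const (0 : ℝ) (0 : ℝ)).prodMk (hasDerivAt_id (0 : ℝ)))).clm_apply
        (hasDerivAt_const (0 : ℝ) ((1 : ℝ), (0 : ℝ))) |>.congr_deriv (by simp)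
    exact h1.unique (((key v u).const_sub u).congr_of_eventuallyEq e2)
  -- the second derivative of `κ` is symmetric
  have hsymm : IsSymmSndFDerivAt ℝ κ 0 := hκ.isSymmSndFDerivAt
    (by rw [minSmoothness_of_isRCLikeNormedField]; exact WithTop.coe_le_coe.2 le_top)
  rw [← f1, ← f2]
  exact hsymm _ _

end Representations

/-! ### Lie crossed modules on the infinitesimal level -/
section CrossedModule

variable {X : Type*} [NormedAddCommGroup X] [NormedSpace ℝ X]
  {𝔤 : Type*} [NormedAddCommGroup 𝔤] [NormedSpace ℝ 𝔤]
  {G : Type*} [TopologicalSpace G] [ChartedSpace 𝔤 G] [Group G] [LieGroup 𝓘(ℝ, 𝔤) ∞ G]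
  {𝔢 : Type*} [NormedAddCommGroup 𝔢] [NormedSpace ℝ 𝔢]
  {E : Type*} [TopologicalSpace E] [ChartedSpace 𝔢 E] [Group E] [LieGroup 𝓘(ℝ, 𝔢) ∞ E]
  [MulDistribMulAction G E]

variable (𝔢 E) in
/-- The action of `g ∈ G` on `𝔢 = T₁E`, as a continuous linear map. -/
def actT (g : G) : 𝔢 →L[ℝ] 𝔢 := tmap 𝔢 𝔢 (fun e : E => g • e) 1

/-- The Lie algebra map induced by `d : E → G`, as a continuous linear map. -/
def derT (d : E →* G) : 𝔢 →L[ℝ] 𝔤 := tmap 𝔢 𝔤 (fun e : E => d e) 1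

variable (𝔤 G 𝔢 E) in
/-- The derivative at `1` of the action of `G` on `𝔢`. -/
def actDer : 𝔤 →L[ℝ] 𝔢 →L[ℝ] 𝔢 := tmap 𝔤 (𝔢 →L[ℝ] 𝔢) (actT 𝔢 E : G → 𝔢 →L[ℝ] 𝔢) 1

theorem IsLieCrossedModule.mdiff_act {d : E →* G}
    (hd : IsLieCrossedModule (𝔤 := 𝔤) (𝔢 := 𝔢) d) (g : G) (e : E) :
    MDifferentiableAt 𝓘(ℝ, 𝔢) 𝓘(ℝ, 𝔢) (fun e : E => g • e) e :=
  (hd.smooth_act.comp (contMDiff_const.prodMk contMDiff_id)).mdifferentiableAt (by simp)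

theorem IsLieCrossedModule.mdiff_map {d : E →* G}
    (hd : IsLieCrossedModule (𝔤 := 𝔤) (𝔢 := 𝔢) d) (e : E) :
    MDifferentiableAt 𝓘(ℝ, 𝔢) 𝓘(ℝ, 𝔤) (fun e : E => d e) e :=
  hd.smooth_map.mdifferentiableAt (by simp)

theorem IsLieCrossedModule.contMDiff_actT {d : E →* G}
    (hd : IsLieCrossedModule (𝔤 := 𝔤) (𝔢 := 𝔢) d) :
    ContMDiff 𝓘(ℝ, 𝔤) 𝓘(ℝ, 𝔢 →L[ℝ] 𝔢) ∞ (actT 𝔢 E : G → 𝔢 →L[ℝ] 𝔢) := fun g =>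
  contMDiffAt_tmap_of_fixed (fun (g : G) (e : E) => g • e) g 1 1 (by simp)
    hd.smooth_act.contMDiffAt

theorem IsLieCrossedModule.actT_mul {d : E →* G}
    (hd : IsLieCrossedModule (𝔤 := 𝔤) (𝔢 := 𝔢) d) (g h : G) :
    actT 𝔢 E (g * h) = (actT 𝔢 E g).comp (actT 𝔢 E h) := by
  have := tmap_comp (F := 𝔢) (F₁ := 𝔢) (F₂ := 𝔢) (f := fun e : E => h • e)
    (g := fun e : E => g • e) (p := 1) (hd.mdiff_act g _) (hd.mdiff_act h _)
  simp only [smul_one, smul_smul] at this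
  exact this

theorem actT_one : actT 𝔢 E (1 : G) = ContinuousLinearMap.id ℝ 𝔢 := by
  simp only [actT, one_smul]
  exact tmap_id _

theorem IsLieCrossedModule.actT_map {d : E →* G}
    (hd : IsLieCrossedModule (𝔤 := 𝔤) (𝔢 := 𝔢) d) (e : E) :
    actT 𝔢 E (d e) = adT 𝔢 e := by
  simp only [actT, adT, hd.peiffer]

theorem IsLieCrossedModule.actDer_derT {d : E →* G}
    (hd : IsLieCrossedModule (𝔤 := 𝔤) (𝔢 := 𝔢) d) :
    (actDer 𝔤 G 𝔢 E).comp (derT d) = adDer 𝔢 E := by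
  have h1 := tmap_comp (F := 𝔢) (F₁ := 𝔤) (F₂ := 𝔢 →L[ℝ] 𝔢) (f := fun e : E => d e)
    (g := (actT 𝔢 E : G → 𝔢 →L[ℝ] 𝔢)) (p := 1)
    ((hd.contMDiff_actT _).mdifferentiableAt (by simp)) (hd.mdiff_map 1)
  simp only [hd.actT_map, map_one] at h1
  exact h1.symm

theorem HasLog.map_crossed {d : E →* G} (hd : IsLieCrossedModule (𝔤 := 𝔤) (𝔢 := 𝔢) d)
    {f : X → E} {s : Set X} {x : X} {ℓ : X →L[ℝ] 𝔢} (hf : HasLog f s x ℓ) :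
    HasLog (fun y => d (f y)) s x ((derT d : 𝔢 →L[ℝ] 𝔤).comp ℓ) := by
  refine (HasTDeriv.comp_tmap hf (hd.mdiff_map (f x))).congr_deriv ?_
  have h1 := tmap_comp (F := 𝔢) (F₁ := 𝔢) (F₂ := 𝔤) (f := fun e : E => f x * e)
    (g := fun e : E => d e) (p := 1) (hd.mdiff_map _) (mdiff_mul_left 𝔢 (f x) 1)
  have h2 := tmap_comp (F := 𝔢) (F₁ := 𝔤) (F₂ := 𝔤) (f := fun e : E => d e)
    (g := fun g : G => d (f x) * g) (p := 1) (mdiff_mul_left 𝔤 _ _) (hd.mdiff_map _)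
  simp only [map_mul, map_one, mul_one] at h1 h2
  rw [← ContinuousLinearMap.comp_assoc, ← ContinuousLinearMap.comp_assoc, leftT, leftT, derT]
  rw [← h1, ← h2]

theorem HasLog.hasFDerivWithinAt_actT {d : E →* G}
    (hd : IsLieCrossedModule (𝔤 := 𝔤) (𝔢 := 𝔢) d)
    {f : X → G} {s : Set X} {x : X} {ℓ : X →L[ℝ] 𝔤} (hf : HasLog f s x ℓ) :
    HasFDerivWithinAt (fun y => actT 𝔢 E (f y))
      ((ContinuousLinearMap.compL ℝ 𝔢 𝔢 𝔢 (actT 𝔢 E (f x))).comp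
        ((actDer 𝔤 G 𝔢 E).comp ℓ)) s x :=
  hf.hasFDerivWithinAt_rep hd.contMDiff_actT hd.actT_mul

end CrossedModule

/-! ### Continuity and differentiability of parametric integrals -/
section ParametricIntegral

variable {Y : Type*} [NormedAddCommGroup Y] [NormedSpace ℝ Y]
  {V : Type*} [NormedAddCommGroup V] [NormedSpace ℝ V] {a b : ℝ} {S : Set Y}

theorem ContinuousOn.slice_fst {f : ℝ × Y → V} (hf : ContinuousOn f (Icc a b ×ˢ S)) {y : Y}
    (hy : y ∈ S) : ContinuousOn (fun t => f (t, y)) (Icc a b) :=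
  hf.comp (by fun_prop) fun _ ht => ⟨ht, hy⟩

theorem ContinuousOn.intervalIntegrable_slice {f : ℝ × Y → V}
    (hf : ContinuousOn f (Icc a b ×ˢ S)) {y : Y} (hy : y ∈ S) {t t' : ℝ} (ht : t ∈ Icc a b)
    (ht' : t' ∈ Icc a b) : IntervalIntegrable (fun τ => f (τ, y)) volume t t' :=
  ((hf.slice_fst hy).mono (uIcc_subset_Icc ht ht')).intervalIntegrable

/-- Uniform continuity on the compact set `[a, b] × S`. -/
theorem exists_dist_le_of_continuousOn_prod {f : ℝ × Y → V} (hS : IsCompact S)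
    (hf : ContinuousOn f (Icc a b ×ˢ S)) {ε : ℝ} (hε : 0 < ε) :
    ∃ δ > 0, ∀ t ∈ Icc a b, ∀ t' ∈ Icc a b, ∀ y ∈ S, ∀ y' ∈ S, ‖t - t'‖ < δ → ‖y - y'‖ < δ →
      ‖f (t, y) - f (t', y')‖ ≤ ε := by
  have hu := (isCompact_Icc.prod hS).uniformContinuousOn_of_continuous hf
  obtain ⟨δ, hδ, h⟩ := Metric.uniformContinuousOn_iff.1 hu ε hε
  refine ⟨δ, hδ, fun t ht t' ht' y hy y' hy' h1 h2 => ?_⟩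
  have := h (t, y) ⟨ht, hy⟩ (t', y') ⟨ht', hy'⟩
    (by rw [Prod.dist_eq, dist_eq_norm, dist_eq_norm]; exact max_lt h1 h2)
  rw [dist_eq_norm] at this
  exact this.le

variable [CompleteSpace V]

/-- The primitive `(t, y) ↦ ∫ₐᵗ f(τ, y) dτ` is continuous. -/
theorem continuousOn_parametric_primitive {f : ℝ × Y → V} (hS : IsCompact S)
    (hf : ContinuousOn f (Icc a b ×ˢ S)) :
    ContinuousOn (fun z : ℝ × Y => ∫ τ in a..z.1, f (τ, z.2)) (Icc a b ×ˢ S) := by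
  obtain ⟨C, hC⟩ := (isCompact_Icc.prod hS).exists_bound_of_continuousOn hf
  rintro ⟨t₀, y₀⟩ ⟨ht₀ : t₀ ∈ Icc a b, hy₀ : y₀ ∈ S⟩
  have hab : a ≤ b := ht₀.1.trans ht₀.2
  have ha : a ∈ Icc a b := left_mem_Icc.2 hab
  have hC0 : 0 ≤ C := (norm_nonneg _).trans (hC (t₀, y₀) ⟨ht₀, hy₀⟩)
  rw [Metric.continuousWithinAt_iff]
  intro ε hε
  obtain ⟨δ, hδ, h⟩ := exists_dist_le_of_continuousOn_prod hS hf
    (ε := ε / (2 * (b - a + 1))) (div_pos hε (by linarith))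
  refine ⟨min δ (ε / (2 * (C + 1))), lt_min hδ (by positivity), ?_⟩
  rintro ⟨t, y⟩ ⟨ht : t ∈ Icc a b, hy : y ∈ S⟩ hd
  rw [Prod.dist_eq, max_lt_iff, dist_eq_norm, dist_eq_norm, lt_min_iff, lt_min_iff] at hd
  obtain ⟨⟨hd1, hd2⟩, hd3, hd4⟩ := hd
  rw [dist_eq_norm]
  -- the contributions of the change of the end point and of the change of the parameter
  have e1 : (∫ τ in a..t, f (τ, y)) - ∫ τ in a..t₀, f (τ, y₀) =
      (∫ τ in t₀..t, f (τ, y)) + ∫ τ in a..t₀, (f (τ, y) - f (τ, y₀)) := by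
    rw [intervalIntegral.integral_sub (hf.intervalIntegrable_slice hy ha ht₀)
      (hf.intervalIntegrable_slice hy₀ ha ht₀),
      ← intervalIntegral.integral_add_adjacent_intervals
        (hf.intervalIntegrable_slice hy ha ht₀) (hf.intervalIntegrable_slice hy ht₀ ht)]
    abel
  have e2 : ‖∫ τ in t₀..t, f (τ, y)‖ ≤ C * |t - t₀| :=
    intervalIntegral.norm_integral_le_of_norm_le_const fun τ hτ =>
      hC _ ⟨uIcc_subset_Icc ht₀ ht (uIoc_subset_uIcc hτ), hy⟩
  have e3 : ‖∫ τ in a..t₀, (f (τ, y) - f (τ, y₀))‖ ≤ ε / (2 * (b - a + 1)) * |t₀ - a| :=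
    intervalIntegral.norm_integral_le_of_norm_le_const fun τ hτ => by
      have hτ' := uIcc_subset_Icc ha ht₀ (uIoc_subset_uIcc hτ)
      exact h τ hτ' τ hτ' y hy y₀ hy₀ (by simpa using hδ) hd3
  rw [e1]
  have e4 : ε / (2 * (b - a + 1)) * |t₀ - a| < ε / 2 := by
    rw [abs_of_nonneg (by linarith [ht₀.1])]
    have : t₀ - a < b - a + 1 := by linarith [ht₀.2]
    calc ε / (2 * (b - a + 1)) * (t₀ - a) < ε / (2 * (b - a + 1)) * (b - a + 1) := by
          apply mul_lt_mul_of_pos_left this (div_pos hε (by linarith))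
      _ = ε / 2 := by field_simp [show b - a + 1 ≠ 0 by linarith]
  have e5 : C * |t - t₀| ≤ ε / 2 := by
    rw [Real.norm_eq_abs] at hd2
    calc C * |t - t₀| ≤ (C + 1) * (ε / (2 * (C + 1))) := by gcongr; linarith
      _ = ε / 2 := by field_simp
  calc _ ≤ _ := norm_add_le _ _
    _ < ε := by linarith

/-- Differentiation under the integral sign for `(t, y) ↦ ∫ₐᵗ f(τ, y) dτ`. -/
theorem hasFDerivWithinAt_parametric_primitive {f : ℝ × Y → V} {f' : ℝ × Y → Y →L[ℝ] V}
    (hS : IsCompact S) (hc : Convex ℝ S) (hf : ContinuousOn f (Icc a b ×ˢ S))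
    (hf' : ContinuousOn f' (Icc a b ×ˢ S))
    (hff' : ∀ t ∈ Icc a b, ∀ y ∈ S, HasFDerivWithinAt (fun y => f (t, y)) (f' (t, y)) S y)
    {t₀ : ℝ} (ht₀ : t₀ ∈ Icc a b) {y₀ : Y} (hy₀ : y₀ ∈ S) :
    HasFDerivWithinAt (fun z : ℝ × Y => ∫ τ in a..z.1, f (τ, z.2))
      ((ContinuousLinearMap.fst ℝ ℝ Y).smulRight (f (t₀, y₀)) +
        (∫ τ in a..t₀, f' (τ, y₀)).comp (ContinuousLinearMap.snd ℝ ℝ Y)) (Icc a b ×ˢ S)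
      (t₀, y₀) := by
  have hab : a ≤ b := ht₀.1.trans ht₀.2
  have ha : a ∈ Icc a b := left_mem_Icc.2 hab
  rw [hasFDerivWithinAt_iff_isLittleO, Asymptotics.isLittleO_iff]
  intro ε hε
  obtain ⟨δ, hδ, h⟩ := exists_dist_le_of_continuousOn_prod hS hf (half_pos hε)
  obtain ⟨δ', hδ', h'⟩ := exists_dist_le_of_continuousOn_prod hS hf'
    (ε := ε / (2 * (b - a + 1))) (div_pos hε (by linarith))
  filter_upwards [inter_mem_nhdsWithin _ (Metric.ball_mem_nhds (t₀, y₀) (lt_min hδ hδ'))]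
  rintro ⟨t, y⟩ ⟨⟨ht : t ∈ Icc a b, hy : y ∈ S⟩, hd⟩
  rw [Metric.mem_ball, Prod.dist_eq, max_lt_iff, dist_eq_norm, dist_eq_norm, lt_min_iff,
    lt_min_iff] at hd
  obtain ⟨⟨hd1, hd2⟩, hd3, hd4⟩ := hd
  simp only at hd1 hd2 hd3 hd4
  have i1 := hf.intervalIntegrable_slice hy ha ht₀
  have i2 := hf.intervalIntegrable_slice hy₀ ha ht₀
  have i3 := hf.intervalIntegrable_slice hy ht₀ ht
  have i4 := hf'.intervalIntegrable_slice hy₀ ha ht₀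
  have i5 : IntervalIntegrable (fun τ => f' (τ, y₀) (y - y₀)) volume a t₀ :=
    (hf'.clm_apply continuousOn_const).intervalIntegrable_slice hy₀ ha ht₀
  -- the remainder, as a contribution of the change of the end point, where `f` is close to
  -- `f (t₀, y₀)`, and one of the change of the parameter, bounded by the mean value inequality
  have e1 : (∫ τ in a..t, f (τ, y)) - (∫ τ in a..t₀, f (τ, y₀)) -
      ((t - t₀) • f (t₀, y₀) + (∫ τ in a..t₀, f' (τ, y₀)) (y - y₀)) =
      (∫ τ in t₀..t, (f (τ, y) - f (t₀, y₀))) +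
        ∫ τ in a..t₀, (f (τ, y) - f (τ, y₀) - f' (τ, y₀) (y - y₀)) := by
    rw [intervalIntegral.integral_sub i3 (by simp), intervalIntegral.integral_const,
      intervalIntegral.integral_sub (i1.sub i2) i5, intervalIntegral.integral_sub i1 i2,
      ← intervalIntegral.integral_add_adjacent_intervals i1 i3,
      ContinuousLinearMap.intervalIntegral_apply i4]
    abel
  have e2 : ‖∫ τ in t₀..t, (f (τ, y) - f (t₀, y₀))‖ ≤ ε / 2 * |t - t₀| :=
    intervalIntegral.norm_integral_le_of_norm_le_const fun τ hτ => by
      have hτ' := uIoc_subset_uIcc hτ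
      refine h τ (uIcc_subset_Icc ht₀ ht hτ') t₀ ht₀ y hy y₀ hy₀ ?_ hd3
      have := abs_sub_left_of_mem_uIcc hτ'
      rw [Real.norm_eq_abs]
      exact lt_of_le_of_lt this hd1
  have e3 : ‖∫ τ in a..t₀, (f (τ, y) - f (τ, y₀) - f' (τ, y₀) (y - y₀))‖ ≤
      (ε / (2 * (b - a + 1)) * ‖y - y₀‖) * |t₀ - a| :=
    intervalIntegral.norm_integral_le_of_norm_le_const fun τ hτ => by
      have hτ' := uIcc_subset_Icc ha ht₀ (uIoc_subset_uIcc hτ)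
      have hcv : Convex ℝ (S ∩ Metric.ball y₀ δ') := hc.inter (convex_ball _ _)
      refine hcv.norm_image_sub_le_of_norm_hasFDerivWithin_le' (f := fun y => f (τ, y))
        (f' := fun y => f' (τ, y))
        (fun z hz => (hff' τ hτ' z hz.1).mono inter_subset_left) (fun z hz => ?_)
        ⟨hy₀, Metric.mem_ball_self hδ'⟩ ⟨hy, by rwa [Metric.mem_ball, dist_eq_norm]⟩
      refine h' τ hτ' τ hτ' z hz.1 y₀ hy₀ (by simpa using hδ') ?_
      simpa [dist_eq_norm] using hz.2
  have e4 : (ε / (2 * (b - a + 1)) * ‖y - y₀‖) * |t₀ - a| ≤ ε / 2 * ‖y - y₀‖ := by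
    rw [abs_of_nonneg (by linarith [ht₀.1])]
    have : t₀ - a ≤ b - a + 1 := by linarith [ht₀.2]
    calc (ε / (2 * (b - a + 1)) * ‖y - y₀‖) * (t₀ - a)
        ≤ (ε / (2 * (b - a + 1)) * ‖y - y₀‖) * (b - a + 1) := by
          apply mul_le_mul_of_nonneg_left this
          have : 0 < b - a + 1 := by linarith
          positivity
      _ = ε / 2 * ‖y - y₀‖ := by field_simp [show b - a + 1 ≠ 0 by linarith]
  have n1 : |t - t₀| ≤ ‖((t, y) - (t₀, y₀) : ℝ × Y)‖ := norm_fst_le ((t, y) - (t₀, y₀) : ℝ × Y)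
  have n2 : ‖y - y₀‖ ≤ ‖((t, y) - (t₀, y₀) : ℝ × Y)‖ := norm_snd_le ((t, y) - (t₀, y₀) : ℝ × Y)
  calc _ = ‖(∫ τ in t₀..t, (f (τ, y) - f (t₀, y₀))) +
        ∫ τ in a..t₀, (f (τ, y) - f (τ, y₀) - f' (τ, y₀) (y - y₀))‖ := by
        rw [← e1]; simp
    _ ≤ ε / 2 * |t - t₀| + ε / 2 * ‖y - y₀‖ :=
        (norm_add_le _ _).trans (add_le_add e2 (e3.trans e4))
    _ ≤ ε / 2 * ‖((t, y) - (t₀, y₀) : ℝ × Y)‖ + ε / 2 * ‖((t, y) - (t₀, y₀) : ℝ × Y)‖ := by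
        gcongr
    _ = ε * ‖((t, y) - (t₀, y₀) : ℝ × Y)‖ := by ring

end ParametricIntegral

/-! ### Smoothness of parametric integrals -/
section ParametricIntegralSmooth

variable {Y : Type} [NormedAddCommGroup Y] [NormedSpace ℝ Y] {a b : ℝ} {S : Set Y}

theorem uniqueDiffOn_Icc_prod (hab : a < b) (hc : Convex ℝ S) (hi : (interior S).Nonempty) :
    UniqueDiffOn ℝ (Icc a b ×ˢ S) :=
  (uniqueDiffOn_Icc hab).prod (uniqueDiffOn_convex hc hi)

theorem HasFDerivWithinAt.slice_snd {V : Type*} [NormedAddCommGroup V] [NormedSpace ℝ V]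
    {f : ℝ × Y → V} {t : ℝ} {y : Y} {f' : ℝ × Y →L[ℝ] V}
    (hf : HasFDerivWithinAt f f' (Icc a b ×ˢ S) (t, y)) (ht : t ∈ Icc a b) :
    HasFDerivWithinAt (fun y => f (t, y)) (f'.comp (ContinuousLinearMap.inr ℝ ℝ Y)) S y :=
  HasFDerivWithinAt.comp (f := fun y : Y => (t, y)) y hf
    (hasFDerivAt_prodMk_right t y).hasFDerivWithinAt fun _ hy => ⟨ht, hy⟩

theorem HasFDerivWithinAt.slice_fst {V : Type*} [NormedAddCommGroup V] [NormedSpace ℝ V]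
    {f : ℝ × Y → V} {t : ℝ} {y : Y} {f' : ℝ × Y →L[ℝ] V}
    (hf : HasFDerivWithinAt f f' (Icc a b ×ˢ S) (t, y)) (hy : y ∈ S) :
    HasDerivWithinAt (fun t => f (t, y)) (f' (1, 0)) (Icc a b) t := by
  have := HasFDerivWithinAt.comp (f := fun t : ℝ => (t, y)) t hf
    (hasFDerivAt_prodMk_left t y).hasFDerivWithinAt fun _ ht => ⟨ht, hy⟩
  simpa [Function.comp_def] using this.hasDerivWithinAt

/-- The primitive `(t, y) ↦ ∫ₐᵗ f(τ, y) dτ` of a function of class `C^n` is of class `C^n`. -/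
theorem contDiffOn_parametric_primitive_nat (hab : a < b) (hS : IsCompact S) (hc : Convex ℝ S)
    (hi : (interior S).Nonempty) (n : ℕ) :
    ∀ {V : Type*} [NormedAddCommGroup V] [NormedSpace ℝ V] [CompleteSpace V] {f : ℝ × Y → V},
    ContDiffOn ℝ n f (Icc a b ×ˢ S) →
    ContDiffOn ℝ n (fun z : ℝ × Y => ∫ τ in a..z.1, f (τ, z.2)) (Icc a b ×ˢ S) := by
  have hu := uniqueDiffOn_Icc_prod hab hc hi
  induction n with
  | zero =>
    intro V _ _ _ f hf
    simp only [Nat.cast_zero, contDiffOn_zero] at hf ⊢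
    exact continuousOn_parametric_primitive hS hf
  | succ n ih =>
    intro V _ _ _ f hf
    have hd : ∀ z ∈ Icc a b ×ˢ S, HasFDerivWithinAt f (fderivWithin ℝ f (Icc a b ×ˢ S) z)
        (Icc a b ×ˢ S) z := fun z hz =>
      ((hf z hz).differentiableWithinAt (by simp)).hasFDerivWithinAt
    have hf1 : ContDiffOn ℝ n (fun z => (fderivWithin ℝ f (Icc a b ×ˢ S) z).comp
        (ContinuousLinearMap.inr ℝ ℝ Y)) (Icc a b ×ˢ S) :=
      (hf.fderivWithin hu (m := n) (by norm_cast)).clm_comp contDiffOn_const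
    have hD : ∀ z ∈ Icc a b ×ˢ S, HasFDerivWithinAt (fun z : ℝ × Y => ∫ τ in a..z.1, f (τ, z.2))
        ((ContinuousLinearMap.fst ℝ ℝ Y).smulRight (f z) +
        (∫ τ in a..z.1, (fderivWithin ℝ f (Icc a b ×ˢ S) (τ, z.2)).comp
          (ContinuousLinearMap.inr ℝ ℝ Y)).comp (ContinuousLinearMap.snd ℝ ℝ Y))
        (Icc a b ×ˢ S) z := by
      rintro ⟨t, y⟩ ⟨ht, hy⟩
      exact hasFDerivWithinAt_parametric_primitive hS hc hf.continuousOn hf1.continuousOn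
        (fun t ht y hy => (hd (t, y) ⟨ht, hy⟩).slice_snd ht) ht hy
    push_cast
    rw [contDiffOn_succ_iff_fderivWithin hu]
    refine ⟨fun z hz => (hD z hz).differentiableWithinAt, by simp, ?_⟩
    refine ContDiffOn.congr ?_ fun z hz => (hD z hz).fderivWithin (hu z hz)
    refine ContDiffOn.add ?_ ?_
    · exact contDiffOn_const.smulRight (hf.of_le (by norm_cast; omega))
    · exact (ih hf1).clm_comp contDiffOn_const

theorem contDiffOn_parametric_primitive (hab : a < b) (hS : IsCompact S) (hc : Convex ℝ S)
    (hi : (interior S).Nonempty) {V : Type*} [NormedAddCommGroup V] [NormedSpace ℝ V]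
    [CompleteSpace V] {f : ℝ × Y → V} {n : ℕ∞} (hf : ContDiffOn ℝ n f (Icc a b ×ˢ S)) :
    ContDiffOn ℝ n (fun z : ℝ × Y => ∫ τ in a..z.1, f (τ, z.2)) (Icc a b ×ˢ S) := by
  rw [contDiffOn_iff_forall_nat_le]
  intro m hm
  exact contDiffOn_parametric_primitive_nat hab hS hc hi m (hf.of_le (by exact_mod_cast hm))

end ParametricIntegralSmooth

/-! ### The equation `g' = g K` on a Lie group -/
section LieODE

variable {𝔤 : Type*} [NormedAddCommGroup 𝔤] [NormedSpace ℝ 𝔤] [CompleteSpace 𝔤]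
  {G : Type*} [TopologicalSpace G] [ChartedSpace 𝔤 G] [Group G] [LieGroup 𝓘(ℝ, 𝔤) ∞ G]

/-- The curve `g` in `G` solves `g' = g K` on `[a, b]`. -/
def IsLogSol (g : ℝ → G) (K : ℝ → 𝔤) (a b : ℝ) : Prop :=
  ∀ t ∈ Icc a b, HasLog g (Icc a b) t ((1 : ℝ →L[ℝ] ℝ).smulRight (K t))

theorem IsLogSol.eqOn {g h : ℝ → G} {K : ℝ → 𝔤} {a b : ℝ} (hg : IsLogSol g K a b)
    (hh : IsLogSol h K a b) {c : ℝ} (hc : c ∈ Icc a b) (e : g c = h c) : EqOn g h (Icc a b) :=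
  fun _ ht => HasLog.eq_of_eq ordConnected_Icc hg hh hc e ht

theorem IsLogSol.const_mul {g : ℝ → G} {K : ℝ → 𝔤} {a b : ℝ} (hg : IsLogSol g K a b) (c : G) :
    IsLogSol (fun t => c * g t) K a b := fun t ht =>
  ((hasLog_const (𝔤 := 𝔤) c (Icc a b) t).mul (hg t ht)).congr_deriv (by simp)

theorem IsLogSol.congr {g h : ℝ → G} {K : ℝ → 𝔤} {a b : ℝ} (hg : IsLogSol g K a b)
    (e : EqOn h g (Icc a b)) : IsLogSol h K a b :=
  fun t ht => (hg t ht).congr e ht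

theorem IsLogSol.union {g : ℝ → G} {K : ℝ → 𝔤} {a b c : ℝ} (h1 : IsLogSol g K a c)
    (h2 : IsLogSol g K c b) (hac : a ≤ c) (hcb : c ≤ b) : IsLogSol g K a b := by
  intro t ht
  have hU : Icc a c ∪ Icc c b = Icc a b := Icc_union_Icc_eq_Icc hac hcb
  rcases lt_trichotomy t c with h | rfl | h
  · refine HasTDeriv.mono_of_mem (h1 t ⟨ht.1, h.le⟩) ?_
    rw [← hU]
    have : Iio c ∩ (Icc a c ∪ Icc c b) ⊆ Icc a c := by
      rintro x ⟨hx, hx' | hx'⟩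
      · exact hx'
      · exact absurd hx'.1 (not_le.2 hx)
    exact Filter.mem_of_superset (Filter.inter_mem (mem_nhdsWithin_of_mem_nhds (Iio_mem_nhds h))
      self_mem_nhdsWithin) this
  · rw [← hU]
    exact HasMFDerivWithinAt.union (h1 t (right_mem_Icc.2 hac)) (h2 t (left_mem_Icc.2 hcb))
  · refine HasTDeriv.mono_of_mem (h2 t ⟨h.le, ht.2⟩) ?_
    rw [← hU]
    have : Ioi c ∩ (Icc a c ∪ Icc c b) ⊆ Icc c b := by
      rintro x ⟨hx, hx' | hx'⟩
      · exact absurd hx'.2 (not_le.2 hx)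
      · exact hx'
    exact Filter.mem_of_superset (Filter.inter_mem (mem_nhdsWithin_of_mem_nhds (Ioi_mem_nhds h))
      self_mem_nhdsWithin) this

variable (𝔤 G) in
/-- Solvability of `g' = g K`, `g(a) = 1` for small `K` by the Picard–Lindelöf theorem in the chart
at `1`, with bounds for the solution that are linear in the size of `K`. -/
theorem exists_isLogSol_of_small : ∃ ε > 0, ∃ C ≥ 0, ∀ (a b : ℝ) (K : ℝ → 𝔤) (η : ℝ), a ≤ b →
    0 ≤ η → η * (b - a) ≤ ε → ContinuousOn K (Icc a b) → (∀ t ∈ Icc a b, ‖K t‖ ≤ η) →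
    ∃ g : ℝ → G, g a = 1 ∧ IsLogSol g K a b ∧ ∀ t ∈ Icc a b, g t ∈ (chartAt 𝔤 (1 : G)).source ∧
      ‖logChart 𝔤 1 (g t) - ContinuousLinearMap.id ℝ 𝔤‖ ≤ C * (η * (b - a)) := by
  set ψ := extChartAt 𝓘(ℝ, 𝔤) (1 : G) with hψ
  -- in the chart `ψ` at `1` the equation is `z' = Ψ(z) K`
  let Ψ : 𝔤 → 𝔤 →L[ℝ] 𝔤 := fun z => logChart 𝔤 1 (ψ.symm z)
  have hΨ1 : Ψ (ψ 1) = ContinuousLinearMap.id ℝ 𝔤 := by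
    simp only [Ψ, hψ, extChartAt_to_inv, logChart_one]
  have hΨ : ContDiffAt ℝ 1 Ψ (ψ 1) := by
    rw [← contMDiffAt_iff_contDiffAt]
    have h1 : ContMDiffAt 𝓘(ℝ, 𝔤) 𝓘(ℝ, 𝔤) ∞ ψ.symm (ψ 1) := by
      have := contMDiffWithinAt_extChartAt_symm_range_self (I := 𝓘(ℝ, 𝔤)) (n := ∞) (1 : G)
      rwa [ModelWithCorners.range_eq_univ, contMDiffWithinAt_univ] at this
    have h2 : ContMDiffAt 𝓘(ℝ, 𝔤) 𝓘(ℝ, 𝔤 →L[ℝ] 𝔤) ∞ (logChart 𝔤 (1 : G)) (ψ.symm (ψ 1)) := by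
      rw [hψ, extChartAt_to_inv]; exact contMDiffAt_logChart (mem_chart_source 𝔤 1)
    exact (ContMDiffAt.comp (I' := 𝓘(ℝ, 𝔤)) (ψ 1) h2 h1).of_le (by exact_mod_cast le_top)
  obtain ⟨L, s, hs, hL⟩ := hΨ.exists_lipschitzOnWith
  -- on the ball of radius `r` the chart is defined and `Ψ` is Lipschitz, hence bounded by `B`
  obtain ⟨r, hr, hrs⟩ := Metric.nhds_basis_closedBall.mem_iff.1
    (Filter.inter_mem hs (extChartAt_target_mem_nhds (I := 𝓘(ℝ, 𝔤)) (1 : G)))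
  have hLr : ∀ z ∈ Metric.closedBall (ψ 1) r, ‖Ψ z - ContinuousLinearMap.id ℝ 𝔤‖ ≤
      L * ‖z - ψ 1‖ := fun z hz => by
    rw [← hΨ1]
    exact hL.norm_sub_le (hrs hz).1 (hrs (Metric.mem_closedBall_self hr.le)).1
  set B : ℝ := 1 + L * r with hB
  have hB0 : 0 < B := by positivity
  have hBr : ∀ z ∈ Metric.closedBall (ψ 1) r, ‖Ψ z‖ ≤ B := fun z hz => by
    have h1 := hLr z hz
    have h2 : ‖z - ψ 1‖ ≤ r := by simpa [dist_eq_norm] using hz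
    calc ‖Ψ z‖ = ‖ContinuousLinearMap.id ℝ 𝔤 + (Ψ z - ContinuousLinearMap.id ℝ 𝔤)‖ := by
          congr 1; abel
      _ ≤ _ := norm_add_le _ _
      _ ≤ 1 + L * r := add_le_add ContinuousLinearMap.norm_id_le (h1.trans (by gcongr))
  -- the speed is at most `B η`, so that for `η (b - a) ≤ r / B` the solution stays in the ball of
  -- radius `ρ = B η (b - a) ≤ r`
  refine ⟨r / B, by positivity, L * B, by positivity, fun a b K η hab hη hηε hK hKη => ?_⟩
  have hba : 0 ≤ b - a := by linarith
  set ρ : ℝ := B * (η * (b - a)) with hρ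
  have hρ0 : 0 ≤ ρ := by positivity
  have hρr : ρ ≤ r := by
    calc ρ ≤ B * (r / B) := by rw [hρ]; gcongr
      _ = r := by field_simp
  have hball : Metric.closedBall (ψ 1) ρ ⊆ Metric.closedBall (ψ 1) r :=
    Metric.closedBall_subset_closedBall hρr
  have hP : IsPicardLindelof (fun t z => Ψ z (K t)) (tmin := a) (tmax := b)
      ⟨a, left_mem_Icc.2 hab⟩ (ψ 1) ρ.toNNReal 0 (B * η).toNNReal (L * η.toNNReal) := by
    have hBη : ((B * η).toNNReal : ℝ) = B * η := Real.coe_toNNReal _ (by positivity)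
    have hρ' : (ρ.toNNReal : ℝ) = ρ := Real.coe_toNNReal _ hρ0
    have hη' : (η.toNNReal : ℝ) = η := Real.coe_toNNReal _ hη
    refine ⟨fun t ht => ?_, fun z hz => ?_, fun t ht z hz => ?_, ?_⟩
    · rw [hρ']
      refine LipschitzOnWith.of_dist_le_mul fun z hz z' hz' => ?_
      rw [dist_eq_norm, dist_eq_norm, ← sub_apply]
      refine (ContinuousLinearMap.le_opNorm _ _).trans ?_
      have := hL.norm_sub_le (hrs (hball hz)).1 (hrs (hball hz')).1
      calc ‖Ψ z - Ψ z'‖ * ‖K t‖ ≤ (L * ‖z - z'‖) * η := by gcongr; exact hKη t ht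
        _ = _ := by rw [NNReal.coe_mul, hη']; ring
    · exact continuousOn_const.clm_apply hK
    · rw [hρ'] at hz
      rw [hBη]
      refine (ContinuousLinearMap.le_opNorm _ _).trans ?_
      exact mul_le_mul (hBr z (hball hz)) (hKη t ht) (norm_nonneg _) hB0.le
    · rw [hBη, hρ', sub_self, NNReal.coe_zero, sub_zero, max_eq_left hba, hρ, mul_assoc]
  -- the fixed point of the Picard operator is used, and not only the solution, because it is known
  -- to stay in the ball of radius `ρ`
  obtain ⟨α, hα⟩ := ODE.FunSpace.exists_isFixedPt_next hP (Metric.mem_closedBall_self le_rfl)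
  have hαb : ∀ t, α.compProj t ∈ Metric.closedBall (ψ 1) ρ := fun t => by
    have := α.compProj_mem_closedBall (t := t) hP.mul_max_le
    rwa [Real.coe_toNNReal _ hρ0] at this
  have hα0 : α.compProj a = ψ 1 := by
    have := α.compProj_val (t := ⟨a, left_mem_Icc.2 hab⟩)
    rw [this, ← hα]; exact ODE.FunSpace.next_apply₀ _ _ _
  have hαd : ∀ t ∈ Icc a b, HasDerivWithinAt α.compProj (Ψ (α.compProj t) (K t)) (Icc a b) t := by
    intro t ht
    apply ODE.hasDerivWithinAt_picard_Icc (left_mem_Icc.2 hab) hP.continuousOn_uncurry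
      α.continuous_compProj.continuousOn (fun _ _ => α.compProj_mem_closedBall hP.mul_max_le)
      (ψ 1) ht |>.congr_of_mem _ ht
    intro t' ht'
    nth_rw 1 [← hα]
    rw [ODE.FunSpace.compProj_of_mem ht', ODE.FunSpace.next_apply]
  have htgt : ∀ t, α.compProj t ∈ ψ.target := fun t => (hrs (hball (hαb t))).2
  refine ⟨fun t => ψ.symm (α.compProj t), ?_, fun t ht => ?_, fun t ht => ⟨?_, ?_⟩⟩
  · simp only [hα0, hψ, extChartAt_to_inv]
  · refine hasLog_extChartAt_symm 1 (htgt t) ((hαd t ht).hasFDerivWithinAt.congr_fderiv ?_)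
    ext; simp [Ψ, hψ]
  · simpa [hψ] using ψ.map_target (htgt t)
  · have h1 := hLr _ (hball (hαb t))
    have h2 : ‖α.compProj t - ψ 1‖ ≤ ρ := by simpa [dist_eq_norm] using hαb t
    calc _ ≤ L * ‖α.compProj t - ψ 1‖ := h1
      _ ≤ L * ρ := by gcongr
      _ = _ := by rw [hρ]; ring

/-- The equation `g' = g K`, `g(a) = 1` on a Lie group has a solution on the whole interval:
left translates of solutions are solutions, so short solutions can be concatenated. -/
theorem exists_isLogSol {K : ℝ → 𝔤} {a b : ℝ} (hab : a ≤ b) (hK : ContinuousOn K (Icc a b)) :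
    ∃ g : ℝ → G, g a = 1 ∧ IsLogSol g K a b := by
  obtain ⟨ε, hε, C, -, hsmall⟩ := exists_isLogSol_of_small 𝔤 G
  obtain ⟨η, hη⟩ := isCompact_Icc.exists_bound_of_continuousOn hK
  have hη0 : 0 ≤ η := (norm_nonneg _).trans (hη a (left_mem_Icc.2 hab))
  obtain ⟨N, hN⟩ := exists_nat_gt (η * (b - a) / ε)
  have hN0 : (0 : ℝ) < N := lt_of_le_of_lt
    (div_nonneg (mul_nonneg hη0 (by linarith)) hε.le) hN
  -- `N` steps of length `h`, short enough for the local existence result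
  set h : ℝ := (b - a) / N with hh
  have hh0 : 0 ≤ h := div_nonneg (by linarith) hN0.le
  have hNh : N * h = b - a := by rw [hh]; field_simp
  have key : ∀ k : ℕ, k ≤ N → ∃ g : ℝ → G, g a = 1 ∧ IsLogSol g K a (a + k * h) := by
    intro k
    induction k with
    | zero =>
      intro _
      obtain ⟨g, h1, h2, -⟩ := hsmall a a K η le_rfl hη0 (by simpa using hε.le)
        (hK.mono (Icc_subset_Icc le_rfl hab)) (fun t ht => hη t ⟨ht.1, ht.2.trans hab⟩)
      exact ⟨g, h1, by simpa using h2⟩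
    | succ k ih =>
      intro hk
      obtain ⟨g₁, h1, h1'⟩ := ih (by omega)
      have hk' : ((k : ℝ) + 1) * h ≤ b - a := by
        rw [← hNh]; gcongr; exact_mod_cast hk
      have hkh : 0 ≤ (k : ℝ) * h := by positivity
      have hsub : Icc (a + k * h) (a + (k + 1 : ℕ) * h) ⊆ Icc a b := by
        push_cast
        exact Icc_subset_Icc (by linarith) (by linarith)
      have hle : a + k * h ≤ a + (k + 1 : ℕ) * h := by push_cast; linarith
      obtain ⟨g₂, h2, h2', -⟩ := hsmall (a + k * h) (a + (k + 1 : ℕ) * h) K η hle hη0 (by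
        push_cast
        have : η * (b - a) / N ≤ ε := by
          rw [div_le_iff₀ hN0, mul_comm ε]; exact ((div_lt_iff₀ hε).1 hN).le
        calc η * (a + (k + 1) * h - (a + k * h)) = η * (b - a) / N := by rw [hh]; ring
          _ ≤ ε := this) (hK.mono hsub) (fun t ht => hη t (hsub ht))
      refine ⟨fun t => if t ≤ a + k * h then g₁ t else g₁ (a + k * h) * g₂ t, ?_, ?_⟩
      · simp only [if_pos (show a ≤ a + k * h by linarith), h1]
      · refine IsLogSol.union (h1'.congr fun t ht => if_pos ht.2)
          ((h2'.const_mul (g₁ (a + k * h))).congr fun t ht => ?_) (by linarith) hle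
        rcases eq_or_lt_of_le ht.1 with e | e
        · simp only
          rw [← e, if_pos le_rfl, h2, mul_one]
        · simp only [if_neg (not_le.2 e)]
  obtain ⟨g, h1, h2⟩ := key N le_rfl
  rw [hNh, add_sub_cancel] at h2
  exact ⟨g, h1, h2⟩

end LieODE

/-! ### Smooth dependence on parameters and the formula of Duhamel -/
section LieODEParam

variable {𝔤 : Type*} [NormedAddCommGroup 𝔤] [NormedSpace ℝ 𝔤] [CompleteSpace 𝔤]
  {G : Type*} [TopologicalSpace G] [ChartedSpace 𝔤 G] [Group G] [LieGroup 𝓘(ℝ, 𝔤) ∞ G]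
  {Y : Type} [NormedAddCommGroup Y] [NormedSpace ℝ Y] {S : Set Y} {a b : ℝ}

/-- The logarithmic derivative of the solution `g` of `g' = g K` with respect to time and the
parameter `y`, given by Duhamel's formula `g⁻¹ ∂_y g = Ad(g⁻¹) ∫ₐᵗ Ad(g) ∂_y K`. -/
def duhamel (K' : ℝ × Y → Y →L[ℝ] 𝔤) (K : ℝ × Y → 𝔤) (g : ℝ × Y → G) (a : ℝ) (z : ℝ × Y) :
    ℝ × Y →L[ℝ] 𝔤 :=
  (ContinuousLinearMap.fst ℝ ℝ Y).smulRight (K z) +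
    ((adT 𝔤 (g z)⁻¹).comp (∫ τ in a..z.1, (adT 𝔤 (g (τ, z.2))).comp (K' (τ, z.2)) :
      Y →L[ℝ] 𝔤)).comp (ContinuousLinearMap.snd ℝ ℝ Y)

/-- Solutions `g(·, y)` of `g' = g K` depend differentiably on time and on the parameter `y`.

With `k = g(·, y₀)`, the quotient `δ = g(·, y) k⁻¹` solves `δ' = δ Ad(k)(K(·, y) - K(·, y₀))`.  The
right hand side is of size `O(‖y - y₀‖)`, so `δ` stays in the chart at `1` and differs there from
the primitive of the right hand side by `O(‖y - y₀‖²)`.  This yields the derivative of `δ` at `y₀`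
and hence that of `g = δ k`. -/
theorem hasLog_duhamel {K : ℝ × Y → 𝔤} {K' : ℝ × Y → Y →L[ℝ] 𝔤} {g : ℝ × Y → G}
    (hS : IsCompact S) (hc : Convex ℝ S) (hK : ContinuousOn K (Icc a b ×ˢ S))
    (hK' : ContinuousOn K' (Icc a b ×ˢ S))
    (hKK' : ∀ t ∈ Icc a b, ∀ y ∈ S, HasFDerivWithinAt (fun y => K (t, y)) (K' (t, y)) S y)
    (hg1 : ∀ y ∈ S, g (a, y) = 1)
    (hg : ∀ y ∈ S, IsLogSol (fun t => g (t, y)) (fun t => K (t, y)) a b)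
    {z₀ : ℝ × Y} (hz₀ : z₀ ∈ Icc a b ×ˢ S) :
    HasLog g (Icc a b ×ˢ S) z₀ (duhamel K' K g a z₀) := by
  obtain ⟨t₀, y₀⟩ := z₀
  obtain ⟨ht₀, hy₀⟩ : t₀ ∈ Icc a b ∧ y₀ ∈ S := hz₀
  have hab : a ≤ b := ht₀.1.trans ht₀.2
  have hba : 0 ≤ b - a := by linarith
  have ha : a ∈ Icc a b := left_mem_Icc.2 hab
  set ψ := extChartAt 𝓘(ℝ, 𝔤) (1 : G) with hψ
  set k : ℝ → G := fun t => g (t, y₀) with hk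
  have hkc : ContinuousOn k (Icc a b) := fun t ht =>
    HasTDeriv.continuousWithinAt (hg y₀ hy₀ t ht)
  have hAk : ContinuousOn (fun t => adT 𝔤 (k t)) (Icc a b) :=
    (contMDiff_adT (𝔤 := 𝔤) (G := G)).continuous.comp_continuousOn hkc
  have hAk' : ContinuousOn (fun z : ℝ × Y => adT 𝔤 (k z.1)) (Icc a b ×ˢ S) :=
    hAk.comp continuousOn_fst fun z hz => hz.1
  set W : ℝ × Y → 𝔤 := fun z => adT 𝔤 (k z.1) (K z - K (z.1, y₀)) with hW
  have hWc : ContinuousOn W (Icc a b ×ˢ S) := by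
    refine hAk'.clm_apply (hK.sub (hK.comp (by fun_prop) fun z hz => ⟨hz.1, hy₀⟩))
  have hW'c : ContinuousOn (fun z : ℝ × Y => (adT 𝔤 (k z.1)).comp (K' z)) (Icc a b ×ˢ S) :=
    hAk'.clm_comp hK'
  have hWW' : ∀ t ∈ Icc a b, ∀ y ∈ S, HasFDerivWithinAt (fun y => W (t, y))
      ((adT 𝔤 (k t)).comp (K' (t, y))) S y := fun t ht y hy =>
    (adT 𝔤 (k t) : 𝔤 →L[ℝ] 𝔤).hasFDerivAt.comp_hasFDerivWithinAt y
      ((hKK' t ht y hy).sub_const (K (t, y₀)))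
  -- the primitive of `W` is the first-order part of `g k⁻¹` in the chart at `1`
  set I : ℝ × Y → 𝔤 := fun z => ∫ τ in a..z.1, W (τ, z.2) with hI
  have hId : ∀ t ∈ Icc a b, ∀ y ∈ S, HasFDerivWithinAt I
      ((ContinuousLinearMap.fst ℝ ℝ Y).smulRight (W (t, y)) +
        (∫ τ in a..t, (adT 𝔤 (k τ)).comp (K' (τ, y)) : Y →L[ℝ] 𝔤).comp
          (ContinuousLinearMap.snd ℝ ℝ Y)) (Icc a b ×ˢ S) (t, y) := fun t ht y hy =>
    hasFDerivWithinAt_parametric_primitive hS hc hWc hW'c hWW' ht hy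
  obtain ⟨C₀, hC₀⟩ := (isCompact_Icc.prod hS).exists_bound_of_continuousOn hW'c
  have hC₀0 : 0 ≤ C₀ := (norm_nonneg _).trans (hC₀ (a, y₀) ⟨ha, hy₀⟩)
  have hWb : ∀ t ∈ Icc a b, ∀ y ∈ S, ‖W (t, y)‖ ≤ C₀ * ‖y - y₀‖ := fun t ht y hy => by
    have h1 := hc.norm_image_sub_le_of_norm_hasFDerivWithin_le (hWW' t ht)
      (fun y hy => hC₀ (t, y) ⟨ht, hy⟩) hy₀ hy
    simpa [hW] using h1
  obtain ⟨ε, hε, C, hC, hsmall⟩ := exists_isLogSol_of_small 𝔤 G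
  -- the remainder, which is of second order in `y - y₀`
  set r : ℝ × Y → 𝔤 := fun z => ψ (g z * (k z.1)⁻¹) - ψ 1 - I z with hr
  have key : ∀ y ∈ S, C₀ * ‖y - y₀‖ * (b - a) ≤ ε → ∀ t ∈ Icc a b,
      g (t, y) * (k t)⁻¹ ∈ (chartAt 𝔤 (1 : G)).source ∧
      ‖r (t, y)‖ ≤ C * C₀ ^ 2 * (b - a) ^ 2 * ‖y - y₀‖ ^ 2 := by
    intro y hy hyε
    obtain ⟨δ, hδ1, hδ, hδb⟩ := hsmall a b (fun t => W (t, y)) (C₀ * ‖y - y₀‖) hab (by positivity)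
      hyε (hWc.slice_fst hy) (fun t ht => hWb t ht y hy)
    -- `δ k` and `g(·, y)` solve the same initial value problem
    have hδk : IsLogSol (fun t => δ t * k t) (fun t => K (t, y)) a b := fun t ht =>
      ((hδ t ht).mul (hg y₀ hy₀ t ht)).congr_deriv (by
        ext
        simp [hW, hk, adT_inv_apply])
    have hδg : ∀ t ∈ Icc a b, g (t, y) * (k t)⁻¹ = δ t := fun t ht => by
      have := (hg y hy).eqOn hδk ha (by simp [hg1 y hy, hδ1, hk, hg1 y₀ hy₀]) ht
      simp only at this
      rw [this, mul_inv_cancel_right]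
    refine fun t ht => ⟨by rw [hδg t ht]; exact (hδb t ht).1, ?_⟩
    have hrd : ∀ t ∈ Icc a b, HasDerivWithinAt (fun t => r (t, y))
        ((logChart 𝔤 1 (δ t) - ContinuousLinearMap.id ℝ 𝔤) (W (t, y))) (Icc a b) t := by
      intro t ht
      have h1 := ((hδ t ht).hasFDerivWithinAt_chart (hδb t ht).1).hasDerivWithinAt
      have h2 := ((h1.sub_const (ψ 1)).sub ((hId t ht y hy).slice_fst hy))
      refine HasDerivWithinAt.congr_deriv (h2.congr_of_mem (fun s hs => ?_) ht) ?_
      · simp only [hr, hδg s hs, Pi.sub_apply, hψ]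
      · simp
    have h3 := (convex_Icc a b).norm_image_sub_le_of_norm_hasDerivWithin_le
      (C := C * (C₀ * ‖y - y₀‖ * (b - a)) * (C₀ * ‖y - y₀‖)) hrd
      (fun t ht => (ContinuousLinearMap.le_opNorm _ _).trans
        (mul_le_mul (hδb t ht).2 (hWb t ht y hy) (norm_nonneg _) (by positivity))) ha ht
    have h4 : r (a, y) = 0 := by simp [hr, hI, hk, hg1 y hy, hg1 y₀ hy₀]
    rw [h4, sub_zero] at h3
    have h5 : ‖t - a‖ ≤ b - a := by
      rw [Real.norm_of_nonneg (by linarith [ht.1])]; linarith [ht.2]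
    calc ‖r (t, y)‖ ≤ C * (C₀ * ‖y - y₀‖ * (b - a)) * (C₀ * ‖y - y₀‖) * ‖t - a‖ := h3
      _ ≤ C * (C₀ * ‖y - y₀‖ * (b - a)) * (C₀ * ‖y - y₀‖) * (b - a) := by gcongr
      _ = _ := by ring
  have hev : ∀ᶠ z in nhdsWithin (t₀, y₀) (Icc a b ×ˢ S), z ∈ Icc a b ×ˢ S ∧
      C₀ * ‖z.2 - y₀‖ * (b - a) ≤ ε := by
    refine Filter.Eventually.and self_mem_nhdsWithin (mem_nhdsWithin_of_mem_nhds ?_)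
    have h : Filter.Tendsto (fun z : ℝ × Y => C₀ * ‖z.2 - y₀‖ * (b - a)) (nhds (t₀, y₀))
        (nhds (C₀ * ‖y₀ - y₀‖ * (b - a))) := by
      have : Continuous (fun z : ℝ × Y => C₀ * ‖z.2 - y₀‖ * (b - a)) := by fun_prop
      exact this.tendsto (t₀, y₀)
    simp only [sub_self, norm_zero, mul_zero, zero_mul] at h
    exact h.eventually (Iic_mem_nhds hε)
  -- a function of second order has zero derivative
  have hr0 : HasFDerivWithinAt r (0 : ℝ × Y →L[ℝ] 𝔤) (Icc a b ×ˢ S) (t₀, y₀) := by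
    refine Asymptotics.IsBigO.hasFDerivWithinAt (n := 2) ?_ ⟨ht₀, hy₀⟩ (by norm_num)
    refine Asymptotics.IsBigO.of_bound (C * C₀ ^ 2 * (b - a) ^ 2) ?_
    filter_upwards [hev] with z hz
    refine ((key z.2 hz.1.2 hz.2 z.1 hz.1.1).2).trans ?_
    rw [norm_pow, norm_norm]
    gcongr
    exact norm_snd_le (z - (t₀, y₀))
  have hg0 : g (t₀, y₀) * (k t₀)⁻¹ = 1 := by simp [hk]
  have hW0 : W (t₀, y₀) = 0 := by simp [hW]
  have hz : HasFDerivWithinAt (fun z : ℝ × Y => ψ (g z * (k z.1)⁻¹))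
      ((∫ τ in a..t₀, (adT 𝔤 (k τ)).comp (K' (τ, y₀)) : Y →L[ℝ] 𝔤).comp
          (ContinuousLinearMap.snd ℝ ℝ Y)) (Icc a b ×ˢ S) (t₀, y₀) := by
    have h1 := (hr0.add (hId t₀ ht₀ y₀ hy₀)).add_const (ψ 1)
    refine (h1.congr' (fun z hz => ?_) ⟨ht₀, hy₀⟩).congr_fderiv ?_
    · simp only [hr, Pi.add_apply]; abel
    · ext <;> simp [hW0]
  have hδ : HasLog (fun z : ℝ × Y => ψ.symm (ψ (g z * (k z.1)⁻¹))) (Icc a b ×ˢ S) (t₀, y₀)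
      ((∫ τ in a..t₀, (adT 𝔤 (k τ)).comp (K' (τ, y₀)) : Y →L[ℝ] 𝔤).comp
          (ContinuousLinearMap.snd ℝ ℝ Y)) := by
    refine hasLog_extChartAt_symm 1 ?_ (hz.congr_fderiv ?_)
    · simp only [hg0]; exact mem_extChartAt_target 1
    · simp only [hg0, hψ, extChartAt_to_inv, logChart_one]; rfl
  have hk1 : HasLog (fun z : ℝ × Y => k z.1) (Icc a b ×ˢ S) (t₀, y₀)
      (((1 : ℝ →L[ℝ] ℝ).smulRight (K (t₀, y₀))).comp (ContinuousLinearMap.fst ℝ ℝ Y)) :=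
    HasLog.comp_hasFDerivWithinAt (φ := fun z : ℝ × Y => z.1) (hg y₀ hy₀ t₀ ht₀)
      (hasFDerivWithinAt_fst (p := (t₀, y₀))) (fun z hz => hz.1)
  have hev2 : ∀ᶠ z in nhdsWithin (t₀, y₀) (Icc a b ×ˢ S),
      g z = ψ.symm (ψ (g z * (k z.1)⁻¹)) * k z.1 := by
    filter_upwards [hev] with z hz
    have := (key z.2 hz.1.2 hz.2 z.1 hz.1.1).1
    rw [hψ, (extChartAt 𝓘(ℝ, 𝔤) (1 : G)).left_inv (by simpa using this), inv_mul_cancel_right]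
  have hx : g (t₀, y₀) = ψ.symm (ψ (g (t₀, y₀) * (k t₀)⁻¹)) * k t₀ := by
    rw [hg0, hψ, extChartAt_to_inv, one_mul]
  have h2 := HasTDeriv.congr_of_eventuallyEq (hδ.mul hk1) hev2 hx
  refine h2.congr_deriv ?_
  simp only
  rw [← hx]
  congr 1
  rw [duhamel]
  ext <;> simp [hk]

/-- The initial value problems `g' = g K(·, y)`, `g(a, y) = 1` with smooth right hand side have a
solution which is smooth in time and the parameter.  Smoothness follows by induction: if `g` is of
class `C^n`, then so is its logarithmic derivative, which is given by Duhamel's formula, and hence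
`g` is of class `C^{n+1}`. -/
theorem exists_contMDiffOn_isLogSol {K : ℝ × Y → 𝔤} (hab : a < b) (hS : IsCompact S)
    (hc : Convex ℝ S) (hi : (interior S).Nonempty) (hK : ContDiffOn ℝ ∞ K (Icc a b ×ˢ S)) :
    ∃ g : ℝ × Y → G, (∀ y ∈ S, g (a, y) = 1) ∧
      ContMDiffOn 𝓘(ℝ, ℝ × Y) 𝓘(ℝ, 𝔤) ∞ g (Icc a b ×ˢ S) ∧
      ∀ z ∈ Icc a b ×ˢ S, HasLog g (Icc a b ×ˢ S) z
        (duhamel (fun z => (fderivWithin ℝ K (Icc a b ×ˢ S) z).comp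
          (ContinuousLinearMap.inr ℝ ℝ Y)) K g a z) := by
  have hu := uniqueDiffOn_Icc_prod hab hc hi
  have hex : ∀ y : Y, ∃ g : ℝ → G, y ∈ S → g a = 1 ∧ IsLogSol g (fun t => K (t, y)) a b := by
    intro y
    by_cases hy : y ∈ S
    · obtain ⟨g, h⟩ := exists_isLogSol (G := G) hab.le (hK.continuousOn.slice_fst hy)
      exact ⟨g, fun _ => h⟩
    · exact ⟨fun _ => 1, fun h => absurd h hy⟩
  choose f hf using hex
  set g : ℝ × Y → G := fun z => f z.2 z.1 with hg
  set K' : ℝ × Y → Y →L[ℝ] 𝔤 := fun z => (fderivWithin ℝ K (Icc a b ×ˢ S) z).comp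
    (ContinuousLinearMap.inr ℝ ℝ Y) with hK'
  have hK'c : ContDiffOn ℝ ∞ K' (Icc a b ×ˢ S) :=
    (hK.fderivWithin hu (m := ∞) (by simp)).clm_comp contDiffOn_const
  have hlog : ∀ z ∈ Icc a b ×ˢ S, HasLog g (Icc a b ×ˢ S) z (duhamel K' K g a z) := fun z hz =>
    hasLog_duhamel hS hc hK.continuousOn hK'c.continuousOn
      (fun t ht y hy => HasFDerivWithinAt.slice_snd
        ((hK.differentiableOn (by simp) (t, y) ⟨ht, hy⟩).hasFDerivWithinAt) ht)
      (fun y hy => (hf y hy).1) (fun y hy => (hf y hy).2) hz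
  refine ⟨g, fun y hy => (hf y hy).1, ?_, hlog⟩
  have hn : ∀ n : ℕ, ContMDiffOn 𝓘(ℝ, ℝ × Y) 𝓘(ℝ, 𝔤) n g (Icc a b ×ˢ S) := by
    intro n
    induction n with
    | zero =>
      rw [Nat.cast_zero, contMDiffOn_zero_iff]
      exact fun z hz => HasTDeriv.continuousWithinAt (hlog z hz)
    | succ n ih =>
      refine contMDiffOn_succ_of_hasLog hu hlog ?_ ih
      have hA : ContDiffOn ℝ n (fun z => adT 𝔤 (g z)) (Icc a b ×ˢ S) := by
        rw [← contMDiffOn_iff_contDiffOn]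
        exact ((contMDiff_adT (𝔤 := 𝔤) (G := G)).of_le
          (by exact_mod_cast le_top)).comp_contMDiffOn ih
      have hA' : ContDiffOn ℝ n (fun z => adT 𝔤 (g z)⁻¹) (Icc a b ×ˢ S) := by
        rw [← contMDiffOn_iff_contDiffOn]
        have : LieGroup 𝓘(ℝ, 𝔤) n G := LieGroup.of_le (n := ∞) (by exact_mod_cast le_top)
        exact ((contMDiff_adT (𝔤 := 𝔤) (G := G)).of_le
          (by exact_mod_cast le_top)).comp_contMDiffOn ih.inv
      have hle : ((n : ℕ∞) : WithTop ℕ∞) ≤ ∞ := by exact_mod_cast le_top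
      have h1 := contDiffOn_parametric_primitive_nat hab hS hc hi n
        (hA.clm_comp (hK'c.of_le hle))
      refine ContDiffOn.add ?_ ?_
      · exact contDiffOn_const.smulRight (hK.of_le hle)
      · exact (hA'.clm_comp h1).clm_comp contDiffOn_const
  exact contMDiffOn_infty.2 hn

end LieODEParam

/-! ### Smooth families of alternating forms -/
section FormSmooth

variable {X : Type*} [NormedAddCommGroup X] [NormedSpace ℝ X]
  {W : Type*} [NormedAddCommGroup W] [NormedSpace ℝ W]
  {V : Type*} [NormedAddCommGroup V] [NormedSpace ℝ V]

/-- A form on a finite-dimensional space depends smoothly on a parameter if its values do. -/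
theorem contDiffWithinAt_alternating [FiniteDimensional ℝ X] [FiniteDimensional ℝ V] {n : ℕ}
    {k : WithTop ℕ∞} {f : W → X [⋀^Fin n]→L[ℝ] V}
    {s : Set W} {x : W} (h : ∀ v, ContDiffWithinAt ℝ k (fun w => f w v) s x) :
    ContDiffWithinAt ℝ k f s x := by
  -- evaluation on the tuples of basis vectors is an injective linear map, with left inverse `R`
  let b := Module.finBasis ℝ X
  let L : X [⋀^Fin n]→L[ℝ] V →ₗ[ℝ] ((Fin n → Fin (Module.finrank ℝ X)) → V) :=
    { toFun := fun α i => α (fun j => b (i j))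
      map_add' := fun _ _ => rfl
      map_smul' := fun _ _ => rfl }
  have hL : LinearMap.ker L = ⊥ := by
    rw [LinearMap.ker_eq_bot']
    intro α hα
    apply ContinuousAlternatingMap.toAlternatingMap_injective
    refine Module.Basis.ext_alternating b fun i _ => ?_
    exact congrFun hα i
  obtain ⟨R, hR⟩ := L.exists_leftInverse_of_injective hL
  have h1 : f = fun w => (LinearMap.toContinuousLinearMap R) (L (f w)) := by
    funext w
    exact (LinearMap.congr_fun hR (f w)).symm
  rw [h1]
  refine (LinearMap.toContinuousLinearMap R).contDiff.comp_contDiffWithinAt ?_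
  exact contDiffWithinAt_pi.2 fun i => h _

/-- The value of the pullback `T^* α` on fixed vectors depends smoothly on the form `α` and the
linear map `T`. -/
theorem contDiff_compContinuousLinearMap_apply {Y : Type*} [NormedAddCommGroup Y] [NormedSpace ℝ Y]
    {n : ℕ} {k : WithTop ℕ∞} (v : Fin n → X) :
    ContDiff ℝ k (fun p : (Y [⋀^Fin n]→L[ℝ] V) × (X →L[ℝ] Y) =>
      p.1.compContinuousLinearMap p.2 v) := by
  have h0 : ContDiff ℝ k (fun p : Y [⋀^Fin n]→L[ℝ] V => p.toContinuousMultilinearMap) :=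
    (ContinuousAlternatingMap.toContinuousMultilinearMapLI (𝕜 := ℝ) (E := Y) (F := V)
      (ι := Fin n)).contDiff
  have h1 : ContDiff ℝ k (fun p : (Y [⋀^Fin n]→L[ℝ] V) × (X →L[ℝ] Y) =>
      (fun _ : Fin n => p.2, p.1.toContinuousMultilinearMap)) :=
    (contDiff_pi.2 fun _ => contDiff_snd).prodMk (h0.comp contDiff_fst)
  have h2 : ContDiff ℝ k (fun p : (∀ _ : Fin n, X →L[ℝ] Y) ×
      (ContinuousMultilinearMap ℝ (fun _ : Fin n => Y) V) => p.2.compContinuousLinearMap p.1) :=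
    contDiff_iff_contDiffAt.2 fun q =>
      (ContinuousMultilinearMap.cpolynomialAt_uncurry_compContinuousLinearMap).contDiffAt
  exact (ContinuousMultilinearMap.apply ℝ (fun _ : Fin n => X) V v).contDiff.comp (h2.comp h1)

end FormSmooth

/-! ### Pullback of forms to subsets of normed spaces -/
section Pullback

variable {X : Type*} [NormedAddCommGroup X] [NormedSpace ℝ X]
  {EP : Type*} [NormedAddCommGroup EP] [NormedSpace ℝ EP]
  {P : Type*} [TopologicalSpace P] [ChartedSpace EP P]
  {V : Type*} [NormedAddCommGroup V] [NormedSpace ℝ V] {n : ℕ}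

/-- The pullback `F^* α` of a form on the manifold `P` by a map `F : X → P` defined on the subset
`D` of a normed space. -/
def pull (α : PreForm EP P n V) (F : X → P) (D : Set X) (z : X) : X [⋀^Fin n]→L[ℝ] V :=
  ContinuousAlternatingMap.compContinuousLinearMap (α (F z) : EP [⋀^Fin n]→L[ℝ] V)
    (tmapWithin EP F D z)

variable [IsManifold 𝓘(ℝ, EP) ∞ P]

theorem tmap_chart_symm_comp {p q : P} (hq : q ∈ (chartAt EP p).source) :
    (tmap EP EP (chartAt EP p).symm (chartAt EP p q)).comp (tmap EP EP (chartAt EP p) q) =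
      ContinuousLinearMap.id ℝ EP := by
  have : IsManifold 𝓘(ℝ, EP) 1 P := IsManifold.of_le (n := ∞) (by simp)
  exact (mdifferentiable_chart (I := 𝓘(ℝ, EP)) p).symm_comp_deriv hq

theorem ContMDiffWithinAt.chart_comp {F : X → P} {D : Set X} {z : X} {k : WithTop ℕ∞} {p : P}
    (hk : k ≤ ∞)
    (hF : ContMDiffWithinAt 𝓘(ℝ, X) 𝓘(ℝ, EP) k F D z) (hz : F z ∈ (chartAt EP p).source) :
    ContDiffWithinAt ℝ k (fun w => chartAt EP p (F w)) D z := by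
  have : IsManifold 𝓘(ℝ, EP) k P := IsManifold.of_le hk
  rw [← contMDiffWithinAt_iff_contDiffWithinAt]
  exact (contMDiffAt_of_mem_maximalAtlas (I := 𝓘(ℝ, EP))
    (IsManifold.chart_mem_maximalAtlas p) hz).comp_contMDiffWithinAt z hF

theorem HasTDeriv.fderivWithin_chart {F : X → P} {D : Set X} {z : X} {p : P} {T : X →L[ℝ] EP}
    (hF : HasTDeriv F D z T) (hz : F z ∈ (chartAt EP p).source) :
    HasFDerivWithinAt (fun w => chartAt EP p (F w)) ((tmap EP EP (chartAt EP p) (F z)).comp T)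
      D z := by
  have : IsManifold 𝓘(ℝ, EP) 1 P := IsManifold.of_le (n := ∞) (by simp)
  have h1 := HasTDeriv.comp_tmap (N₁ := EP) hF (mdifferentiableAt_extChartAt (I := 𝓘(ℝ, EP)) hz)
  rw [hasTDeriv_iff_hasFDerivWithinAt] at h1
  exact h1

/-- The pullback of a form, computed in a chart of the manifold. -/
theorem pull_eq_chart (α : PreForm EP P n V) {F : X → P} {D : Set X} {z : X} {p : P}
    (hF : MDifferentiableWithinAt 𝓘(ℝ, X) 𝓘(ℝ, EP) F D z) (hD : UniqueDiffWithinAt ℝ D z)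
    (hz : F z ∈ (chartAt EP p).source) :
    pull α F D z = (chartRep α (chartAt EP p) (chartAt EP p (F z))).compContinuousLinearMap
      (fderivWithin ℝ (fun w => chartAt EP p (F w)) D z) := by
  have hT : HasTDeriv F D z (tmapWithin EP F D z) := hF.hasMFDerivWithinAt
  rw [(hT.fderivWithin_chart hz).fderivWithin hD]
  -- the statement is generalized to a variable point `q`, since `φ⁻¹(φ(F z)) = F z` does not hold
  -- by definition
  have key : ∀ q : P, q = F z → ContinuousAlternatingMap.compContinuousLinearMap
      (ContinuousAlternatingMap.compContinuousLinearMap (α q : EP [⋀^Fin n]→L[ℝ] V)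
        (tmap EP EP (chartAt EP p).symm (chartAt EP p (F z))))
      ((tmap EP EP (chartAt EP p) (F z)).comp (tmapWithin EP F D z)) = pull α F D z := by
    rintro q rfl
    ext v
    have h := tmap_chart_symm_comp hz
    exact congrArg (α (F z) : EP [⋀^Fin n]→L[ℝ] V)
      (funext fun i => DFunLike.congr_fun h (tmapWithin EP F D z (v i)))
  exact (key _ ((chartAt EP p).left_inv hz)).symm

theorem contDiffOn_pull_apply {α : PreForm EP P n V} (hα : IsSmoothForm α) {F : X → P} {D : Set X}
    (hF : ContMDiffOn 𝓘(ℝ, X) 𝓘(ℝ, EP) ∞ F D) (hD : UniqueDiffOn ℝ D) (v : Fin n → X) :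
    ContDiffOn ℝ ∞ (fun z => pull α F D z v) D := by
  intro z hz
  set φ := chartAt EP (F z) with hφ
  have hs : F z ∈ φ.source := mem_chart_source EP (F z)
  have h1 : ContDiffWithinAt ℝ ∞ (fun w => φ (F w)) D z := (hF z hz).chart_comp le_rfl hs
  have h2 : ContDiffWithinAt ℝ ∞ (fun w => chartRep α φ (φ (F w))) D z :=
    ContDiffAt.comp_contDiffWithinAt (f := fun w => φ (F w)) z
      ((hα φ (chart_mem_atlas EP (F z))).contDiffAt
        (φ.open_target.mem_nhds (φ.map_source hs))) h1
  have h3 := h1.fderivWithin_right hD (m := ∞) (by simp) hz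
  refine ((contDiff_compContinuousLinearMap_apply (k := ∞) v).comp_contDiffWithinAt
    (h2.prodMk h3)).congr_of_eventuallyEq_of_mem ?_ hz
  filter_upwards [self_mem_nhdsWithin, (hF z hz).continuousWithinAt.preimage_mem_nhdsWithin
    (φ.open_source.mem_nhds hs)] with w hw hws
  rw [pull_eq_chart (p := F z) α ((hF w hw).mdifferentiableWithinAt (by simp)) (hD w hw) hws]
  rfl

theorem contDiffOn_pull [FiniteDimensional ℝ X] [FiniteDimensional ℝ V] {α : PreForm EP P n V}
    (hα : IsSmoothForm α) {F : X → P} {D : Set X}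
    (hF : ContMDiffOn 𝓘(ℝ, X) 𝓘(ℝ, EP) ∞ F D) (hD : UniqueDiffOn ℝ D) :
    ContDiffOn ℝ ∞ (pull α F D) D := fun z hz =>
  contDiffWithinAt_alternating fun v => contDiffOn_pull_apply hα hF hD v z hz

/-- The exterior derivative commutes with pullback to a subset of a normed space. -/
theorem extDerivWithin_pull {α : PreForm EP P n V}
    (hα : IsSmoothForm α) {F : X → P} {D : Set X}
    (hF : ContMDiffOn 𝓘(ℝ, X) 𝓘(ℝ, EP) ∞ F D) (hD : UniqueDiffOn ℝ D) {z : X} (hz : z ∈ D)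
    (hz' : z ∈ closure (interior D)) :
    extDerivWithin (pull α F D) D z = pull (extD α) F D z := by
  set φ := chartAt EP (F z) with hφ
  have hs : F z ∈ φ.source := mem_chart_source EP (F z)
  have h1 : ContDiffWithinAt ℝ ∞ (fun w => φ (F w)) D z := (hF z hz).chart_comp le_rfl hs
  have h2 : ContDiffAt ℝ ∞ (chartRep α φ) (φ (F z)) :=
    (hα φ (chart_mem_atlas EP (F z))).contDiffAt (φ.open_target.mem_nhds (φ.map_source hs))
  have h3 : pull α F D =ᶠ[nhdsWithin z D] fun w => (chartRep α φ (φ (F w))).compContinuousLinearMap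
      (fderivWithin ℝ (fun w => φ (F w)) D w) := by
    filter_upwards [self_mem_nhdsWithin, (hF z hz).continuousWithinAt.preimage_mem_nhdsWithin
      (φ.open_source.mem_nhds hs)] with w hw hws
    rw [pull_eq_chart (p := F z) α ((hF w hw).mdifferentiableWithinAt (by simp)) (hD w hw) hws]
  rw [h3.extDerivWithin_eq_of_mem hz, extDerivWithin_pullback (f := fun w => φ (F w))
    (t := univ) (r := ∞)
    (h2.differentiableAt (by simp)).differentiableWithinAt h1
    (by
      rw [minSmoothness_of_isRCLikeNormedField]
      exact WithTop.coe_le_coe.2 (le_top : (2 : ℕ∞) ≤ ⊤)) hD hz' hz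
    (fun _ _ => mem_univ _), extDerivWithin_univ]
  have hT : HasTDeriv F D z (tmapWithin EP F D z) := (hF z hz).hasTDeriv (by simp)
  rw [(hT.fderivWithin_chart hs).fderivWithin (hD z hz)]
  rfl

end Pullback

/-! ### Principal bundles -/
section PrincipalBundle

variable {X : Type*} [NormedAddCommGroup X] [NormedSpace ℝ X]
  {𝔤 : Type*} [NormedAddCommGroup 𝔤] [NormedSpace ℝ 𝔤]
  {G : Type*} [TopologicalSpace G] [ChartedSpace 𝔤 G] [Group G]
  {EM : Type*} [NormedAddCommGroup EM] [NormedSpace ℝ EM]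
  {M : Type*} [TopologicalSpace M] [ChartedSpace EM M]
  {EP : Type*} [NormedAddCommGroup EP] [NormedSpace ℝ EP]
  {P : Type*} [TopologicalSpace P] [ChartedSpace EP P]
  [MulAction Gᵐᵒᵖ P]

variable (𝔤 G EP) in
/-- The linear map `A ↦ A^#(p)`. -/
def fundT (p : P) : 𝔤 →L[ℝ] EP := tmap 𝔤 EP (fun g : G => p <• g) 1

variable (EP) in
/-- The tangent map of the right translation by `g`. -/
def rightT (g : G) (p : P) : EP →L[ℝ] EP := tmap EP EP (fun q : P => q <• g) p

/-- A `1`-form as a family of linear maps. -/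
def oneForm (η : PreForm EP P 1 𝔤) (p : P) : EP →L[ℝ] 𝔤 :=
  (ContinuousAlternatingMap.ofSubsingletonLIE (𝕜 := ℝ) (E := EP) (F := 𝔤)
    (0 : Fin 1)).symm (η p)

theorem oneForm_apply (η : PreForm EP P 1 𝔤) (p : P) (v : EP) :
    oneForm η p v = (η p : EP [⋀^Fin 1]→L[ℝ] 𝔤) ![v] := by
  have h := LinearIsometryEquiv.apply_symm_apply
    (ContinuousAlternatingMap.ofSubsingletonLIE (𝕜 := ℝ) (E := EP) (F := 𝔤) (0 : Fin 1))
    (η p : EP [⋀^Fin 1]→L[ℝ] 𝔤)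
  exact DFunLike.congr_fun h ![v]

variable [LieGroup 𝓘(ℝ, 𝔤) ∞ G] [IsManifold 𝓘(ℝ, EP) ∞ P] [IsManifold 𝓘(ℝ, EM) ∞ M]
  {π : P → M}

section Action

theorem IsPrincipalBundle.mdiff_act
    (hπ : IsPrincipalBundle (𝔤 := 𝔤) (EM := EM) (EP := EP) G π) (z : P × G) :
    MDifferentiableAt (𝓘(ℝ, EP).prod 𝓘(ℝ, 𝔤)) 𝓘(ℝ, EP) (fun z : P × G => z.1 <• z.2) z :=
  (hπ.smooth_act z).mdifferentiableAt (by simp)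

theorem IsPrincipalBundle.mdiff_proj
    (hπ : IsPrincipalBundle (𝔤 := 𝔤) (EM := EM) (EP := EP) G π) (p : P) :
    MDifferentiableAt 𝓘(ℝ, EP) 𝓘(ℝ, EM) π p :=
  (hπ.smooth_proj p).mdifferentiableAt (by simp)

theorem IsPrincipalBundle.mdiff_orbit
    (hπ : IsPrincipalBundle (𝔤 := 𝔤) (EM := EM) (EP := EP) G π) (p : P) (g : G) :
    MDifferentiableAt 𝓘(ℝ, 𝔤) 𝓘(ℝ, EP) (fun g : G => p <• g) g := by
  have h1 : MDifferentiableAt 𝓘(ℝ, 𝔤) (𝓘(ℝ, EP).prod 𝓘(ℝ, 𝔤)) (fun g : G => (p, g)) g :=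
    mdifferentiableAt_const.prodMk mdifferentiableAt_id
  exact MDifferentiableAt.comp (g := fun z : P × G => z.1 <• z.2) g (hπ.mdiff_act (p, g)) h1

theorem IsPrincipalBundle.mdiff_right
    (hπ : IsPrincipalBundle (𝔤 := 𝔤) (EM := EM) (EP := EP) G π) (p : P) (g : G) :
    MDifferentiableAt 𝓘(ℝ, EP) 𝓘(ℝ, EP) (fun q : P => q <• g) p := by
  have h1 : MDifferentiableAt 𝓘(ℝ, EP) (𝓘(ℝ, EP).prod 𝓘(ℝ, 𝔤)) (fun q : P => (q, g)) p :=
    mdifferentiableAt_id.prodMk mdifferentiableAt_const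
  exact MDifferentiableAt.comp (g := fun z : P × G => z.1 <• z.2) p (hπ.mdiff_act (p, g)) h1

theorem smul_op_mul (p : P) (g h : G) : p <• (g * h) = (p <• g) <• h := by
  rw [MulOpposite.op_mul, mul_smul]

theorem smul_op_one (p : P) : p <• (1 : G) = p := by
  rw [MulOpposite.op_one, one_smul]

theorem IsPrincipalBundle.tmap_orbit
    (hπ : IsPrincipalBundle (𝔤 := 𝔤) (EM := EM) (EP := EP) G π) (p : P) (g : G) :
    (tmap 𝔤 EP (fun g : G => p <• g) g).comp (leftT 𝔤 g) = fundT 𝔤 G EP (p <• g) := by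
  have h1 := tmap_comp (F := 𝔤) (F₁ := 𝔤) (F₂ := EP) (f := fun x : G => g * x)
    (g := fun x : G => p <• x) (p := (1 : G)) (hπ.mdiff_orbit _ _) (mdiff_mul_left 𝔤 g 1)
  simp only [mul_one] at h1
  rw [leftT, ← h1, fundT]
  congr 1
  funext x
  exact smul_op_mul p g x

/-- The product rule for the action of a variable group element. -/
theorem HasTDeriv.act (hπ : IsPrincipalBundle (𝔤 := 𝔤) (EM := EM) (EP := EP) G π)
    {f : X → P} {h : X → G} {s : Set X} {x : X} {f' : X →L[ℝ] EP} {ℓ : X →L[ℝ] 𝔤}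
    (hf : HasTDeriv f s x f') (hh : HasLog h s x ℓ) :
    HasTDeriv (fun y => f y <• h y) s x
      ((rightT EP (h x) (f x)).comp f' + (fundT 𝔤 G EP (f x <• h x)).comp ℓ) := by
  refine (HasTDeriv.map₂ (N₁ := G) hf hh (hπ.mdiff_act (f x, h x))).congr_deriv ?_
  simp only
  rw [← ContinuousLinearMap.comp_assoc, hπ.tmap_orbit]
  rfl

theorem IsPrincipalBundle.tmap_proj_fundT
    (hπ : IsPrincipalBundle (𝔤 := 𝔤) (EM := EM) (EP := EP) G π) (p : P) :
    (tmap EP EM π p).comp (fundT 𝔤 G EP p) = 0 := by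
  have hp : p <• (1 : G) = p := smul_op_one p
  have h0 := hπ.mdiff_proj (p <• (1 : G))
  have h1 := tmap_comp (F := 𝔤) (F₁ := EP) (F₂ := EM) (f := fun x : G => p <• x)
    (g := π) (p := (1 : G)) h0 (hπ.mdiff_orbit p 1)
  simp only [hπ.proj_act, tmap_const, hp] at h1
  exact h1.symm

theorem IsPrincipalBundle.tmap_proj_rightT
    (hπ : IsPrincipalBundle (𝔤 := 𝔤) (EM := EM) (EP := EP) G π) (p : P) (g : G) :
    (tmap EP EM π (p <• g)).comp (rightT EP g p) = tmap EP EM π p := by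
  have h1 := tmap_comp (F := EP) (F₁ := EP) (F₂ := EM) (f := fun q : P => q <• g)
    (g := π) (p := p) (hπ.mdiff_proj (p <• g)) (hπ.mdiff_right p g)
  simp only [hπ.proj_act] at h1
  exact h1.symm

theorem IsPrincipalBundle.contMDiffOn_act
    (hπ : IsPrincipalBundle (𝔤 := 𝔤) (EM := EM) (EP := EP) G π)
    {f : X → P} {h : X → G} {s : Set X} {k : WithTop ℕ∞} (hk : k ≤ ∞)
    (hf : ContMDiffOn 𝓘(ℝ, X) 𝓘(ℝ, EP) k f s) (hh : ContMDiffOn 𝓘(ℝ, X) 𝓘(ℝ, 𝔤) k h s) :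
    ContMDiffOn 𝓘(ℝ, X) 𝓘(ℝ, EP) k (fun y => f y <• h y) s :=
  ContMDiff.comp_contMDiffOn (g := fun z : P × G => z.1 <• z.2)
    (hπ.smooth_act.of_le hk) (hf.prodMk hh)

end Action

section LocalSection

/-- A local trivialization, in terms of a local section `σ` and the coordinate `γ` in the fibre:
`p = σ(π p) γ(p)`. -/
theorem IsPrincipalBundle.exists_localSection
    (hπ : IsPrincipalBundle (𝔤 := 𝔤) (EM := EM) (EP := EP) G π) (x : M) :
    ∃ U : Set M, x ∈ U ∧ IsOpen U ∧ ∃ (σ : M → P) (γ : P → G),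
      ContMDiffOn 𝓘(ℝ, EM) 𝓘(ℝ, EP) ∞ σ U ∧ ContMDiffOn 𝓘(ℝ, EP) 𝓘(ℝ, 𝔤) ∞ γ (π ⁻¹' U) ∧
      (∀ y ∈ U, π (σ y) = y) ∧ (∀ y ∈ U, γ (σ y) = 1) ∧
      (∀ p ∈ π ⁻¹' U, ∀ g : G, γ (p <• g) = γ p * g) ∧ ∀ p ∈ π ⁻¹' U, p = σ (π p) <• γ p := by
  obtain ⟨U, hxU, hU, Φ, hs, ht, hΦ⟩ := hπ.locally_trivial x
  have hmem : ∀ y ∈ U, ∀ g : G, (y, g) ∈ Φ.toPartialEquiv.target := fun y hy g => by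
    have : (y, g) ∈ Φ.target := by rw [ht]; exact ⟨hy, mem_univ _⟩
    exact this
  have hσs : ∀ y ∈ U, Φ.symm (y, (1 : G)) ∈ π ⁻¹' U := fun y hy => by
    rw [← hs]; exact Φ.toPartialEquiv.map_target (hmem y hy 1)
  have hΦσ : ∀ y ∈ U, Φ (Φ.symm (y, (1 : G))) = (y, 1) := fun y hy =>
    Φ.toPartialEquiv.right_inv (hmem y hy 1)
  have hπσ : ∀ y ∈ U, π (Φ.symm (y, (1 : G))) = y := fun y hy => by
    rw [← (hΦ _ (hσs y hy)).1, hΦσ y hy]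
  refine ⟨U, hxU, hU, fun y => Φ.symm (y, (1 : G)), fun p => (Φ p).2, ?_, ?_, hπσ, ?_, ?_, ?_⟩
  · refine Φ.contMDiffOn_invFun.comp (contMDiffOn_id.prodMk contMDiffOn_const) ?_
    exact fun y hy => hmem y hy 1
  · rw [← hs]
    exact contMDiff_snd.comp_contMDiffOn Φ.contMDiffOn_toFun
  · intro y hy
    simp only [hΦσ y hy]
  · intro p hp g
    simp only [(hΦ p hp).2 g]
  · intro p hp
    have h1 := hΦ _ (hσs (π p) hp)
    have hp' : p ∈ Φ.toPartialEquiv.source := by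
      have : p ∈ Φ.source := by rw [hs]; exact hp
      exact this
    have hq : (Φ.symm (π p, (1 : G)) <• (Φ p).2) ∈ Φ.toPartialEquiv.source := by
      have : (Φ.symm (π p, (1 : G)) <• (Φ p).2) ∈ Φ.source := by
        rw [hs, mem_preimage, hπ.proj_act]; exact hσs _ hp
      exact this
    refine Φ.toPartialEquiv.injOn hp' hq ?_
    have h2 := h1.2 (Φ p).2
    rw [hΦσ _ hp] at h2
    simp only [one_mul] at h2
    refine Eq.trans ?_ h2.symm
    exact Prod.ext (hΦ p hp).1 rfl

/-- The fibres of a principal bundle are orbits. -/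
theorem IsPrincipalBundle.exists_act_eq
    (hπ : IsPrincipalBundle (𝔤 := 𝔤) (EM := EM) (EP := EP) G π) {p q : P} (h : π p = π q) :
    ∃ g : G, q = p <• g := by
  obtain ⟨U, hxU, -, σ, γ, -, -, -, -, -, hp⟩ := hπ.exists_localSection (π p)
  refine ⟨(γ p)⁻¹ * γ q, ?_⟩
  have h1 := hp p hxU
  have h2 := hp q (by rwa [mem_preimage, ← h])
  calc q = σ (π q) <• γ q := h2
    _ = (σ (π p) <• γ p) <• ((γ p)⁻¹ * γ q) := by
      rw [← smul_op_mul, mul_inv_cancel_left, h]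
    _ = _ := by rw [← h1]

theorem IsPrincipalBundle.act_injective
    (hπ : IsPrincipalBundle (𝔤 := 𝔤) (EM := EM) (EP := EP) G π) (p : P) {g h : G}
    (e : p <• g = p <• h) : g = h := by
  obtain ⟨U, hxU, -, σ, γ, -, -, -, -, hγ, -⟩ := hπ.exists_localSection (π p)
  have h1 := congrArg γ e
  rw [hγ p hxU, hγ p hxU] at h1
  exact mul_left_cancel h1

/-- The vectors in the kernel of the projection are vertical. -/
theorem IsPrincipalBundle.exists_eq_fundT
    (hπ : IsPrincipalBundle (𝔤 := 𝔤) (EM := EM) (EP := EP) G π) {p : P} {v : EP}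
    (hv : tmap EP EM π p v = 0) : ∃ A : 𝔤, v = fundT 𝔤 G EP p A := by
  obtain ⟨U, hxU, hU, σ, γ, hσ, hγ, -, -, -, hp⟩ := hπ.exists_localSection (π p)
  -- the derivative of `p = σ(π p) γ(p)` in the direction of `v`, with `p` given by the chart at
  -- `p`; the summand of `σ ∘ π` vanishes since `v` is in the kernel of the projection
  set c : EP → P := fun y => (extChartAt 𝓘(ℝ, EP) p).symm y with hc
  set y₀ := extChartAt 𝓘(ℝ, EP) p p with hy₀
  have hcy : c y₀ = p := extChartAt_to_inv p
  have h1 : HasTDeriv c univ y₀ (ContinuousLinearMap.id ℝ EP) := hasTDeriv_extChartAt_symm p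
  have hUp : π ⁻¹' U ∈ nhds (c y₀) := by
    rw [hcy]; exact (hU.preimage hπ.smooth_proj.continuous).mem_nhds hxU
  have h2 := h1.comp_tmap (hπ.mdiff_proj (c y₀))
  have h3 := h2.comp_tmap (N := M) (g := σ) (((hσ _ (by rwa [hcy])).contMDiffAt
    (hU.mem_nhds (by rwa [hcy]))).mdifferentiableAt (by simp))
  have h4 := h1.comp_tmap (g := γ) ((hγ.contMDiffAt hUp).mdifferentiableAt (by simp))
  have h5 := h3.act hπ h4.hasLog
  have h6 : HasTDeriv c univ y₀ _ := h5.congr_of_eventuallyEq (by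
    filter_upwards [h1.continuousWithinAt.preimage_mem_nhdsWithin hUp] with y hy
    exact hp (c y) hy) (hp (c y₀) (by rwa [hcy]))
  have h7 := DFunLike.congr_fun (h1.unique h6 uniqueDiffWithinAt_univ) v
  rw [← hp (c y₀) (by rwa [hcy]), hcy] at h7
  simp only [ContinuousLinearMap.comp_apply, add_apply, ContinuousLinearMap.id_apply, hv,
    map_zero, zero_add] at h7
  exact ⟨_, h7⟩

end LocalSection

end PrincipalBundle

/-! ### Horizontal lifts and parallel transport -/
section Connection

variable {X : Type*} [NormedAddCommGroup X] [NormedSpace ℝ X]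
  {𝔤 : Type*} [NormedAddCommGroup 𝔤] [NormedSpace ℝ 𝔤]
  {G : Type*} [TopologicalSpace G] [ChartedSpace 𝔤 G] [Group G]
  {EM : Type*} [NormedAddCommGroup EM] [NormedSpace ℝ EM]
  {M : Type*} [TopologicalSpace M] [ChartedSpace EM M]
  {EP : Type*} [NormedAddCommGroup EP] [NormedSpace ℝ EP]
  {P : Type*} [TopologicalSpace P] [ChartedSpace EP P]
  [MulAction Gᵐᵒᵖ P]
  [LieGroup 𝓘(ℝ, 𝔤) ∞ G] [IsManifold 𝓘(ℝ, EP) ∞ P] [IsManifold 𝓘(ℝ, EM) ∞ M]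
  {π : P → M} {η : PreForm EP P 1 𝔤}

theorem IsConnectionForm.oneForm_fundT (hη : IsConnectionForm (G := G) η) (p : P) (A : 𝔤) :
    oneForm η p (fundT 𝔤 G EP p A) = A := by
  rw [oneForm_apply]; exact hη.vertical A p

theorem IsConnectionForm.oneForm_rightT (hη : IsConnectionForm (G := G) η) (p : P) (g : G)
    (v : EP) : oneForm η (p <• g) (rightT EP g p v) = adT 𝔤 g⁻¹ (oneForm η p v) := by
  rw [oneForm_apply, oneForm_apply]; exact hη.equivariant g p v

/-- A vector which is both vertical and horizontal is zero. -/
theorem IsConnectionForm.eq_zero (hη : IsConnectionForm (G := G) η)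
    (hπ : IsPrincipalBundle (𝔤 := 𝔤) (EM := EM) (EP := EP) G π) {p : P} {v : EP}
    (h1 : tmap EP EM π p v = 0) (h2 : oneForm η p v = 0) : v = 0 := by
  obtain ⟨A, rfl⟩ := hπ.exists_eq_fundT h1
  rw [hη.oneForm_fundT] at h2
  rw [h2, map_zero]

/-- The horizontal lift as a map between the model spaces. -/
def hLift (π : P → M) (η : PreForm EP P 1 𝔤) (p : P) (X : EM) : EP := horLift π η p X

variable (EM) in
/-- The velocity of a curve as an element of the model space. -/
def vel (c : ℝ → M) (t : ℝ) : EM := velocity EM c t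

/-- The properties that determine the horizontal lift hold as soon as there is a lift. -/
theorem hLift_spec {p : P} {X : EM} {v : EP} (h1 : tmap EP EM π p v = X)
    (h2 : oneForm η p v = 0) :
    tmap EP EM π p (hLift π η p X) = X ∧ oneForm η p (hLift π η p X) = 0 := by
  have hex : ∃ v : TangentSpace 𝓘(ℝ, EP) p,
      mfderiv 𝓘(ℝ, EP) 𝓘(ℝ, EM) π p v = X ∧ η p ![v] = 0 :=
    ⟨v, h1, by rw [oneForm_apply] at h2; exact h2⟩
  obtain ⟨h3, h4⟩ := Classical.epsilon_spec hex
  exact ⟨h3, by rw [oneForm_apply]; exact h4⟩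

theorem IsConnectionForm.hLift_eq (hη : IsConnectionForm (G := G) η)
    (hπ : IsPrincipalBundle (𝔤 := 𝔤) (EM := EM) (EP := EP) G π) {p : P} {X : EM} {v : EP}
    (h1 : tmap EP EM π p v = X) (h2 : oneForm η p v = 0) : hLift π η p X = v := by
  obtain ⟨h3, h4⟩ := hLift_spec h1 h2
  refine sub_eq_zero.1 (hη.eq_zero (p := p) hπ ?_ ?_)
  · rw [map_sub, h3, h1, sub_self]
  · rw [map_sub, h4, h2, sub_self]

theorem IsConnectionForm.hLift_tmap (hη : IsConnectionForm (G := G) η)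
    (hπ : IsPrincipalBundle (𝔤 := 𝔤) (EM := EM) (EP := EP) G π) (p : P) (v : EP) :
    hLift π η p (tmap EP EM π p v) = v - fundT 𝔤 G EP p (oneForm η p v) := by
  refine hη.hLift_eq hπ ?_ ?_
  · have := DFunLike.congr_fun (hπ.tmap_proj_fundT p) (oneForm η p v)
    simp only [ContinuousLinearMap.comp_apply, zero_apply] at this
    rw [map_sub, this, sub_zero]
  · rw [map_sub, hη.oneForm_fundT, sub_self]

/-- The curve `h` in `P` is differentiable on `s` with horizontal velocities. -/
def IsHorizontal (η : PreForm EP P 1 𝔤) (h : ℝ → P) (s : Set ℝ) : Prop :=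
  ∀ t ∈ s, ∃ v : EP, HasTDeriv h s t ((1 : ℝ →L[ℝ] ℝ).smulRight v) ∧ oneForm η (h t) v = 0

theorem IsHorizontal.congr {h k : ℝ → P} {s : Set ℝ} (hh : IsHorizontal η h s) (e : EqOn k h s) :
    IsHorizontal η k s := fun t ht => by
  obtain ⟨v, hv, hv'⟩ := hh t ht
  exact ⟨v, hv.congr e ht, by rwa [e ht]⟩

theorem IsHorizontal.mono {h : ℝ → P} {s t : Set ℝ} (hh : IsHorizontal η h s) (hst : t ⊆ s) :
    IsHorizontal η h t := fun x hx => by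
  obtain ⟨v, hv, hv'⟩ := hh x (hst hx)
  exact ⟨v, hv.mono hst, hv'⟩

theorem IsHorizontal.act (hη : IsConnectionForm (G := G) η)
    (hπ : IsPrincipalBundle (𝔤 := 𝔤) (EM := EM) (EP := EP) G π)
    {h : ℝ → P} {s : Set ℝ} (hh : IsHorizontal η h s) (g : G) :
    IsHorizontal η (fun t => h t <• g) s := fun t ht => by
  obtain ⟨v, hv, hv'⟩ := hh t ht
  refine ⟨rightT EP g (h t) v, (hv.act hπ (hasLog_const (𝔤 := 𝔤) g s t)).congr_deriv ?_, ?_⟩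
  · ext; simp
  · rw [hη.oneForm_rightT, hv', map_zero]

/-- Horizontal curves over the same curve which agree at one point are equal. -/
theorem IsHorizontal.eqOn (hη : IsConnectionForm (G := G) η)
    (hπ : IsPrincipalBundle (𝔤 := 𝔤) (EM := EM) (EP := EP) G π)
    {h k : ℝ → P} {s : Set ℝ} (hs : s.OrdConnected) (hsu : UniqueDiffOn ℝ s)
    (hh : IsHorizontal η h s) (hk : IsHorizontal η k s) (hp : ∀ t ∈ s, π (h t) = π (k t))
    {a : ℝ} (ha : a ∈ s) (e : h a = k a) : EqOn h k s := by
  have : IsManifold 𝓘(ℝ, 𝔤) 1 G := IsManifold.of_le (n := ∞) (by simp)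
  have hex : ∀ t, ∃ g : G, t ∈ s → k t = h t <• g := fun t => by
    by_cases ht : t ∈ s
    · obtain ⟨g, hg⟩ := hπ.exists_act_eq (hp t ht)
      exact ⟨g, fun _ => hg⟩
    · exact ⟨1, fun h => absurd h ht⟩
  -- `k = h g` for a map `g` to the group; it is differentiable, by means of a local section, and
  -- its logarithmic derivative is the value of the connection form on the velocity of `k`, i.e.
  -- zero
  choose g hg using hex
  have hg0 : ∀ t ∈ s, HasTDeriv g s t (0 : ℝ →L[ℝ] 𝔤) := by
    intro t ht
    obtain ⟨v, hv, hv'⟩ := hh t ht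
    obtain ⟨w, hw, hw'⟩ := hk t ht
    obtain ⟨U, hxU, hU, σ, γ, -, hγ, -, -, hγm, -⟩ := hπ.exists_localSection (π (h t))
    have hUo : IsOpen (π ⁻¹' U) := hU.preimage hπ.smooth_proj.continuous
    have h1 := hv.comp_tmap (g := γ)
      ((hγ.contMDiffAt (hUo.mem_nhds hxU)).mdifferentiableAt (by simp))
    have hxU' : k t ∈ π ⁻¹' U := by rw [mem_preimage, ← hp t ht]; exact hxU
    have h2 := hw.comp_tmap (g := γ)
      ((hγ.contMDiffAt (hUo.mem_nhds hxU')).mdifferentiableAt (by simp))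
    have h3 := h1.hasLog.inv.mul h2.hasLog
    have hgγ : ∀ t' ∈ s, h t' ∈ π ⁻¹' U → g t' = (γ (h t'))⁻¹ * γ (k t') := fun t' ht' htU => by
      rw [hg t' ht', hγm _ htU, inv_mul_cancel_left]
    have h4 : HasTDeriv g s t _ := HasTDeriv.congr_of_eventuallyEq h3 (by
      filter_upwards [self_mem_nhdsWithin,
        hv.continuousWithinAt.preimage_mem_nhdsWithin (hUo.mem_nhds hxU)] with t' ht' htU
      exact hgγ t' ht' htU) (hgγ t ht hxU)
    obtain ⟨ℓ, h5⟩ : ∃ ℓ, HasLog g s t ℓ := ⟨_, h4.hasLog⟩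
    have h6 := (hv.act hπ h5).congr (fun t' ht' => hg t' ht') ht
    have h7 := DFunLike.congr_fun (h6.unique hw (hsu t ht)) (1 : ℝ)
    have h8 := congrArg (oneForm η (k t)) h7
    simp only [add_apply, ContinuousLinearMap.comp_apply, ContinuousLinearMap.smulRight_apply,
      one_apply_eq_self, one_smul, hw', map_add] at h8
    rw [hg t ht, hη.oneForm_rightT, hv', map_zero, zero_add, hη.oneForm_fundT] at h8
    refine HasTDeriv.congr_deriv h5 ?_
    ext
    simp only [ContinuousLinearMap.comp_apply, zero_apply]
    rw [h8, map_zero]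
  intro t ht
  have h1 : g a = g t := eqOn_of_hasTDeriv_zero hs hg0 ha ht
  have h2 : g a = 1 := by
    refine hπ.act_injective (h a) ?_
    rw [← hg a ha, smul_op_one, e]
  rw [hg t ht, ← h1, h2, smul_op_one]

/-- The velocity of the projection of a curve; only a germ of the projected curve is needed. -/
theorem HasTDeriv.vel_eq_of_eventuallyEq {c : ℝ → P} {γ : ℝ → M} {t : ℝ} {v : EP}
    (hπ : IsPrincipalBundle (𝔤 := 𝔤) (EM := EM) (EP := EP) G π)
    (hc : HasTDeriv c (Icc (0 : ℝ) 1) t ((1 : ℝ →L[ℝ] ℝ).smulRight v))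
    (hγ : γ =ᶠ[nhdsWithin t (Icc (0 : ℝ) 1)] fun t => π (c t)) (ht : t ∈ Icc (0 : ℝ) 1) :
    vel EM γ t = tmap EP EM π (c t) v := by
  have h1 := (hc.comp_tmap (hπ.mdiff_proj (c t))).congr_of_eventuallyEq hγ
    (hγ.eq_of_nhdsWithin ht)
  have h2 : mfderivWithin 𝓘(ℝ, ℝ) 𝓘(ℝ, EM) γ (Icc (0 : ℝ) 1) t = _ :=
    HasMFDerivWithinAt.mfderivWithin h1
      ((uniqueDiffOn_Icc zero_lt_one t ht).uniqueMDiffWithinAt)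
  rw [vel, velocity, h2]
  change tmap EP EM π (c t) ((1 : ℝ) • v) = _
  rw [one_smul]

theorem HasTDeriv.vel_eq {c : ℝ → P} {γ : ℝ → M} {t : ℝ} {v : EP}
    (hπ : IsPrincipalBundle (𝔤 := 𝔤) (EM := EM) (EP := EP) G π)
    (hc : HasTDeriv c (Icc (0 : ℝ) 1) t ((1 : ℝ →L[ℝ] ℝ).smulRight v))
    (hγ : ∀ t ∈ Icc (0 : ℝ) 1, π (c t) = γ t) (ht : t ∈ Icc (0 : ℝ) 1) :
    vel EM γ t = tmap EP EM π (c t) v :=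
  hc.vel_eq_of_eventuallyEq hπ
    (Filter.eventually_of_mem self_mem_nhdsWithin fun t ht => (hγ t ht).symm) ht

/-- The horizontal lift of the velocity of the projection of a curve is the horizontal part of the
velocity of the curve. -/
theorem IsConnectionForm.hLift_vel (hη : IsConnectionForm (G := G) η)
    (hπ : IsPrincipalBundle (𝔤 := 𝔤) (EM := EM) (EP := EP) G π) {c : ℝ → P} {γ : ℝ → M}
    {t : ℝ} {v : EP} (hc : HasTDeriv c (Icc (0 : ℝ) 1) t ((1 : ℝ →L[ℝ] ℝ).smulRight v))
    (hγ : ∀ t ∈ Icc (0 : ℝ) 1, π (c t) = γ t) (ht : t ∈ Icc (0 : ℝ) 1) :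
    hLift π η (c t) (vel EM γ t) =
      v - fundT 𝔤 G EP (c t) (oneForm η (c t) v) := by
  rw [hc.vel_eq hπ hγ ht, hη.hLift_tmap hπ]

theorem IsHorizontal.reverse {h : ℝ → P} (hh : IsHorizontal η h (Icc (0 : ℝ) 1)) :
    IsHorizontal η (fun t => h (1 - t)) (Icc (0 : ℝ) 1) := fun t ht => by
  obtain ⟨v, hv, hv'⟩ := hh (1 - t) ⟨by linarith [ht.2], by linarith [ht.1]⟩
  have hφ : HasFDerivWithinAt (fun t : ℝ => 1 - t) (-ContinuousLinearMap.id ℝ ℝ)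
      (Icc (0 : ℝ) 1) t := ((hasFDerivAt_id t).const_sub 1).hasFDerivWithinAt
  refine ⟨-v, (HasTDeriv.comp_hasFDerivWithinAt (φ := fun t : ℝ => 1 - t) hv hφ
    fun τ hτ => ⟨by linarith [hτ.2], by linarith [hτ.1]⟩).congr_deriv ?_, ?_⟩
  · ext; simp
  · rw [map_neg, hv', neg_zero]

theorem IsParallelTransport.isHorizontal (hη : IsConnectionForm (G := G) η)
    (hπ : IsPrincipalBundle (𝔤 := 𝔤) (EM := EM) (EP := EP) G π) {γ : ℝ → M} {u : P} {h : ℝ → P}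
    (hh : IsParallelTransport (EM := EM) π η γ u h) : IsHorizontal η h (Icc (0 : ℝ) 1) := by
  intro t ht
  have h1 : HasTDeriv h (Icc (0 : ℝ) 1) t ((1 : ℝ →L[ℝ] ℝ).smulRight
    (hLift π η (h t) (vel EM γ t))) := hh.hasVelocity t ht
  refine ⟨_, h1, ?_⟩
  rw [hη.hLift_vel hπ h1 hh.lies_over ht, map_sub, hη.oneForm_fundT, sub_self]

theorem IsHorizontal.isParallelTransport (hη : IsConnectionForm (G := G) η)
    (hπ : IsPrincipalBundle (𝔤 := 𝔤) (EM := EM) (EP := EP) G π) {γ : ℝ → M} {u : P} {h : ℝ → P}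
    (h0 : h 0 = u) (hγ : ∀ t ∈ Icc (0 : ℝ) 1, π (h t) = γ t)
    (hh : IsHorizontal η h (Icc (0 : ℝ) 1)) : IsParallelTransport (EM := EM) π η γ u h := by
  refine ⟨h0, hγ, fun t ht => ?_⟩
  obtain ⟨v, hv, hv'⟩ := hh t ht
  have h1 := hη.hLift_vel hπ hv hγ ht
  rw [hv', map_zero, sub_zero] at h1
  rw [HasVelocityAt]
  refine HasTDeriv.congr_deriv (f := h) hv ?_
  exact congrArg (fun v : EP => (1 : ℝ →L[ℝ] ℝ).smulRight v) h1.symm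

/-- Parallel transport is given by any horizontal lift of the curve. -/
theorem IsHorizontal.parTransport_eq (hη : IsConnectionForm (G := G) η)
    (hπ : IsPrincipalBundle (𝔤 := 𝔤) (EM := EM) (EP := EP) G π) {γ : ℝ → M} {u : P} {h : ℝ → P}
    (h0 : h 0 = u) (hγ : ∀ t ∈ Icc (0 : ℝ) 1, π (h t) = γ t)
    (hh : IsHorizontal η h (Icc (0 : ℝ) 1)) {t : ℝ} (ht : t ∈ Icc (0 : ℝ) 1) :
    parTransport (EM := EM) π η γ t u = h t := by
  have h1 := hh.isParallelTransport hη hπ h0 hγ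
  have h2 : IsParallelTransport (EM := EM) π η γ u (fun t => parTransport (EM := EM) π η γ t u) :=
    Classical.epsilon_spec (p := fun h => IsParallelTransport (EM := EM) π η γ u h) ⟨h, h1⟩
  refine IsHorizontal.eqOn hη hπ ordConnected_Icc (uniqueDiffOn_Icc zero_lt_one)
    (h2.isHorizontal hη hπ) hh (fun t ht => ?_) (left_mem_Icc.2 zero_le_one)
    (h2.start.trans h0.symm) ht
  rw [h2.lies_over t ht, hγ t ht]

/-- The expression of the pulled back connection form after a gauge transformation. -/
theorem IsConnectionForm.oneForm_act (hη : IsConnectionForm (G := G) η) (p : P) (g : G) (v : EP)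
    (A : 𝔤) :
    oneForm η (p <• g) (rightT EP g p v + fundT 𝔤 G EP (p <• g) A) =
      adT 𝔤 g⁻¹ (oneForm η p v) + A := by
  rw [map_add, hη.oneForm_rightT, hη.oneForm_fundT]

end Connection

/-! ### The 2-form of a categorical connection -/
section CategoricalConnection

variable {X : Type*} [NormedAddCommGroup X] [NormedSpace ℝ X]
  {𝔤 : Type*} [NormedAddCommGroup 𝔤] [NormedSpace ℝ 𝔤]
  {G : Type*} [TopologicalSpace G] [ChartedSpace 𝔤 G] [Group G]
  {𝔢 : Type*} [NormedAddCommGroup 𝔢] [NormedSpace ℝ 𝔢]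
  {E : Type*} [TopologicalSpace E] [ChartedSpace 𝔢 E] [Group E]
  {EP : Type*} [NormedAddCommGroup EP] [NormedSpace ℝ EP]
  {P : Type*} [TopologicalSpace P] [ChartedSpace EP P]
  [MulAction Gᵐᵒᵖ P] [MulDistribMulAction G E] {d : E →* G}
  [LieGroup 𝓘(ℝ, 𝔤) ∞ G] [IsManifold 𝓘(ℝ, EP) ∞ P]
  {η : PreForm EP P 1 𝔤} {m : PreForm EP P 2 𝔢}

/-- The value of a form at a point as an alternating map on the model space. -/
def formAt {V : Type*} [NormedAddCommGroup V] [NormedSpace ℝ V] {n : ℕ}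
    (α : PreForm EP P n V) (p : P) : EP [⋀^Fin n]→L[ℝ] V := α p

theorem horProj_eq (p : P) (v : EP) :
    (horProj G η p v : EP) = v - fundT 𝔤 G EP p (oneForm η p v) := by
  rw [oneForm_apply]; rfl

theorem IsCategoricalConnection.formAt_horProj (hc : IsCategoricalConnection d η m) (p : P)
    (v w : EP) : formAt m p ![v - fundT 𝔤 G EP p (oneForm η p v),
      w - fundT 𝔤 G EP p (oneForm η p w)] = formAt m p ![v, w] := by
  rw [← horProj_eq, ← horProj_eq]
  exact (hc.horizontal p v w).symm

theorem IsCategoricalConnection.formAt_add_fundT (hc : IsCategoricalConnection d η m) (p : P)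
    (v w : EP) (A B : 𝔤) :
    formAt m p ![v + fundT 𝔤 G EP p A, w + fundT 𝔤 G EP p B] = formAt m p ![v, w] := by
  rw [← hc.formAt_horProj p (v + _), ← hc.formAt_horProj p v]
  simp only [map_add, hc.connection.oneForm_fundT, add_sub_add_right_eq_sub]

/-- Equivariance and horizontality of `m`, combined: vertical components of the arguments do not
matter. -/
theorem IsCategoricalConnection.formAt_act (hc : IsCategoricalConnection d η m) (p : P) (g : G)
    (v w : EP) (A B : 𝔤) :
    formAt m (p <• g) ![rightT EP g p v + fundT 𝔤 G EP (p <• g) A,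
      rightT EP g p w + fundT 𝔤 G EP (p <• g) B] = actT 𝔢 E g⁻¹ (formAt m p ![v, w]) := by
  rw [hc.formAt_add_fundT]
  exact hc.equivariant g p v w

end CategoricalConnection

/-! ### Smooth families of horizontal lifts -/
section Transport

variable {Y : Type} [NormedAddCommGroup Y] [NormedSpace ℝ Y] {S : Set Y} {a b : ℝ}
  {𝔤 : Type*} [NormedAddCommGroup 𝔤] [NormedSpace ℝ 𝔤]
  {G : Type*} [TopologicalSpace G] [ChartedSpace 𝔤 G] [Group G]
  {EM : Type*} [NormedAddCommGroup EM] [NormedSpace ℝ EM]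
  {M : Type*} [TopologicalSpace M] [ChartedSpace EM M]
  {EP : Type*} [NormedAddCommGroup EP] [NormedSpace ℝ EP]
  {P : Type*} [TopologicalSpace P] [ChartedSpace EP P]
  [MulAction Gᵐᵒᵖ P]
  [LieGroup 𝓘(ℝ, 𝔤) ∞ G] [IsManifold 𝓘(ℝ, EP) ∞ P] [IsManifold 𝓘(ℝ, EM) ∞ M]
  {π : P → M} {η : PreForm EP P 1 𝔤}

/-- `F` is a smooth family, parametrized by `S`, of horizontal lifts to `[a, b]` of the curves
`t ↦ J(t, y)`. -/
structure IsHorFamily (π : P → M) (η : PreForm EP P 1 𝔤) (J : ℝ × Y → M) (F : ℝ × Y → P)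
    (a b : ℝ) (S : Set Y) : Prop where
  smooth : ContMDiffOn 𝓘(ℝ, ℝ × Y) 𝓘(ℝ, EP) ∞ F (Icc a b ×ˢ S)
  lies_over : ∀ z ∈ Icc a b ×ˢ S, π (F z) = J z
  horizontal : ∀ y ∈ S, IsHorizontal η (fun t => F (t, y)) (Icc a b)

theorem HasTDeriv.slice_fst {N F : Type*} [NormedAddCommGroup F] [NormedSpace ℝ F]
    [TopologicalSpace N] [ChartedSpace F N] {f : ℝ × Y → N} {t : ℝ} {y : Y} {f' : ℝ × Y →L[ℝ] F}
    (hf : HasTDeriv f (Icc a b ×ˢ S) (t, y) f') (hy : y ∈ S) :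
    HasTDeriv (fun t => f (t, y)) (Icc a b) t ((1 : ℝ →L[ℝ] ℝ).smulRight (f' (1, 0))) := by
  refine (HasTDeriv.comp_hasFDerivWithinAt (φ := fun t : ℝ => (t, y)) hf
    (hasFDerivAt_prodMk_left t y).hasFDerivWithinAt fun _ ht => ⟨ht, hy⟩).congr_deriv ?_
  ext
  simp

theorem contMDiffOn_slice_snd {N F : Type*} [NormedAddCommGroup F] [NormedSpace ℝ F]
    [TopologicalSpace N] [ChartedSpace F N] {f : ℝ × Y → N}
    (hf : ContMDiffOn 𝓘(ℝ, ℝ × Y) 𝓘(ℝ, F) ∞ f (Icc a b ×ˢ S)) {t : ℝ} (ht : t ∈ Icc a b) :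
    ContMDiffOn 𝓘(ℝ, Y) 𝓘(ℝ, F) ∞ (fun y => f (t, y)) S := by
  have h : ContMDiffOn 𝓘(ℝ, Y) 𝓘(ℝ, ℝ × Y) ∞ (fun y : Y => (t, y)) S := by
    rw [contMDiffOn_iff_contDiffOn]; fun_prop
  exact hf.comp h fun y hy => ⟨ht, hy⟩

/-- Smooth families of horizontal lifts over a domain of triviality of the bundle.  In terms of the
section `s = σ ∘ J` the lift is `s l⁻¹ g`, where `l` solves `l' = l η(∂ₜs)` and `g` only depends on
the parameter. -/
theorem exists_isHorFamily_of_localSection [FiniteDimensional ℝ 𝔤]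
    (hη : IsConnectionForm (G := G) η)
    (hπ : IsPrincipalBundle (𝔤 := 𝔤) (EM := EM) (EP := EP) G π) (hab : a < b) (hS : IsCompact S)
    (hc : Convex ℝ S) (hi : (interior S).Nonempty) {J : ℝ × Y → M}
    (hJ : ContMDiffOn 𝓘(ℝ, ℝ × Y) 𝓘(ℝ, EM) ∞ J (Icc a b ×ˢ S)) {U : Set M}
    {σ : M → P} {γ : P → G}
    (hσ : ContMDiffOn 𝓘(ℝ, EM) 𝓘(ℝ, EP) ∞ σ U) (hγ : ContMDiffOn 𝓘(ℝ, EP) 𝓘(ℝ, 𝔤) ∞ γ (π ⁻¹' U))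
    (hπσ : ∀ y ∈ U, π (σ y) = y) (hσγ : ∀ p ∈ π ⁻¹' U, p = σ (π p) <• γ p)
    (hJU : MapsTo J (Icc a b ×ˢ S) U) {c : ℝ} (hcab : c ∈ Icc a b) {p : Y → P}
    (hp : ContMDiffOn 𝓘(ℝ, Y) 𝓘(ℝ, EP) ∞ p S) (hpJ : ∀ y ∈ S, π (p y) = J (c, y)) :
    ∃ F : ℝ × Y → P, IsHorFamily π η J F a b S ∧ ∀ y ∈ S, F (c, y) = p y := by
  have hu := uniqueDiffOn_Icc_prod hab hc hi
  set s : ℝ × Y → P := fun z => σ (J z) with hs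
  have hss : ContMDiffOn 𝓘(ℝ, ℝ × Y) 𝓘(ℝ, EP) ∞ s (Icc a b ×ˢ S) := hσ.comp hJ hJU
  set K : ℝ × Y → 𝔤 := fun z => pull η s (Icc a b ×ˢ S) z ![((1 : ℝ), (0 : Y))] with hK
  have hKs : ContDiffOn ℝ ∞ K (Icc a b ×ˢ S) := contDiffOn_pull_apply hη.smooth hss hu _
  obtain ⟨l, hl1, hls, hll⟩ := exists_contMDiffOn_isLogSol (G := G) hab hS hc hi hKs
  have hpU : MapsTo p S (π ⁻¹' U) := fun y hy => by
    rw [mem_preimage, hpJ y hy]; exact hJU ⟨hcab, hy⟩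
  -- `g` is determined by the prescribed value of the lift at `t = c`
  set g : Y → G := fun y => l (c, y) * γ (p y) with hg
  have hgs : ContMDiffOn 𝓘(ℝ, Y) 𝓘(ℝ, 𝔤) ∞ g S :=
    (contMDiffOn_slice_snd hls hcab).mul (hγ.comp hp hpU)
  have hgs' : ContMDiffOn 𝓘(ℝ, ℝ × Y) 𝓘(ℝ, 𝔤) ∞ (fun z : ℝ × Y => g z.2) (Icc a b ×ˢ S) := by
    have h : ContMDiffOn 𝓘(ℝ, ℝ × Y) 𝓘(ℝ, Y) ∞ (fun z : ℝ × Y => z.2) (Icc a b ×ˢ S) := by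
      rw [contMDiffOn_iff_contDiffOn]; fun_prop
    exact hgs.comp h fun z hz => hz.2
  refine ⟨fun z => s z <• ((l z)⁻¹ * g z.2), ⟨?_, ?_, ?_⟩, ?_⟩
  · exact hπ.contMDiffOn_act le_rfl hss (hls.inv.mul hgs')
  · intro z hz
    rw [hπ.proj_act, hπσ _ (hJU hz)]
  · intro y hy t ht
    have h1 := ((hss (t, y) ⟨ht, hy⟩).hasTDeriv (by simp)).slice_fst hy
    have h2 : HasLog (fun t => l (t, y)) (Icc a b) t ((1 : ℝ →L[ℝ] ℝ).smulRight (K (t, y))) := by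
      refine (HasLog.comp_hasFDerivWithinAt (φ := fun t : ℝ => (t, y)) (hll (t, y) ⟨ht, hy⟩)
        (hasFDerivAt_prodMk_left t y).hasFDerivWithinAt fun _ ht => ⟨ht, hy⟩).congr_deriv ?_
      ext
      simp [duhamel]
    have h3 := h2.inv.mul (hasLog_const (𝔤 := 𝔤) (g y) (Icc a b) t)
    have h4 := h1.act hπ h3
    refine ⟨rightT EP ((l (t, y))⁻¹ * g y) (s (t, y))
        (tmapWithin EP s (Icc a b ×ˢ S) (t, y) (1, 0)) +
        fundT 𝔤 G EP (s (t, y) <• ((l (t, y))⁻¹ * g y))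
          (adT 𝔤 (g y)⁻¹ (-(adT 𝔤 (l (t, y)) (K (t, y))))), h4.congr_deriv ?_, ?_⟩
    · ext; simp
    · rw [hη.oneForm_act]
      have h5 : K (t, y) = oneForm η (s (t, y)) (tmapWithin EP s (Icc a b ×ˢ S) (t, y) (1, 0)) := by
        rw [oneForm_apply]
        simp only [hK, pull]
        exact congrArg (η (s (t, y)) : EP [⋀^Fin 1]→L[ℝ] 𝔤) (by ext i; fin_cases i; rfl)
      rw [← h5, mul_inv_rev, inv_inv, adT_mul]
      simp
  · intro y hy
    have h1 : (l (c, y))⁻¹ * g y = γ (p y) := by simp [hg]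
    simp only [h1, hs, ← hpJ y hy]
    exact (hσγ _ (hpU hy)).symm

theorem ContMDiffOn.of_locally_eq {N F X : Type*} [NormedAddCommGroup F] [NormedSpace ℝ F]
    [TopologicalSpace N] [ChartedSpace F N] [NormedAddCommGroup X] [NormedSpace ℝ X] {f : X → N}
    {D : Set X} {k : WithTop ℕ∞}
    (h : ∀ z ∈ D, ∃ (D' : Set X) (g : X → N), D' ∈ nhdsWithin z D ∧ z ∈ D' ∧ EqOn f g D' ∧
      ContMDiffOn 𝓘(ℝ, X) 𝓘(ℝ, F) k g D') : ContMDiffOn 𝓘(ℝ, X) 𝓘(ℝ, F) k f D := by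
  intro z hz
  obtain ⟨D', g, hD, hzD, he, hg⟩ := h z hz
  exact ((hg z hzD).congr he (he hzD)).mono_of_mem_nhdsWithin hD

theorem IsHorFamily.eqOn (hη : IsConnectionForm (G := G) η)
    (hπ : IsPrincipalBundle (𝔤 := 𝔤) (EM := EM) (EP := EP) G π) {J : ℝ × Y → M} {a' b' : ℝ}
    {S' : Set Y} {F F' : ℝ × Y → P} (hF : IsHorFamily π η J F a b S)
    (hF' : IsHorFamily π η J F' a' b' S') {a₁ b₁ : ℝ} (hab : a₁ < b₁)
    (h1 : Icc a₁ b₁ ⊆ Icc a b) (h2 : Icc a₁ b₁ ⊆ Icc a' b') {c : ℝ} (hc : c ∈ Icc a₁ b₁) {y : Y}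
    (hy : y ∈ S) (hy' : y ∈ S') (e : F (c, y) = F' (c, y)) {t : ℝ} (ht : t ∈ Icc a₁ b₁) :
    F (t, y) = F' (t, y) :=
  IsHorizontal.eqOn hη hπ ordConnected_Icc (uniqueDiffOn_Icc hab) ((hF.horizontal y hy).mono h1)
    ((hF'.horizontal y hy').mono h2)
    (fun t ht => by rw [hF.lies_over (t, y) ⟨h1 ht, hy⟩, hF'.lies_over (t, y) ⟨h2 ht, hy'⟩])
    hc e ht

/-- Families of horizontal lifts can be concatenated if their intervals of definition overlap. -/
theorem IsHorFamily.concat (hη : IsConnectionForm (G := G) η)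
    (hπ : IsPrincipalBundle (𝔤 := 𝔤) (EM := EM) (EP := EP) G π) {J : ℝ × Y → M} {c₁ c₂ : ℝ}
    {F F' : ℝ × Y → P} (hac : a ≤ c₁) (hcc : c₁ < c₂) (hcb : c₂ ≤ b)
    (hF : IsHorFamily π η J F a c₂ S)
    (hF' : IsHorFamily π η J F' c₁ b S) (e : ∀ y ∈ S, F' (c₂, y) = F (c₂, y)) :
    ∃ F'' : ℝ × Y → P, IsHorFamily π η J F'' a b S ∧ ∀ y ∈ S, F'' (a, y) = F (a, y) := by
  set H : ℝ × Y → P := fun z => if z.1 ≤ c₂ then F z else F' z with hH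
  have e1 : ∀ z ∈ Icc a c₂ ×ˢ S, H z = F z := fun z hz => if_pos hz.1.2
  have e2 : ∀ z ∈ Icc c₁ b ×ˢ S, H z = F' z := fun z hz => by
    by_cases h : z.1 ≤ c₂
    · rw [hH]
      simp only [if_pos h]
      exact hF.eqOn hη hπ hF' hcc (Icc_subset_Icc_left hac) (Icc_subset_Icc_right hcb)
        (right_mem_Icc.2 hcc.le) hz.2 hz.2 (e _ hz.2).symm ⟨hz.1.1, h⟩
    · simp only [hH, if_neg h]
  have n1 : ∀ t ∈ Icc a b, t < c₂ → Icc a c₂ ∈ nhdsWithin t (Icc a b) := fun t ht h => by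
    filter_upwards [self_mem_nhdsWithin, mem_nhdsWithin_of_mem_nhds (Iio_mem_nhds h)] with x hx hx'
    exact ⟨hx.1, le_of_lt hx'⟩
  have n2 : ∀ t ∈ Icc a b, c₂ ≤ t → Icc c₁ b ∈ nhdsWithin t (Icc a b) := fun t ht h => by
    filter_upwards [self_mem_nhdsWithin,
      mem_nhdsWithin_of_mem_nhds (Ioi_mem_nhds (hcc.trans_le h))] with x hx hx'
    exact ⟨le_of_lt hx', hx.2⟩
  refine ⟨H, ⟨?_, ?_, ?_⟩, fun y hy => e1 _ ⟨left_mem_Icc.2 (hac.trans hcc.le), hy⟩⟩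
  · refine ContMDiffOn.of_locally_eq fun z hz => ?_
    rcases lt_or_ge z.1 c₂ with h | h
    · refine ⟨Icc a c₂ ×ˢ S, F, ?_, ⟨⟨hz.1.1, h.le⟩, hz.2⟩, e1, hF.smooth⟩
      rw [← Prod.mk.eta (p := z), nhdsWithin_prod_eq]
      exact Filter.prod_mem_prod (n1 z.1 hz.1 h) self_mem_nhdsWithin
    · refine ⟨Icc c₁ b ×ˢ S, F', ?_, ⟨⟨hcc.le.trans h, hz.1.2⟩, hz.2⟩, e2, hF'.smooth⟩
      rw [← Prod.mk.eta (p := z), nhdsWithin_prod_eq]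
      exact Filter.prod_mem_prod (n2 z.1 hz.1 h) self_mem_nhdsWithin
  · intro z hz
    rcases lt_or_ge z.1 c₂ with h | h
    · rw [e1 z ⟨⟨hz.1.1, h.le⟩, hz.2⟩, hF.lies_over z ⟨⟨hz.1.1, h.le⟩, hz.2⟩]
    · rw [e2 z ⟨⟨hcc.le.trans h, hz.1.2⟩, hz.2⟩, hF'.lies_over z ⟨⟨hcc.le.trans h, hz.1.2⟩, hz.2⟩]
  · intro y hy t ht
    rcases lt_or_ge t c₂ with h | h
    · obtain ⟨v, hv, hv'⟩ := (hF.horizontal y hy).congr (k := fun t => H (t, y))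
        (fun t ht => e1 (t, y) ⟨ht, hy⟩) t ⟨ht.1, h.le⟩
      exact ⟨v, hv.mono_of_mem (n1 t ht h), hv'⟩
    · obtain ⟨v, hv, hv'⟩ := (hF'.horizontal y hy).congr (k := fun t => H (t, y))
        (fun t ht => e2 (t, y) ⟨ht, hy⟩) t ⟨hcc.le.trans h, ht.2⟩
      exact ⟨v, hv.mono_of_mem (n2 t ht h), hv'⟩

/-- Horizontal lifts exist for parameters in a neighbourhood of a given one: by compactness the
curve is covered by finitely many domains of triviality. -/
theorem exists_isHorFamily_local [FiniteDimensional ℝ 𝔤]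
    (hη : IsConnectionForm (G := G) η)
    (hπ : IsPrincipalBundle (𝔤 := 𝔤) (EM := EM) (EP := EP) G π) (hab : a < b) (hS : IsCompact S)
    (hc : Convex ℝ S) (hi : (interior S).Nonempty) {J : ℝ × Y → M}
    (hJ : ContMDiffOn 𝓘(ℝ, ℝ × Y) 𝓘(ℝ, EM) ∞ J (Icc a b ×ˢ S)) {p : Y → P}
    (hp : ContMDiffOn 𝓘(ℝ, Y) 𝓘(ℝ, EP) ∞ p S) (hpJ : ∀ y ∈ S, π (p y) = J (a, y)) {y₀ : Y}
    (hy₀ : y₀ ∈ S) :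
    ∃ r > 0, ∃ F : ℝ × Y → P, IsHorFamily π η J F a b (S ∩ Metric.closedBall y₀ r) ∧
      ∀ y ∈ S ∩ Metric.closedBall y₀ r, F (a, y) = p y := by
  choose U hxU hU σ γ hσ hγ hπσ hσ1 hγm hσγ using hπ.exists_localSection
  have hO : ∀ x : M, ∃ O : Set (ℝ × Y), IsOpen O ∧ J ⁻¹' (U x) ∩ (Icc a b ×ˢ S) =
      O ∩ (Icc a b ×ˢ S) := fun x => continuousOn_iff'.1 hJ.continuousOn (U x) (hU x)
  choose O hOo hOJ using hO
  have hcov : Icc a b ×ˢ {y₀} ⊆ ⋃ x, O x := by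
    rintro ⟨t, y⟩ ⟨ht, rfl⟩
    have : (t, y) ∈ J ⁻¹' (U (J (t, y))) ∩ (Icc a b ×ˢ S) := ⟨hxU _, ht, hy₀⟩
    rw [hOJ] at this
    exact mem_iUnion.2 ⟨_, this.1⟩
  -- the pieces of size less than the Lebesgue number `δ` lie over a domain of triviality
  obtain ⟨δ, hδ, hleb⟩ := lebesgue_number_lemma_of_metric
    (isCompact_Icc.prod isCompact_singleton) hOo hcov
  set S' := S ∩ Metric.closedBall y₀ (δ / 2) with hS'
  have hS'c : IsCompact S' := hS.inter_right Metric.isClosed_closedBall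
  have hc' : Convex ℝ S' := hc.inter (convex_closedBall _ _)
  have hi' : (interior S').Nonempty := by
    have h1 : y₀ ∈ closure (interior S) := by
      rw [hc.closure_interior_eq_closure_of_nonempty_interior hi]; exact subset_closure hy₀
    obtain ⟨y, hy, hy'⟩ := Metric.mem_closure_iff.1 h1 (δ / 2) (by positivity)
    refine ⟨y, ?_⟩
    rw [hS', interior_inter]
    refine ⟨hy, Metric.ball_subset_interior_closedBall ?_⟩
    rwa [Metric.mem_ball, dist_comm]
  -- `N` steps of length `h < δ / 2`
  obtain ⟨N, hN⟩ := exists_nat_gt ((b - a) / (δ / 2))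
  have hN0 : (0 : ℝ) < N := lt_of_le_of_lt (div_nonneg (by linarith) (by positivity)) hN
  set h : ℝ := (b - a) / N with hh
  have hh0 : 0 < h := div_pos (by linarith) hN0
  have hhδ : h < δ / 2 := by
    rw [hh, div_lt_iff₀ hN0]; rw [div_lt_iff₀ (by positivity)] at hN; linarith
  have hNh : N * h = b - a := by rw [hh]; field_simp
  -- the families over short intervals, with prescribed value at `t = c`
  have hshort : ∀ c a₁ b₁ : ℝ, c ∈ Icc a₁ b₁ → a ≤ a₁ → b₁ ≤ b → a₁ < b₁ → c - h ≤ a₁ →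
      b₁ ≤ c + h → ∀ q : Y → P, ContMDiffOn 𝓘(ℝ, Y) 𝓘(ℝ, EP) ∞ q S' →
      (∀ y ∈ S', π (q y) = J (c, y)) →
      ∃ F : ℝ × Y → P, IsHorFamily π η J F a₁ b₁ S' ∧ ∀ y ∈ S', F (c, y) = q y := by
    intro c a₁ b₁ hcI h1 h2 h3 h4 h5 q hq hqJ
    obtain ⟨x, hx⟩ := hleb (c, y₀) ⟨⟨h1.trans hcI.1, hcI.2.trans h2⟩, rfl⟩
    have hsub : Icc a₁ b₁ ×ˢ S' ⊆ Icc a b ×ˢ S :=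
      prod_mono (Icc_subset_Icc h1 h2) inter_subset_left
    refine exists_isHorFamily_of_localSection hη hπ h3 hS'c hc' hi' (hJ.mono hsub) (hσ x) (hγ x)
      (hπσ x) (hσγ x) (fun z hz => ?_) hcI hq hqJ
    have h6 : z ∈ O x ∩ (Icc a b ×ˢ S) := by
      refine ⟨hx ?_, hsub hz⟩
      rw [Metric.mem_ball, Prod.dist_eq]
      refine max_lt ?_ ?_
      · rw [Real.dist_eq, abs_lt]
        exact ⟨by linarith [hz.1.1], by linarith [hz.1.2]⟩
      · exact lt_of_le_of_lt (Metric.mem_closedBall.1 hz.2.2) (by linarith)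
    rw [← hOJ] at h6
    exact h6.1
  refine ⟨δ / 2, by positivity, ?_⟩
  have key : ∀ k : ℕ, k + 1 ≤ N → ∃ F : ℝ × Y → P,
      IsHorFamily π η J F a (a + (k + 1 : ℕ) * h) S' ∧ ∀ y ∈ S', F (a, y) = p y := by
    intro k
    have hle : ∀ k : ℕ, k ≤ N → a + k * h ≤ b := fun k hk => by
      have : (k : ℝ) * h ≤ N * h := by gcongr
      linarith
    induction k with
    | zero =>
      intro hk
      have := hle 1 hk
      simp only [zero_add, Nat.cast_one, one_mul] at this ⊢
      exact hshort a a (a + h) ⟨le_rfl, by linarith⟩ le_rfl this (by linarith)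
        (by linarith) le_rfl p (hp.mono inter_subset_left) (fun y hy => hpJ y hy.1)
    | succ k ih =>
      intro hk
      obtain ⟨F₁, hF₁, hF₁p⟩ := ih (by omega)
      have h1 := hle (k + 1 + 1) hk
      have hkh : 0 ≤ (k : ℝ) * h := by positivity
      -- the next family is started at `a + (k + 1) h` but defined from `a + k h` on, so that the
      -- intervals overlap
      have hc1 : a + (k + 1 : ℕ) * h ∈ Icc (a + k * h) (a + (k + 1 + 1 : ℕ) * h) := by
        push_cast; constructor <;> nlinarith
      have hc2 : a + (k + 1 : ℕ) * h ∈ Icc a (a + (k + 1 : ℕ) * h) := by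
        push_cast; constructor <;> nlinarith
      obtain ⟨F₂, hF₂, hF₂p⟩ := hshort (a + (k + 1 : ℕ) * h) (a + k * h)
        (a + (k + 1 + 1 : ℕ) * h) hc1 (by linarith) h1 (by push_cast; nlinarith)
        (by push_cast; nlinarith) (by push_cast; nlinarith)
        (fun y => F₁ (a + (k + 1 : ℕ) * h, y)) (contMDiffOn_slice_snd hF₁.smooth hc2)
        (fun y hy => hF₁.lies_over _ ⟨hc2, hy⟩)
      obtain ⟨F, hF, hFp⟩ := IsHorFamily.concat hη hπ (by linarith) (by push_cast; nlinarith)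
        (by push_cast; nlinarith) hF₁ hF₂ hF₂p
      exact ⟨F, hF, fun y hy => (hFp y hy).trans (hF₁p y hy)⟩
  have hN1 : N - 1 + 1 = N := Nat.sub_add_cancel (by exact_mod_cast hN0)
  obtain ⟨F, hF, hFp⟩ := key (N - 1) hN1.le
  rw [hN1, hNh, add_sub_cancel] at hF
  exact ⟨F, hF, hFp⟩

/-- Smooth families of curves have smooth families of horizontal lifts. -/
theorem exists_isHorFamily [FiniteDimensional ℝ 𝔤]
    (hη : IsConnectionForm (G := G) η)
    (hπ : IsPrincipalBundle (𝔤 := 𝔤) (EM := EM) (EP := EP) G π) (hab : a < b) (hS : IsCompact S)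
    (hc : Convex ℝ S) (hi : (interior S).Nonempty) {J : ℝ × Y → M}
    (hJ : ContMDiffOn 𝓘(ℝ, ℝ × Y) 𝓘(ℝ, EM) ∞ J (Icc a b ×ˢ S)) {p : Y → P}
    (hp : ContMDiffOn 𝓘(ℝ, Y) 𝓘(ℝ, EP) ∞ p S) (hpJ : ∀ y ∈ S, π (p y) = J (a, y)) :
    ∃ F : ℝ × Y → P, IsHorFamily π η J F a b S ∧ ∀ y ∈ S, F (a, y) = p y := by
  have hex : ∀ y₀ : Y, ∃ (r : ℝ) (F : ℝ × Y → P), y₀ ∈ S → 0 < r ∧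
      IsHorFamily π η J F a b (S ∩ Metric.closedBall y₀ r) ∧
      ∀ y ∈ S ∩ Metric.closedBall y₀ r, F (a, y) = p y := fun y₀ => by
    by_cases hy₀ : y₀ ∈ S
    · obtain ⟨r, hr, F, hF⟩ := exists_isHorFamily_local hη hπ hab hS hc hi hJ hp hpJ hy₀
      exact ⟨r, F, fun _ => ⟨hr, hF⟩⟩
    · exact ⟨1, fun z => p z.2, fun h => absurd h hy₀⟩
  choose r Φ hΦ using hex
  have hself : ∀ y ∈ S, y ∈ S ∩ Metric.closedBall y (r y) := fun y hy =>
    ⟨hy, Metric.mem_closedBall_self (hΦ y hy).1.le⟩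
  -- the local families agree by uniqueness, so that `(t, y) ↦ Φ y (t, y)` locally is one of them
  have heq : ∀ y₀ ∈ S, EqOn (fun z : ℝ × Y => Φ z.2 z) (Φ y₀)
      (Icc a b ×ˢ (S ∩ Metric.closedBall y₀ (r y₀))) := fun y₀ hy₀ z hz =>
    (hΦ z.2 hz.2.1).2.1.eqOn hη hπ (hΦ y₀ hy₀).2.1 hab le_rfl le_rfl (left_mem_Icc.2 hab.le)
      (hself _ hz.2.1) hz.2 (by
        rw [(hΦ z.2 hz.2.1).2.2 _ (hself _ hz.2.1), (hΦ y₀ hy₀).2.2 _ hz.2]) hz.1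
  refine ⟨fun z => Φ z.2 z, ⟨?_, ?_, ?_⟩, fun y hy => (hΦ y hy).2.2 y (hself y hy)⟩
  · refine ContMDiffOn.of_locally_eq fun z hz => ?_
    refine ⟨Icc a b ×ˢ (S ∩ Metric.closedBall z.2 (r z.2)), Φ z.2, ?_, ⟨hz.1, hself _ hz.2⟩,
      heq z.2 hz.2, (hΦ z.2 hz.2).2.1.smooth⟩
    rw [← Prod.mk.eta (p := z), nhdsWithin_prod_eq]
    exact Filter.prod_mem_prod self_mem_nhdsWithin
      (inter_mem_nhdsWithin _ (Metric.closedBall_mem_nhds _ (hΦ z.2 hz.2).1))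
  · exact fun z hz => (hΦ z.2 hz.2).2.1.lies_over z ⟨hz.1, hself _ hz.2⟩
  · exact fun y hy => (hΦ y hy).2.1.horizontal y (hself y hy)

end Transport

/-! ### The bracket as a continuous bilinear map -/
section Bracket

variable {𝔤 : Type*} [NormedAddCommGroup 𝔤] [NormedSpace ℝ 𝔤] [FiniteDimensional ℝ 𝔤]
  {G : Type*} [TopologicalSpace G] [ChartedSpace 𝔤 G] [Group G] [LieGroup 𝓘(ℝ, 𝔤) ∞ G]

variable (𝔤 G) in
/-- In finite dimension the bracket is a continuous bilinear map. -/
theorem exists_bracketCLM : ∃ B : 𝔤 →L[ℝ] 𝔤 →L[ℝ] 𝔤, ∀ u v, B u v = lieBr G u v := by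
  have : CompleteSpace 𝔤 := FiniteDimensional.complete ℝ 𝔤
  have hLG : LieGroup 𝓘(ℝ, 𝔤) (minSmoothness ℝ 3) G := by
    rw [minSmoothness_of_isRCLikeNormedField]
    exact LieGroup.of_le (n := ∞) (WithTop.coe_le_coe.2 (le_top : (3 : ℕ∞) ≤ ⊤))
  let L : 𝔤 →ₗ[ℝ] 𝔤 →ₗ[ℝ] 𝔤 := LinearMap.mk₂ ℝ (lieBr G)
    (fun u v w => add_lie (L := GroupLieAlgebra 𝓘(ℝ, 𝔤) G)
      (M := GroupLieAlgebra 𝓘(ℝ, 𝔤) G) u v w)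
    (fun c u v => smul_lie (L := GroupLieAlgebra 𝓘(ℝ, 𝔤) G)
      (M := GroupLieAlgebra 𝓘(ℝ, 𝔤) G) c u v)
    (fun u v w => lie_add (L := GroupLieAlgebra 𝓘(ℝ, 𝔤) G)
      (M := GroupLieAlgebra 𝓘(ℝ, 𝔤) G) u v w)
    (fun c u v => lie_smul (L := GroupLieAlgebra 𝓘(ℝ, 𝔤) G)
      (M := GroupLieAlgebra 𝓘(ℝ, 𝔤) G) c u v)
  exact ⟨LinearMap.toContinuousLinearMap
    ((LinearMap.toContinuousLinearMap (𝕜 := ℝ) (E := 𝔤) (F' := 𝔤)).toLinearMap ∘ₗ L),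
    fun u v => rfl⟩

end Bracket

/-! ### Pullbacks and exterior derivatives in low degree -/
section PullTwo

variable {X : Type*} [NormedAddCommGroup X] [NormedSpace ℝ X]
  {EP : Type*} [NormedAddCommGroup EP] [NormedSpace ℝ EP]
  {P : Type*} [TopologicalSpace P] [ChartedSpace EP P]
  {V : Type*} [NormedAddCommGroup V] [NormedSpace ℝ V]

theorem pull_one (η : PreForm EP P 1 V) (F : X → P) (D : Set X) (z v : X) :
    pull η F D z ![v] = oneForm η (F z) (tmapWithin EP F D z v) := by
  rw [oneForm_apply]
  exact congrArg (η (F z) : EP [⋀^Fin 1]→L[ℝ] V) (by ext i; fin_cases i; rfl)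

theorem pull_two (m : PreForm EP P 2 V) (F : X → P) (D : Set X) (z v w : X) :
    pull m F D z ![v, w] = formAt m (F z) ![tmapWithin EP F D z v, tmapWithin EP F D z w] :=
  congrArg (m (F z) : EP [⋀^Fin 2]→L[ℝ] V) (by ext i; fin_cases i <;> rfl)

theorem pull_three (m : PreForm EP P 3 V) (F : X → P) (D : Set X) (z u v w : X) :
    pull m F D z ![u, v, w] = formAt m (F z) ![tmapWithin EP F D z u, tmapWithin EP F D z v,
      tmapWithin EP F D z w] :=
  congrArg (m (F z) : EP [⋀^Fin 3]→L[ℝ] V) (by ext i; fin_cases i <;> rfl)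

theorem extDerivWithin_one_apply {f : X → X [⋀^Fin 1]→L[ℝ] V} {D : Set X} {z : X}
    (hf : DifferentiableWithinAt ℝ f D z) (hD : UniqueDiffWithinAt ℝ D z) (u v : X) :
    extDerivWithin f D z ![u, v] =
      fderivWithin ℝ (fun z => f z ![v]) D z u - fderivWithin ℝ (fun z => f z ![u]) D z v := by
  rw [extDerivWithin_apply hf hD]
  have h0 : Fin.removeNth (0 : Fin 2) ![u, v] = ![v] := by ext i; fin_cases i; rfl
  have h1 : Fin.removeNth (1 : Fin 2) ![u, v] = ![u] := by ext i; fin_cases i; rfl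
  rw [Fin.sum_univ_two, h0, h1]
  simp [sub_eq_add_neg]

theorem extDerivWithin_two_apply {f : X → X [⋀^Fin 2]→L[ℝ] V} {D : Set X} {z : X}
    (hf : DifferentiableWithinAt ℝ f D z) (hD : UniqueDiffWithinAt ℝ D z) (u v w : X) :
    extDerivWithin f D z ![u, v, w] =
      fderivWithin ℝ (fun z => f z ![v, w]) D z u - fderivWithin ℝ (fun z => f z ![u, w]) D z v +
        fderivWithin ℝ (fun z => f z ![u, v]) D z w := by
  rw [extDerivWithin_apply hf hD]
  have h0 : Fin.removeNth (0 : Fin 3) ![u, v, w] = ![v, w] := by ext i; fin_cases i <;> rfl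
  have h1 : Fin.removeNth (1 : Fin 3) ![u, v, w] = ![u, w] := by ext i; fin_cases i <;> rfl
  have h2 : Fin.removeNth (2 : Fin 3) ![u, v, w] = ![u, v] := by ext i; fin_cases i <;> rfl
  rw [Fin.sum_univ_three, h0, h1, h2]
  simp [sub_eq_add_neg]

theorem HasTDeriv.tmapWithin_eq {f : X → P} {s : Set X} {x : X} {f' : X →L[ℝ] EP}
    (h : HasTDeriv f s x f') (hs : UniqueDiffWithinAt ℝ s x) : tmapWithin EP f s x = f' :=
  HasTDeriv.unique (HasMFDerivWithinAt.mdifferentiableWithinAt h).hasMFDerivWithinAt h hs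

end PullTwo

/-! ### The fake curvature condition and the Bianchi identity at a point -/
section Bianchi

variable {X : Type*} [NormedAddCommGroup X] [NormedSpace ℝ X] [FiniteDimensional ℝ X]
  {𝔤 : Type*} [NormedAddCommGroup 𝔤] [NormedSpace ℝ 𝔤] [FiniteDimensional ℝ 𝔤]
  {G : Type*} [TopologicalSpace G] [ChartedSpace 𝔤 G] [Group G]
  {𝔢 : Type*} [NormedAddCommGroup 𝔢] [NormedSpace ℝ 𝔢] [FiniteDimensional ℝ 𝔢]
  {E : Type*} [TopologicalSpace E] [ChartedSpace 𝔢 E] [Group E]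
  {EM : Type*} [NormedAddCommGroup EM] [NormedSpace ℝ EM]
  {M : Type*} [TopologicalSpace M] [ChartedSpace EM M]
  {EP : Type*} [NormedAddCommGroup EP] [NormedSpace ℝ EP]
  {P : Type*} [TopologicalSpace P] [ChartedSpace EP P]
  [MulAction Gᵐᵒᵖ P] [MulDistribMulAction G E] {d : E →* G}
  [LieGroup 𝓘(ℝ, 𝔤) ∞ G] [LieGroup 𝓘(ℝ, 𝔢) ∞ E] [IsManifold 𝓘(ℝ, EP) ∞ P]
  [IsManifold 𝓘(ℝ, EM) ∞ M]
  {π : P → M} {η : PreForm EP P 1 𝔤} {m : PreForm EP P 2 𝔢} {F : X → P} {D : Set X}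

/-- The condition `∂(m) = dη + ½ [η ∧ η]`, pulled back along a smooth map. -/
theorem IsCategoricalConnection.derT_pull (hc : IsCategoricalConnection d η m)
    (hF : ContMDiffOn 𝓘(ℝ, X) 𝓘(ℝ, EP) ∞ F D) (hD : UniqueDiffOn ℝ D)
    (hD' : D ⊆ closure (interior D)) {z : X} (hz : z ∈ D) (v w : X) :
    (derT d : 𝔢 →L[ℝ] 𝔤) (pull m F D z ![v, w]) = extDerivWithin (pull η F D) D z ![v, w] +
      (1 / 2 : ℝ) • (lieBr G (pull η F D z ![v]) (pull η F D z ![w]) -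
        lieBr G (pull η F D z ![w]) (pull η F D z ![v])) := by
  rw [extDerivWithin_pull hc.connection.smooth hF hD hz (hD' hz), pull_two, pull_two, pull_one,
    pull_one, oneForm_apply, oneForm_apply]
  exact hc.fake_curvature (F z) (tmapWithin EP F D z v) (tmapWithin EP F D z w)

/-- The Bianchi identity at a point where the pulled back connection form vanishes. -/
theorem IsCategoricalConnection.derT_extDerivWithin_eq_zero (hc : IsCategoricalConnection d η m)
    (hF : ContMDiffOn 𝓘(ℝ, X) 𝓘(ℝ, EP) ∞ F D) (hD : UniqueDiffOn ℝ D)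
    (hD' : D ⊆ closure (interior D)) {z₀ : X} (hz₀ : z₀ ∈ D)
    (h0 : ∀ v, pull η F D z₀ ![v] = 0) (u v w : X) :
    (derT d : 𝔢 →L[ℝ] 𝔤) (extDerivWithin (pull m F D) D z₀ ![u, v, w]) = 0 := by
  obtain ⟨B, hB⟩ := exists_bracketCLM 𝔤 G
  have hu := hD z₀ hz₀
  have hA := contDiffOn_pull hc.connection.smooth hF hD
  have hμ := (contDiffOn_pull hc.smooth hF hD).differentiableOn (by simp) z₀ hz₀
  have hμv : ∀ v w, DifferentiableWithinAt ℝ (fun z => pull m F D z ![v, w]) D z₀ := fun v w =>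
    (contDiffOn_pull_apply hc.smooth hF hD ![v, w]).differentiableOn (by simp) z₀ hz₀
  have hAv : ∀ v, DifferentiableWithinAt ℝ (fun z => pull η F D z ![v]) D z₀ := fun v =>
    (contDiffOn_pull_apply hc.connection.smooth hF hD ![v]).differentiableOn (by simp) z₀ hz₀
  have hdA : DifferentiableWithinAt ℝ (extDerivWithin (pull η F D) D) D z₀ := by
    have h1 : DifferentiableOn ℝ (fderivWithin ℝ (pull η F D) D) D :=
      (hA.fderivWithin hD (m := ∞) (by simp)).differentiableOn (by simp)
    exact ((ContinuousAlternatingMap.alternatizeUncurryFinCLM ℝ X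
      𝔤).differentiableAt).comp_differentiableWithinAt z₀ (h1 z₀ hz₀)
  -- the values of `∂ (F^* m)` and of the exterior derivative of `F^* η` agree to first order
  have key : ∀ v w x, (derT d : 𝔢 →L[ℝ] 𝔤) (fderivWithin ℝ (fun z => pull m F D z ![v, w]) D z₀ x) =
      fderivWithin ℝ (fun z => extDerivWithin (pull η F D) D z ![v, w]) D z₀ x := by
    intro v w x
    have h1 : HasFDerivWithinAt (fun z => (derT d : 𝔢 →L[ℝ] 𝔤) (pull m F D z ![v, w]))
        ((derT d : 𝔢 →L[ℝ] 𝔤).comp (fderivWithin ℝ (fun z => pull m F D z ![v, w]) D z₀)) D z₀ :=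
      (derT d : 𝔢 →L[ℝ] 𝔤).hasFDerivAt.comp_hasFDerivWithinAt z₀ (hμv v w).hasFDerivWithinAt
    -- the bracket of two components of `F^* η` vanishes to second order at `z₀`
    have hb : ∀ v w, HasFDerivWithinAt (fun z => B (pull η F D z ![v]) (pull η F D z ![w]))
        (0 : X →L[ℝ] 𝔤) D z₀ := fun v w => by
      have := B.hasFDerivWithinAt_of_bilinear (hAv v).hasFDerivWithinAt (hAv w).hasFDerivWithinAt
      refine this.congr_fderiv ?_
      ext; simp [h0]
    have h2 : HasFDerivWithinAt (fun z => extDerivWithin (pull η F D) D z ![v, w]) _ D z₀ :=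
      HasFDerivWithinAt.congr' (h1.sub (((hb v w).sub (hb w v)).const_smul (1 / 2 : ℝ)))
        (fun z hz => by
          simp only [Pi.sub_apply, Pi.smul_apply]
          rw [hc.derT_pull hF hD hD' hz, hB, hB, add_sub_cancel_right]) hz₀
    rw [h2.fderivWithin hu]
    simp
  -- hence `∂ d(F^* m) = d d(F^* η) = 0` at `z₀`
  have h3 := extDerivWithin_extDerivWithin_apply (r := ∞) (hA z₀ hz₀) (by
      rw [minSmoothness_of_isRCLikeNormedField]
      exact WithTop.coe_le_coe.2 (le_top : (2 : ℕ∞) ≤ ⊤)) hD (hD' hz₀) hz₀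
  have h4 := DFunLike.congr_fun h3 ![u, v, w]
  rw [extDerivWithin_two_apply hdA hu] at h4
  rw [extDerivWithin_two_apply hμ hu, map_add, map_sub, key, key, key, h4]
  rfl

end Bianchi

/-! ### The 2-curvature in terms of pulled back forms -/
section Gauge

variable {X : Type*} [NormedAddCommGroup X] [NormedSpace ℝ X] [FiniteDimensional ℝ X]
  {𝔤 : Type*} [NormedAddCommGroup 𝔤] [NormedSpace ℝ 𝔤] [FiniteDimensional ℝ 𝔤]
  {G : Type*} [TopologicalSpace G] [ChartedSpace 𝔤 G] [Group G]
  {𝔢 : Type*} [NormedAddCommGroup 𝔢] [NormedSpace ℝ 𝔢] [FiniteDimensional ℝ 𝔢]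
  {E : Type*} [TopologicalSpace E] [ChartedSpace 𝔢 E] [Group E]
  {EM : Type*} [NormedAddCommGroup EM] [NormedSpace ℝ EM]
  {M : Type*} [TopologicalSpace M] [ChartedSpace EM M]
  {EP : Type*} [NormedAddCommGroup EP] [NormedSpace ℝ EP]
  {P : Type*} [TopologicalSpace P] [ChartedSpace EP P]
  [MulAction Gᵐᵒᵖ P] [MulDistribMulAction G E] {d : E →* G}
  [LieGroup 𝓘(ℝ, 𝔤) ∞ G] [LieGroup 𝓘(ℝ, 𝔢) ∞ E] [IsManifold 𝓘(ℝ, EP) ∞ P]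
  [IsManifold 𝓘(ℝ, EM) ∞ M]
  {π : P → M} {η : PreForm EP P 1 𝔤} {m : PreForm EP P 2 𝔢} {F : X → P} {D : Set X}

variable (G) in
/-- There are group-valued maps with a prescribed differential at a point. -/
theorem exists_gauge (z₀ : X) (A : X →L[ℝ] 𝔤) : ∃ (U : Set X) (h : X → G), IsOpen U ∧ z₀ ∈ U ∧
    h z₀ = 1 ∧ ContMDiffOn 𝓘(ℝ, X) 𝓘(ℝ, 𝔤) ∞ h U ∧ HasLog h univ z₀ A := by
  set ψ := extChartAt 𝓘(ℝ, 𝔤) (1 : G) with hψ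
  set c : X → 𝔤 := fun z => ψ 1 + A (z - z₀) with hc
  have hcs : ContDiff ℝ ∞ c := by fun_prop
  have hcd : HasFDerivWithinAt c A univ z₀ := by
    rw [hasFDerivWithinAt_univ]
    have : HasFDerivAt (fun z => A (z - z₀)) A z₀ :=
      A.hasFDerivAt.comp z₀ ((hasFDerivAt_id z₀).sub_const z₀)
    exact this.const_add _
  have hc0 : c z₀ = ψ 1 := by simp [hc]
  refine ⟨c ⁻¹' ψ.target, fun z => ψ.symm (c z), ?_, ?_, ?_, ?_, ?_⟩
  · exact (isOpen_extChartAt_target (I := 𝓘(ℝ, 𝔤)) (1 : G)).preimage hcs.continuous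
  · rw [mem_preimage, hc0]; exact mem_extChartAt_target 1
  · simp only [hc0, hψ, extChartAt_to_inv]
  · exact (contMDiffOn_extChartAt_symm (I := 𝓘(ℝ, 𝔤)) (n := ∞) (1 : G)).comp
      (contMDiffOn_iff_contDiffOn.2 hcs.contDiffOn) fun z hz => hz
  · refine hasLog_extChartAt_symm 1 ?_ (hcd.congr_fderiv ?_)
    · rw [hc0]; exact mem_extChartAt_target 1
    · rw [hc0, extChartAt_to_inv, logChart_one]; rfl

variable (G) in
/-- The 2-curvature `Dm` on the images of tangent vectors under `F`: the value of `dm` on the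
horizontal projections of these images. -/
def pullHor (η : PreForm EP P 1 𝔤) (m : PreForm EP P 2 𝔢) (F : X → P) (D : Set X) (z u v w : X) :
    𝔢 :=
  formAt (extD m) (F z)
    ![tmapWithin EP F D z u - fundT 𝔤 G EP (F z) (oneForm η (F z) (tmapWithin EP F D z u)),
      tmapWithin EP F D z v - fundT 𝔤 G EP (F z) (oneForm η (F z) (tmapWithin EP F D z v)),
      tmapWithin EP F D z w - fundT 𝔤 G EP (F z) (oneForm η (F z) (tmapWithin EP F D z w))]

/-- The 2-curvature in terms of the pulled back forms, and the Bianchi identity `∂ Dm = 0`.  Both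
follow by passing to a gauge in which the connection form vanishes at the given point. -/
theorem IsCategoricalConnection.pullHor_eq
    (hπ : IsPrincipalBundle (𝔤 := 𝔤) (EM := EM) (EP := EP) G π)
    (hd : IsLieCrossedModule (𝔤 := 𝔤) (𝔢 := 𝔢) d) (hc : IsCategoricalConnection d η m)
    (hF : ContMDiffOn 𝓘(ℝ, X) 𝓘(ℝ, EP) ∞ F D) (hD : UniqueDiffOn ℝ D)
    (hD' : D ⊆ closure (interior D)) {z₀ : X} (hz₀ : z₀ ∈ D) (u v w : X) :
    pullHor G η m F D z₀ u v w =
      fderivWithin ℝ (fun z => pull m F D z ![v, w]) D z₀ u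
        + actDer 𝔤 G 𝔢 E (pull η F D z₀ ![u]) (pull m F D z₀ ![v, w])
      - (fderivWithin ℝ (fun z => pull m F D z ![u, w]) D z₀ v
        + actDer 𝔤 G 𝔢 E (pull η F D z₀ ![v]) (pull m F D z₀ ![u, w]))
      + (fderivWithin ℝ (fun z => pull m F D z ![u, v]) D z₀ w
        + actDer 𝔤 G 𝔢 E (pull η F D z₀ ![w]) (pull m F D z₀ ![u, v])) ∧
    (derT d : 𝔢 →L[ℝ] 𝔤) (pullHor G η m F D z₀ u v w) = 0 := by
  -- the gauge transformed map `F₁ = F h`, where `h(z₀) = 1` and `h⁻¹ dh = -A` at `z₀`, has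
  -- horizontal images at `z₀`
  set A : X →L[ℝ] 𝔤 := (oneForm η (F z₀)).comp (tmapWithin EP F D z₀) with hA
  obtain ⟨U, h, hU, hzU, h1, hhs, hhl⟩ := exists_gauge G z₀ (-A)
  set D₁ := D ∩ U with hD₁
  have hz₁ : z₀ ∈ D₁ := ⟨hz₀, hzU⟩
  have hDu : UniqueDiffOn ℝ D₁ := hD.inter hU
  have hDc : D₁ ⊆ closure (interior D₁) := by
    rw [hD₁, interior_inter, hU.interior_eq, inter_comm, inter_comm (interior D)]
    exact fun z hz => hU.inter_closure ⟨hz.1, hD' hz.2⟩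
  set F₁ : X → P := fun z => F z <• h z with hF₁
  have hF₁s : ContMDiffOn 𝓘(ℝ, X) 𝓘(ℝ, EP) ∞ F₁ D₁ :=
    hπ.contMDiffOn_act le_rfl (hF.mono inter_subset_left) (hhs.mono inter_subset_right)
  have hT : ∀ z ∈ D₁, HasTDeriv F D₁ z (tmapWithin EP F D z) := fun z hz =>
    ((hF z hz.1).hasTDeriv (by simp)).mono inter_subset_left
  have hF₀ : F₁ z₀ = F z₀ := by simp only [hF₁, h1]; exact smul_op_one _
  have hT₀ : ∀ v, tmapWithin EP F₁ D₁ z₀ v = tmapWithin EP F D z₀ v -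
      fundT 𝔤 G EP (F z₀) (oneForm η (F z₀) (tmapWithin EP F D z₀ v)) := fun v => by
    have e1 := ((hT z₀ hz₁).act hπ (hhl.mono (subset_univ D₁))).tmapWithin_eq (hDu z₀ hz₁)
    have e2 : rightT EP (1 : G) (F z₀) = ContinuousLinearMap.id ℝ EP := by
      rw [rightT]; simp only [smul_op_one]; exact tmap_id _
    have e3 : F z₀ <• (1 : G) = F z₀ := smul_op_one _
    rw [e1, h1, e2, e3]
    simp [hA, sub_eq_add_neg]
  have hμ₁ : ∀ v w, ∀ z ∈ D₁, pull m F₁ D₁ z ![v, w] =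
      actT 𝔢 E (h z)⁻¹ (pull m F D z ![v, w]) := fun v w z hz => by
    have e0 : HasTDeriv h D₁ z (tmapWithin 𝔤 h U z) :=
      ((hhs z hz.2).hasTDeriv (by simp)).mono inter_subset_right
    have e1 := ((hT z hz).act hπ e0.hasLog).tmapWithin_eq (hDu z hz)
    rw [pull_two, e1, pull_two]
    simp only [add_apply, ContinuousLinearMap.comp_apply]
    exact hc.formAt_act _ _ _ _ _ _
  have hVeq : ∀ u v w, pullHor G η m F D z₀ u v w =
      extDerivWithin (pull m F₁ D₁) D₁ z₀ ![u, v, w] := fun u v w => by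
    rw [extDerivWithin_pull hc.smooth hF₁s hDu hz₁ (hDc hz₁), pull_three, hF₀, hT₀, hT₀, hT₀]
    rfl
  have hA₁ : ∀ v, pull η F₁ D₁ z₀ ![v] = 0 := fun v => by
    rw [pull_one, hF₀, hT₀, map_sub, hc.connection.oneForm_fundT, sub_self]
  refine ⟨?_, by rw [hVeq]; exact hc.derT_extDerivWithin_eq_zero hF₁s hDu hDc hz₁ hA₁ u v w⟩
  -- the derivatives of `F₁^* m = h⁻¹ ▷ F^* m` at `z₀`
  have hder : ∀ v w x, fderivWithin ℝ (fun z => pull m F₁ D₁ z ![v, w]) D₁ z₀ x =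
      fderivWithin ℝ (fun z => pull m F D z ![v, w]) D z₀ x +
        actDer 𝔤 G 𝔢 E (pull η F D z₀ ![x]) (pull m F D z₀ ![v, w]) := fun v w x => by
    have e1 := ((hhl.mono (subset_univ D₁)).inv).hasFDerivWithinAt_actT (𝔢 := 𝔢) (E := E) hd
    have e2 : HasFDerivWithinAt (fun z => pull m F D z ![v, w])
        (fderivWithin ℝ (fun z => pull m F D z ![v, w]) D z₀) D₁ z₀ :=
      (((contDiffOn_pull_apply hc.smooth hF hD ![v, w]).differentiableOn (by simp) z₀
        hz₀).hasFDerivWithinAt).mono inter_subset_left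
    have e3 := (e1.clm_apply e2).congr' (hμ₁ v w) hz₁
    rw [e3.fderivWithin (hDu z₀ hz₁)]
    simp [h1, actT_one, adT_one, hA, pull_one]
  rw [hVeq, extDerivWithin_two_apply
    ((contDiffOn_pull hc.smooth hF₁s hDu).differentiableOn (by simp) z₀ hz₁) (hDu z₀ hz₁),
    hder, hder, hder]

end Gauge

/-! ### Calculus on the unit cube -/
section Cube

/-- The unit cube, with coordinates `(t, s, x)`. -/
def cube : Set (ℝ × ℝ × ℝ) := Icc (0 : ℝ) 1 ×ˢ Icc (0 : ℝ) 1 ×ˢ Icc (0 : ℝ) 1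

/-- The coordinate vector `∂/∂t`. -/
def et : ℝ × ℝ × ℝ := (1, 0, 0)

/-- The coordinate vector `∂/∂s`. -/
def es : ℝ × ℝ × ℝ := (0, 1, 0)

/-- The coordinate vector `∂/∂x`. -/
def ex : ℝ × ℝ × ℝ := (0, 0, 1)

theorem mem_cube {t s x : ℝ} (ht : t ∈ Icc (0 : ℝ) 1) (hs : s ∈ Icc (0 : ℝ) 1)
    (hx : x ∈ Icc (0 : ℝ) 1) : (t, s, x) ∈ cube := ⟨ht, hs, hx⟩

theorem zero_mem_I : (0 : ℝ) ∈ Icc (0 : ℝ) 1 := left_mem_Icc.2 zero_le_one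

theorem one_mem_I : (1 : ℝ) ∈ Icc (0 : ℝ) 1 := right_mem_Icc.2 zero_le_one

theorem convex_square : Convex ℝ (Icc (0 : ℝ) 1 ×ˢ Icc (0 : ℝ) 1) :=
  (convex_Icc 0 1).prod (convex_Icc 0 1)

theorem isCompact_square : IsCompact (Icc (0 : ℝ) 1 ×ˢ Icc (0 : ℝ) 1) :=
  isCompact_Icc.prod isCompact_Icc

theorem interior_I_nonempty : (interior (Icc (0 : ℝ) 1)).Nonempty := by
  rw [interior_Icc]; exact nonempty_Ioo.2 zero_lt_one

theorem interior_square_nonempty : (interior (Icc (0 : ℝ) 1 ×ˢ Icc (0 : ℝ) 1)).Nonempty := by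
  rw [interior_prod_eq]; exact interior_I_nonempty.prod interior_I_nonempty

theorem uniqueDiffOn_cube : UniqueDiffOn ℝ cube :=
  uniqueDiffOn_Icc_prod zero_lt_one convex_square interior_square_nonempty

theorem uniqueDiffOn_I : UniqueDiffOn ℝ (Icc (0 : ℝ) 1) := uniqueDiffOn_Icc zero_lt_one

theorem cube_subset_closure : cube ⊆ closure (interior cube) := by
  rw [cube, interior_prod_eq, interior_prod_eq, interior_Icc, closure_prod_eq, closure_prod_eq,
    closure_Ioo zero_ne_one]

theorem hasFDerivWithinAt_line_t (t s x : ℝ) (D : Set ℝ) :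
    HasFDerivWithinAt (fun t' : ℝ => (t', s, x)) ((1 : ℝ →L[ℝ] ℝ).smulRight et) D t := by
  refine (((hasFDerivAt_id t).prodMk ((hasFDerivAt_const s t).prodMk
    (hasFDerivAt_const x t))).congr_fderiv ?_).hasFDerivWithinAt
  ext <;> simp [et]

theorem hasFDerivWithinAt_line_s (t s x : ℝ) (D : Set ℝ) :
    HasFDerivWithinAt (fun s' : ℝ => (t, s', x)) ((1 : ℝ →L[ℝ] ℝ).smulRight es) D s := by
  refine (((hasFDerivAt_const t s).prodMk ((hasFDerivAt_id s).prodMk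
    (hasFDerivAt_const x s))).congr_fderiv ?_).hasFDerivWithinAt
  ext <;> simp [es]

theorem hasFDerivWithinAt_line_x (t s x : ℝ) (D : Set ℝ) :
    HasFDerivWithinAt (fun x' : ℝ => (t, s, x')) ((1 : ℝ →L[ℝ] ℝ).smulRight ex) D x := by
  refine (((hasFDerivAt_const t x).prodMk ((hasFDerivAt_const s x).prodMk
    (hasFDerivAt_id x))).congr_fderiv ?_).hasFDerivWithinAt
  ext <;> simp [ex]

section

variable {F : Type*} [NormedAddCommGroup F] [NormedSpace ℝ F]
  {N : Type*} [TopologicalSpace N] [ChartedSpace F N] {f : ℝ × ℝ × ℝ → N} {t s x : ℝ}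
  {f' : ℝ × ℝ × ℝ →L[ℝ] F}

theorem HasTDeriv.line_t (hf : HasTDeriv f cube (t, s, x) f') (hs : s ∈ Icc (0 : ℝ) 1)
    (hx : x ∈ Icc (0 : ℝ) 1) : HasTDeriv (fun t' => f (t', s, x)) (Icc (0 : ℝ) 1) t
      ((1 : ℝ →L[ℝ] ℝ).smulRight (f' et)) :=
  (HasTDeriv.comp_hasFDerivWithinAt (φ := fun t' : ℝ => (t', s, x)) hf
    (hasFDerivWithinAt_line_t t s x _) fun _ ht => mem_cube ht hs hx).congr_deriv (by ext; simp)

theorem HasTDeriv.line_s (hf : HasTDeriv f cube (t, s, x) f') (ht : t ∈ Icc (0 : ℝ) 1)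
    (hx : x ∈ Icc (0 : ℝ) 1) : HasTDeriv (fun s' => f (t, s', x)) (Icc (0 : ℝ) 1) s
      ((1 : ℝ →L[ℝ] ℝ).smulRight (f' es)) :=
  (HasTDeriv.comp_hasFDerivWithinAt (φ := fun s' : ℝ => (t, s', x)) hf
    (hasFDerivWithinAt_line_s t s x _) fun _ hs => mem_cube ht hs hx).congr_deriv (by ext; simp)

theorem HasTDeriv.line_x (hf : HasTDeriv f cube (t, s, x) f') (ht : t ∈ Icc (0 : ℝ) 1)
    (hs : s ∈ Icc (0 : ℝ) 1) : HasTDeriv (fun x' => f (t, s, x')) (Icc (0 : ℝ) 1) x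
      ((1 : ℝ →L[ℝ] ℝ).smulRight (f' ex)) :=
  (HasTDeriv.comp_hasFDerivWithinAt (φ := fun x' : ℝ => (t, s, x')) hf
    (hasFDerivWithinAt_line_x t s x _) fun _ hx => mem_cube ht hs hx).congr_deriv (by ext; simp)

end

section

variable {V : Type*} [NormedAddCommGroup V] [NormedSpace ℝ V] {f : ℝ × ℝ × ℝ → V} {t s x : ℝ}

theorem ContDiffOn.hasDerivWithinAt_t (hf : ContDiffOn ℝ ∞ f cube) (ht : t ∈ Icc (0 : ℝ) 1)
    (hs : s ∈ Icc (0 : ℝ) 1) (hx : x ∈ Icc (0 : ℝ) 1) :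
    HasDerivWithinAt (fun t' => f (t', s, x)) (fderivWithin ℝ f cube (t, s, x) et)
      (Icc (0 : ℝ) 1) t := by
  have h := (hf.differentiableOn (by simp) _ (mem_cube ht hs hx)).hasFDerivWithinAt
  have := HasTDeriv.line_t (hasTDeriv_iff_hasFDerivWithinAt.2 h) hs hx
  rw [hasTDeriv_iff_hasFDerivWithinAt] at this
  simpa using this.hasDerivWithinAt

theorem ContDiffOn.hasDerivWithinAt_s (hf : ContDiffOn ℝ ∞ f cube) (ht : t ∈ Icc (0 : ℝ) 1)
    (hs : s ∈ Icc (0 : ℝ) 1) (hx : x ∈ Icc (0 : ℝ) 1) :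
    HasDerivWithinAt (fun s' => f (t, s', x)) (fderivWithin ℝ f cube (t, s, x) es)
      (Icc (0 : ℝ) 1) s := by
  have h := (hf.differentiableOn (by simp) _ (mem_cube ht hs hx)).hasFDerivWithinAt
  have := HasTDeriv.line_s (hasTDeriv_iff_hasFDerivWithinAt.2 h) ht hx
  rw [hasTDeriv_iff_hasFDerivWithinAt] at this
  simpa using this.hasDerivWithinAt

theorem ContDiffOn.hasDerivWithinAt_x (hf : ContDiffOn ℝ ∞ f cube) (ht : t ∈ Icc (0 : ℝ) 1)
    (hs : s ∈ Icc (0 : ℝ) 1) (hx : x ∈ Icc (0 : ℝ) 1) :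
    HasDerivWithinAt (fun x' => f (t, s, x')) (fderivWithin ℝ f cube (t, s, x) ex)
      (Icc (0 : ℝ) 1) x := by
  have h := (hf.differentiableOn (by simp) _ (mem_cube ht hs hx)).hasFDerivWithinAt
  have := HasTDeriv.line_x (hasTDeriv_iff_hasFDerivWithinAt.2 h) ht hs
  rw [hasTDeriv_iff_hasFDerivWithinAt] at this
  simpa using this.hasDerivWithinAt

end

end Cube

/-! ### The lift of a cube -/
section CubeLift

variable {𝔤 : Type*} [NormedAddCommGroup 𝔤] [NormedSpace ℝ 𝔤]
  {G : Type*} [TopologicalSpace G] [ChartedSpace 𝔤 G] [Group G]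
  {𝔢 : Type*} [NormedAddCommGroup 𝔢] [NormedSpace ℝ 𝔢]
  {E : Type*} [TopologicalSpace E] [ChartedSpace 𝔢 E] [Group E]
  {EM : Type*} [NormedAddCommGroup EM] [NormedSpace ℝ EM]
  {M : Type*} [TopologicalSpace M] [ChartedSpace EM M]
  {EP : Type*} [NormedAddCommGroup EP] [NormedSpace ℝ EP]
  {P : Type*} [TopologicalSpace P] [ChartedSpace EP P]
  [MulAction Gᵐᵒᵖ P] [MulDistribMulAction G E] {d : E →* G}
  [LieGroup 𝓘(ℝ, 𝔤) ∞ G] [LieGroup 𝓘(ℝ, 𝔢) ∞ E] [IsManifold 𝓘(ℝ, EP) ∞ P]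
  [IsManifold 𝓘(ℝ, EM) ∞ M]
  {π : P → M} {η : PreForm EP P 1 𝔤} {m : PreForm EP P 2 𝔢} {J : ℝ × ℝ × ℝ → M} {u : P}
  {F : ℝ × ℝ × ℝ → P} {t s x : ℝ}

/-- `F` is a lift of the cube `J` starting at `u` which is horizontal in the direction of `t`, on
the face `t = 0` also in the direction of `s`, and on the edge `t = s = 0` in the direction of
`x`. -/
structure IsCubeLift (π : P → M) (η : PreForm EP P 1 𝔤) (J : ℝ × ℝ × ℝ → M) (u : P)
    (F : ℝ × ℝ × ℝ → P) : Prop where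
  smooth : ContMDiffOn 𝓘(ℝ, ℝ × ℝ × ℝ) 𝓘(ℝ, EP) ∞ F cube
  lies_over : ∀ z ∈ cube, π (F z) = J z
  horizontal_t : ∀ s ∈ Icc (0 : ℝ) 1, ∀ x ∈ Icc (0 : ℝ) 1,
    IsHorizontal η (fun t => F (t, s, x)) (Icc (0 : ℝ) 1)
  horizontal_s : ∀ x ∈ Icc (0 : ℝ) 1, IsHorizontal η (fun s => F (0, s, x)) (Icc (0 : ℝ) 1)
  horizontal_x : IsHorizontal η (fun x => F (0, 0, x)) (Icc (0 : ℝ) 1)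
  start : F (0, 0, 0) = u

/-- A lift of the cube exists: the edge `t = s = 0` is lifted in the direction of `x`, then the face
`t = 0` in the direction of `s`, and then the cube in the direction of `t`. -/
theorem exists_isCubeLift [FiniteDimensional ℝ 𝔤] (hη : IsConnectionForm (G := G) η)
    (hπ : IsPrincipalBundle (𝔤 := 𝔤) (EM := EM) (EP := EP) G π)
    (hJ : ContMDiffOn 𝓘(ℝ, ℝ × ℝ × ℝ) 𝓘(ℝ, EM) ∞ J cube) (hu : π u = J (0, 0, 0)) :
    ∃ F, IsCubeLift π η J u F := by
  have hm1 : ContMDiff 𝓘(ℝ, ℝ × ℝ) 𝓘(ℝ, ℝ × ℝ × ℝ) ∞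
      (fun z : ℝ × ℝ => ((0 : ℝ), (0 : ℝ), z.1)) := by
    rw [contMDiff_iff_contDiff]; fun_prop
  have hm2 : ContMDiff 𝓘(ℝ, ℝ × ℝ) 𝓘(ℝ, ℝ × ℝ × ℝ) ∞ (fun z : ℝ × ℝ => ((0 : ℝ), z.1, z.2)) := by
    rw [contMDiff_iff_contDiff]; fun_prop
  -- the edge `t = s = 0`, with a dummy parameter
  obtain ⟨F₁, hF₁, hF₁0⟩ := exists_isHorFamily hη hπ zero_lt_one isCompact_Icc (convex_Icc 0 1)
    interior_I_nonempty (J := fun z : ℝ × ℝ => J (0, 0, z.1)) (p := fun _ => u)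
    (hJ.comp hm1.contMDiffOn fun z hz => mem_cube zero_mem_I zero_mem_I hz.1)
    contMDiffOn_const fun y _ => hu
  have hm3 : ContMDiff 𝓘(ℝ, ℝ) 𝓘(ℝ, ℝ × ℝ) ∞ (fun x : ℝ => (x, (0 : ℝ))) := by
    rw [contMDiff_iff_contDiff]; fun_prop
  obtain ⟨F₂, hF₂, hF₂0⟩ := exists_isHorFamily hη hπ zero_lt_one isCompact_Icc (convex_Icc 0 1)
    interior_I_nonempty (J := fun z : ℝ × ℝ => J (0, z.1, z.2)) (p := fun x => F₁ (x, 0))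
    (hJ.comp hm2.contMDiffOn fun z hz => mem_cube zero_mem_I hz.1 hz.2)
    (hF₁.smooth.comp hm3.contMDiffOn fun x hx => ⟨hx, zero_mem_I⟩)
    fun x hx => hF₁.lies_over (x, 0) ⟨hx, zero_mem_I⟩
  obtain ⟨F, hF, hF0⟩ := exists_isHorFamily hη hπ zero_lt_one isCompact_square convex_square
    interior_square_nonempty (J := J) (p := F₂) hJ hF₂.smooth
    fun z hz => hF₂.lies_over z hz
  refine ⟨F, hF.smooth, hF.lies_over, fun s hs x hx => hF.horizontal (s, x) ⟨hs, hx⟩,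
    fun x hx => (hF₂.horizontal x hx).congr fun s hs => hF0 (s, x) ⟨hs, hx⟩,
    (hF₁.horizontal 0 zero_mem_I).congr fun x hx => ?_, ?_⟩
  · exact (hF0 (0, x) ⟨zero_mem_I, hx⟩).trans (hF₂0 x hx)
  · exact (hF0 (0, 0) ⟨zero_mem_I, zero_mem_I⟩).trans ((hF₂0 0 zero_mem_I).trans
      (hF₁0 0 zero_mem_I))

theorem IsCubeLift.basePt_eq (hF : IsCubeLift π η J u F) (hη : IsConnectionForm (G := G) η)
    (hπ : IsPrincipalBundle (𝔤 := 𝔤) (EM := EM) (EP := EP) G π) (hx : x ∈ Icc (0 : ℝ) 1) :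
    basePt (EM := EM) π η J u x = F (0, 0, x) :=
  hF.horizontal_x.parTransport_eq hη hπ hF.start
    (fun _ hx' => hF.lies_over _ (mem_cube zero_mem_I zero_mem_I hx')) hx

theorem IsCubeLift.parTransport_left (hF : IsCubeLift π η J u F) (hη : IsConnectionForm (G := G) η)
    (hπ : IsPrincipalBundle (𝔤 := 𝔤) (EM := EM) (EP := EP) G π) (hs : s ∈ Icc (0 : ℝ) 1)
    (hx : x ∈ Icc (0 : ℝ) 1) :
    parTransport (EM := EM) π η (fun s' => slice J x 0 s') s (basePt (EM := EM) π η J u x) =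
      F (0, s, x) :=
  (hF.horizontal_s x hx).parTransport_eq hη hπ (hF.basePt_eq hη hπ hx).symm
    (fun _ hs' => hF.lies_over _ (mem_cube zero_mem_I hs' hx)) hs

theorem IsCubeLift.parTransport_t (hF : IsCubeLift π η J u F) (hη : IsConnectionForm (G := G) η)
    (hπ : IsPrincipalBundle (𝔤 := 𝔤) (EM := EM) (EP := EP) G π) (ht : t ∈ Icc (0 : ℝ) 1)
    (hs : s ∈ Icc (0 : ℝ) 1) (hx : x ∈ Icc (0 : ℝ) 1) :
    parTransport (EM := EM) π η (fun t' => slice J x t' s) t (F (0, s, x)) = F (t, s, x) :=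
  (hF.horizontal_t s hs x hx).parTransport_eq hη hπ rfl
    (fun _ ht' => hF.lies_over _ (mem_cube ht' hs hx)) ht

theorem IsCubeLift.squareLift_eq (hF : IsCubeLift π η J u F) (hη : IsConnectionForm (G := G) η)
    (hπ : IsPrincipalBundle (𝔤 := 𝔤) (EM := EM) (EP := EP) G π) (ht : t ∈ Icc (0 : ℝ) 1)
    (hs : s ∈ Icc (0 : ℝ) 1) (hx : x ∈ Icc (0 : ℝ) 1) :
    squareLift (EM := EM) π η (slice J x) (basePt (EM := EM) π η J u x) t s = F (t, s, x) := by
  rw [squareLift, hF.parTransport_left hη hπ hs hx, hF.parTransport_t hη hπ ht hs hx]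

theorem IsCubeLift.hasTDeriv (hF : IsCubeLift π η J u F) {z : ℝ × ℝ × ℝ} (hz : z ∈ cube) :
    HasTDeriv F cube z (tmapWithin EP F cube z) :=
  (hF.smooth z hz).hasTDeriv (by simp)

theorem IsCubeLift.hLift_vel_t (hF : IsCubeLift π η J u F) (hη : IsConnectionForm (G := G) η)
    (hπ : IsPrincipalBundle (𝔤 := 𝔤) (EM := EM) (EP := EP) G π) (ht : t ∈ Icc (0 : ℝ) 1)
    (hs : s ∈ Icc (0 : ℝ) 1) (hx : x ∈ Icc (0 : ℝ) 1) :
    hLift π η (F (t, s, x)) (vel EM (fun t' => J (t', s, x)) t) =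
      tmapWithin EP F cube (t, s, x) et - fundT 𝔤 G EP (F (t, s, x))
        (oneForm η (F (t, s, x)) (tmapWithin EP F cube (t, s, x) et)) :=
  hη.hLift_vel hπ (c := fun t' => F (t', s, x)) ((hF.hasTDeriv (mem_cube ht hs hx)).line_t hs hx)
    (fun _ ht' => hF.lies_over _ (mem_cube ht' hs hx)) ht

theorem IsCubeLift.hLift_vel_s (hF : IsCubeLift π η J u F) (hη : IsConnectionForm (G := G) η)
    (hπ : IsPrincipalBundle (𝔤 := 𝔤) (EM := EM) (EP := EP) G π) (ht : t ∈ Icc (0 : ℝ) 1)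
    (hs : s ∈ Icc (0 : ℝ) 1) (hx : x ∈ Icc (0 : ℝ) 1) :
    hLift π η (F (t, s, x)) (vel EM (fun s' => J (t, s', x)) s) =
      tmapWithin EP F cube (t, s, x) es - fundT 𝔤 G EP (F (t, s, x))
        (oneForm η (F (t, s, x)) (tmapWithin EP F cube (t, s, x) es)) :=
  hη.hLift_vel hπ (c := fun s' => F (t, s', x)) ((hF.hasTDeriv (mem_cube ht hs hx)).line_s ht hx)
    (fun _ hs' => hF.lies_over _ (mem_cube ht hs' hx)) hs

theorem IsCubeLift.hLift_vel_x (hF : IsCubeLift π η J u F) (hη : IsConnectionForm (G := G) η)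
    (hπ : IsPrincipalBundle (𝔤 := 𝔤) (EM := EM) (EP := EP) G π) (ht : t ∈ Icc (0 : ℝ) 1)
    (hs : s ∈ Icc (0 : ℝ) 1) (hx : x ∈ Icc (0 : ℝ) 1) :
    hLift π η (F (t, s, x)) (vel EM (fun x' => J (t, s, x')) x) =
      tmapWithin EP F cube (t, s, x) ex - fundT 𝔤 G EP (F (t, s, x))
        (oneForm η (F (t, s, x)) (tmapWithin EP F cube (t, s, x) ex)) :=
  hη.hLift_vel hπ (c := fun x' => F (t, s, x')) ((hF.hasTDeriv (mem_cube ht hs hx)).line_x ht hs)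
    (fun _ hx' => hF.lies_over _ (mem_cube ht hs hx')) hx

theorem IsHorizontal.oneForm_eq_zero {h : ℝ → P} {D : Set ℝ} {v : EP} (hh : IsHorizontal η h D)
    (hD : UniqueDiffOn ℝ D) (ht : t ∈ D) (hv : HasTDeriv h D t ((1 : ℝ →L[ℝ] ℝ).smulRight v)) :
    oneForm η (h t) v = 0 := by
  obtain ⟨w, hw, hw'⟩ := hh t ht
  have := DFunLike.congr_fun (hv.unique hw (hD t ht)) 1
  simp only [ContinuousLinearMap.smulRight_apply, one_apply_eq_self, one_smul] at this
  rwa [this]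

theorem IsCubeLift.pull_t (hF : IsCubeLift π η J u F) {z : ℝ × ℝ × ℝ} (hz : z ∈ cube) :
    pull η F cube z ![et] = 0 := by
  obtain ⟨t, s, x⟩ := z
  rw [pull_one]
  exact (hF.horizontal_t s hz.2.1 x hz.2.2).oneForm_eq_zero uniqueDiffOn_I hz.1
    ((hF.hasTDeriv hz).line_t hz.2.1 hz.2.2)

theorem IsCubeLift.pull_s (hF : IsCubeLift π η J u F) (hs : s ∈ Icc (0 : ℝ) 1)
    (hx : x ∈ Icc (0 : ℝ) 1) : pull η F cube (0, s, x) ![es] = 0 := by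
  rw [pull_one]
  exact (hF.horizontal_s x hx).oneForm_eq_zero uniqueDiffOn_I hs
    ((hF.hasTDeriv (mem_cube zero_mem_I hs hx)).line_s zero_mem_I hx)

theorem IsCubeLift.pull_x (hF : IsCubeLift π η J u F)
    (hx : x ∈ Icc (0 : ℝ) 1) : pull η F cube (0, 0, x) ![ex] = 0 := by
  rw [pull_one]
  exact hF.horizontal_x.oneForm_eq_zero uniqueDiffOn_I hx
    ((hF.hasTDeriv (mem_cube zero_mem_I zero_mem_I hx)).line_x zero_mem_I zero_mem_I)

theorem IsCubeLift.surfIntegrand_eq (hF : IsCubeLift π η J u F)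
    (hc : IsCategoricalConnection d η m)
    (hπ : IsPrincipalBundle (𝔤 := 𝔤) (EM := EM) (EP := EP) G π) (ht : t ∈ Icc (0 : ℝ) 1)
    (hs : s ∈ Icc (0 : ℝ) 1) (hx : x ∈ Icc (0 : ℝ) 1) :
    surfIntegrand (EM := EM) π η m (slice J x) (basePt (EM := EM) π η J u x) t s =
      pull m F cube (t, s, x) ![et, es] := by
  have h : surfIntegrand (EM := EM) π η m (slice J x) (basePt (EM := EM) π η J u x) t s =
      formAt m (squareLift (EM := EM) π η (slice J x) (basePt (EM := EM) π η J u x) t s)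
        ![hLift π η (squareLift (EM := EM) π η (slice J x) (basePt (EM := EM) π η J u x) t s)
            (vel EM (fun t' => J (t', s, x)) t),
          hLift π η (squareLift (EM := EM) π η (slice J x) (basePt (EM := EM) π η J u x) t s)
            (vel EM (fun s' => J (t, s', x)) s)] := rfl
  rw [h, hF.squareLift_eq hc.connection hπ ht hs hx, hF.hLift_vel_t hc.connection hπ ht hs hx,
    hF.hLift_vel_s hc.connection hπ ht hs hx, hc.formAt_horProj, pull_two]

theorem twoCurvature_eq (p : P) (v₁ v₂ v₃ : EP) :
    twoCurvature G η m p v₁ v₂ v₃ = formAt (extD m) p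
      ![v₁ - fundT 𝔤 G EP p (oneForm η p v₁), v₂ - fundT 𝔤 G EP p (oneForm η p v₂),
        v₃ - fundT 𝔤 G EP p (oneForm η p v₃)] := by
  rw [oneForm_apply, oneForm_apply, oneForm_apply]; rfl

theorem IsCubeLift.volIntegrand_eq (hF : IsCubeLift π η J u F)
    (hc : IsCategoricalConnection d η m)
    (hπ : IsPrincipalBundle (𝔤 := 𝔤) (EM := EM) (EP := EP) G π) (ht : t ∈ Icc (0 : ℝ) 1)
    (hs : s ∈ Icc (0 : ℝ) 1) (hx : x ∈ Icc (0 : ℝ) 1) :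
    volIntegrand (EM := EM) G π η m J u x t s = pullHor G η m F cube (t, s, x) ex et es := by
  have h : volIntegrand (EM := EM) G π η m J u x t s =
      twoCurvature G η m (squareLift (EM := EM) π η (slice J x) (basePt (EM := EM) π η J u x) t s)
        (hLift π η (squareLift (EM := EM) π η (slice J x) (basePt (EM := EM) π η J u x) t s)
          (vel EM (fun x' => J (t, s, x')) x) : EP)
        (hLift π η (squareLift (EM := EM) π η (slice J x) (basePt (EM := EM) π η J u x) t s)
          (vel EM (fun t' => J (t', s, x)) t) : EP)
        (hLift π η (squareLift (EM := EM) π η (slice J x) (basePt (EM := EM) π η J u x) t s)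
          (vel EM (fun s' => J (t, s', x)) s) : EP) := rfl
  rw [h, twoCurvature_eq, hF.squareLift_eq hc.connection hπ ht hs hx,
    hF.hLift_vel_t hc.connection hπ ht hs hx,
    hF.hLift_vel_s hc.connection hπ ht hs hx, hF.hLift_vel_x hc.connection hπ ht hs hx, pullHor]
  simp only [map_sub, hc.connection.oneForm_fundT, sub_self, map_zero, sub_zero]

end CubeLift

/-! ### Primitives on the cube -/
section CubeIntegrals

variable {V W : Type*} [NormedAddCommGroup V] [NormedSpace ℝ V] [CompleteSpace V]
  [NormedAddCommGroup W] [NormedSpace ℝ W] [CompleteSpace W]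

theorem integral_eq_sub_of_hasDerivWithinAt_I {f f' : ℝ → V} {t : ℝ} (ht : t ∈ Icc (0 : ℝ) 1)
    (hf : ∀ t ∈ Icc (0 : ℝ) 1, HasDerivWithinAt f (f' t) (Icc (0 : ℝ) 1) t)
    (hf' : ContinuousOn f' (Icc (0 : ℝ) 1)) : ∫ τ in (0 : ℝ)..t, f' τ = f t - f 0 := by
  refine intervalIntegral.integral_eq_sub_of_hasDerivAt_of_le ht.1
    (fun τ hτ => ((hf τ ⟨hτ.1, hτ.2.trans ht.2⟩).continuousWithinAt).mono
      (Icc_subset_Icc_right ht.2))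
    (fun τ hτ => (hf τ ⟨hτ.1.le, (hτ.2.trans_le ht.2).le⟩).hasDerivAt
      (Icc_mem_nhds hτ.1 (hτ.2.trans_le ht.2))) ?_
  exact (hf'.mono (uIcc_subset_Icc zero_mem_I ht)).intervalIntegrable

theorem intervalIntegrable_I {f : ℝ → V} (hf : ContinuousOn f (Icc (0 : ℝ) 1)) {a b : ℝ}
    (ha : a ∈ Icc (0 : ℝ) 1) (hb : b ∈ Icc (0 : ℝ) 1) : IntervalIntegrable f volume a b :=
  (hf.mono (uIcc_subset_Icc ha hb)).intervalIntegrable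

/-- The primitive in the direction of `t` of a function on the cube which vanishes at `t = 0`. -/
def prim (f : ℝ × ℝ × ℝ → V) (z : ℝ × ℝ × ℝ) : V := ∫ τ in (0 : ℝ)..z.1, f (τ, z.2)

theorem prim_zero (f : ℝ × ℝ × ℝ → V) (y : ℝ × ℝ) : prim f (0, y) = 0 := by
  simp [prim]

theorem contDiffOn_prim {f : ℝ × ℝ × ℝ → V} (hf : ContDiffOn ℝ ∞ f cube) :
    ContDiffOn ℝ ∞ (prim f) cube :=
  contDiffOn_parametric_primitive zero_lt_one isCompact_square convex_square
    interior_square_nonempty hf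

theorem continuousOn_prim {f : ℝ × ℝ × ℝ → V} (hf : ContinuousOn f cube) :
    ContinuousOn (prim f) cube :=
  continuousOn_parametric_primitive isCompact_square hf

theorem hasDerivWithinAt_prim {f : ℝ × ℝ × ℝ → V} (hf : ContinuousOn f cube) {t : ℝ} {y : ℝ × ℝ}
    (ht : t ∈ Icc (0 : ℝ) 1) (hy : y ∈ Icc (0 : ℝ) 1 ×ˢ Icc (0 : ℝ) 1) :
    HasDerivWithinAt (fun t => prim f (t, y)) (f (t, y)) (Icc (0 : ℝ) 1) t := by
  have h1 : ContinuousOn (fun τ => f (τ, y)) (Icc (0 : ℝ) 1) := hf.slice_fst hy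
  have : Fact (t ∈ Icc (0 : ℝ) 1) := ⟨ht⟩
  exact intervalIntegral.integral_hasDerivWithinAt_right
    (intervalIntegrable_I h1 zero_mem_I ht)
    (h1.stronglyMeasurableAtFilter_nhdsWithin measurableSet_Icc t) (h1 t ht)

theorem continuousOn_fderivWithin_apply {f : ℝ × ℝ × ℝ → V} (hf : ContDiffOn ℝ ∞ f cube)
    (v : ℝ × ℝ × ℝ) : ContinuousOn (fun z => fderivWithin ℝ f cube z v) cube :=
  (hf.continuousOn_fderivWithin uniqueDiffOn_cube (by simp)).clm_apply continuousOn_const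

/-- Differentiation under the integral sign. -/
theorem fderivWithin_prim {f : ℝ × ℝ × ℝ → V} (hf : ContDiffOn ℝ ∞ f cube) {t : ℝ} {y : ℝ × ℝ}
    (ht : t ∈ Icc (0 : ℝ) 1) (hy : y ∈ Icc (0 : ℝ) 1 ×ˢ Icc (0 : ℝ) 1) (w : ℝ × ℝ) :
    fderivWithin ℝ (prim f) cube (t, y) (0, w) =
      prim (fun z => fderivWithin ℝ f cube z (0, w)) (t, y) := by
  have hc : ContinuousOn (fun z => (fderivWithin ℝ f cube z).comp
      (ContinuousLinearMap.inr ℝ ℝ (ℝ × ℝ))) cube :=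
    (hf.continuousOn_fderivWithin uniqueDiffOn_cube (by simp)).clm_comp continuousOn_const
  have h := hasFDerivWithinAt_parametric_primitive isCompact_square convex_square hf.continuousOn
    hc (fun τ hτ y hy => HasFDerivWithinAt.slice_snd
      ((hf.differentiableOn (by simp) (τ, y) ⟨hτ, hy⟩).hasFDerivWithinAt) hτ) ht hy
  have h2 : fderivWithin ℝ (prim f) cube (t, y) = _ := h.fderivWithin (uniqueDiffOn_cube _ ⟨ht, hy⟩)
  rw [h2]
  simp only [add_apply, ContinuousLinearMap.smulRight_apply, ContinuousLinearMap.coe_fst',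
    zero_smul, zero_add, ContinuousLinearMap.comp_apply, ContinuousLinearMap.coe_snd', prim]
  exact ContinuousLinearMap.intervalIntegral_apply
    (intervalIntegrable_I (hc.slice_fst hy) zero_mem_I ht) w

theorem map_prim (L : V →L[ℝ] W) {f : ℝ × ℝ × ℝ → V} (hf : ContinuousOn f cube) {t : ℝ} {y : ℝ × ℝ}
    (ht : t ∈ Icc (0 : ℝ) 1) (hy : y ∈ Icc (0 : ℝ) 1 ×ˢ Icc (0 : ℝ) 1) :
    L (prim f (t, y)) = prim (fun z => L (f z)) (t, y) :=
  (L.intervalIntegral_comp_comm (intervalIntegrable_I (hf.slice_fst hy) zero_mem_I ht)).symm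

theorem prim_fderivWithin {f : ℝ × ℝ × ℝ → V} (hf : ContDiffOn ℝ ∞ f cube) {t : ℝ} {y : ℝ × ℝ}
    (ht : t ∈ Icc (0 : ℝ) 1) (hy : y ∈ Icc (0 : ℝ) 1 ×ˢ Icc (0 : ℝ) 1) :
    prim (fun z => fderivWithin ℝ f cube z et) (t, y) = f (t, y) - f (0, y) :=
  integral_eq_sub_of_hasDerivWithinAt_I ht (f := fun t => f (t, y))
    (fun _ hτ => hf.hasDerivWithinAt_t hτ hy.1 hy.2)
    ((continuousOn_fderivWithin_apply hf et).slice_fst hy)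

end CubeIntegrals

/-! ### Integration of the 2-curvature over the cube -/
section Core

variable {𝔤 : Type*} [NormedAddCommGroup 𝔤] [NormedSpace ℝ 𝔤] [FiniteDimensional ℝ 𝔤]
  {G : Type*} [TopologicalSpace G] [ChartedSpace 𝔤 G] [Group G]
  {𝔢 : Type*} [NormedAddCommGroup 𝔢] [NormedSpace ℝ 𝔢] [FiniteDimensional ℝ 𝔢]
  {E : Type*} [TopologicalSpace E] [ChartedSpace 𝔢 E] [Group E]
  [MulDistribMulAction G E] {d : E →* G}
  [LieGroup 𝓘(ℝ, 𝔤) ∞ G] [LieGroup 𝓘(ℝ, 𝔢) ∞ E]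

theorem IsLogSol.hasDerivWithinAt_adT {e : ℝ → E} {K : ℝ → 𝔢} {a b : ℝ} (he : IsLogSol e K a b)
    {s : ℝ} (hs : s ∈ Icc a b) {β : ℝ → 𝔢} {β' : 𝔢} (hβ : HasDerivWithinAt β β' (Icc a b) s) :
    HasDerivWithinAt (fun s => adT 𝔢 (e s) (β s)) (adT 𝔢 (e s) (adDer 𝔢 E (K s) (β s) + β'))
      (Icc a b) s := by
  have h := (he s hs).hasFDerivWithinAt_adT.hasDerivWithinAt.clm_apply hβ
  refine h.congr_deriv ?_
  simp

theorem IsLogSol.continuousOn_adT {e : ℝ → E} {K : ℝ → 𝔢} {a b : ℝ} (he : IsLogSol e K a b) :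
    ContinuousOn (fun s => adT 𝔢 (e s)) (Icc a b) := fun s hs =>
  (he s hs).hasFDerivWithinAt_adT.continuousWithinAt

/-- Elements of `ker ∂` are central, hence fixed by the adjoint action of the identity
component. -/
theorem IsLogSol.adT_eq_self (hd : IsLieCrossedModule (𝔤 := 𝔤) (𝔢 := 𝔢) d) {e : ℝ → E}
    {K : ℝ → 𝔢} {a b : ℝ} (he : IsLogSol e K a b) (h1 : e a = 1) {v : 𝔢}
    (hv : (derT d : 𝔢 →L[ℝ] 𝔤) v = 0) {s : ℝ} (hs : s ∈ Icc a b) : adT 𝔢 (e s) v = v := by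
  have h0 : ∀ k : 𝔢, adDer 𝔢 E k v = 0 := fun k => by
    have h := DFunLike.congr_fun hd.actDer_derT v
    rw [ContinuousLinearMap.comp_apply, hv, map_zero] at h
    rw [adDer_antisymm, ← h, zero_apply, neg_zero]
  have hder : ∀ s ∈ Icc a b, HasDerivWithinAt (fun s => adT 𝔢 (e s) v) 0 (Icc a b) s :=
    fun s hs => (he.hasDerivWithinAt_adT hs (hasDerivWithinAt_const s _ v)).congr_deriv
      (by rw [h0, add_zero, map_zero])
  have := constant_of_has_deriv_right_zero (fun s hs => (hder s hs).continuousWithinAt)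
    (fun s hs => (hder s ⟨hs.1, hs.2.le⟩).mono_of_mem_nhdsWithin
      (Icc_mem_nhdsGE_of_mem hs)) s hs
  rw [this, h1, adT_one]; rfl

/-- The local data of a lifted cube: the components of the pulled back 2-form `m`, those of the
pulled back connection form in a gauge in which its component along `t` is zero, and the pulled back
2-curvature `V`, with the relations between them. -/
structure IsCubeData (d : E →* G) (μts μtx μsx : ℝ × ℝ × ℝ → 𝔢) (As Ax : ℝ × ℝ × ℝ → 𝔤)
    (V : ℝ × ℝ × ℝ → 𝔢) : Prop where
  smooth_ts : ContDiffOn ℝ ∞ μts cube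
  smooth_tx : ContDiffOn ℝ ∞ μtx cube
  smooth_sx : ContDiffOn ℝ ∞ μsx cube
  smooth_s : ContDiffOn ℝ ∞ As cube
  smooth_x : ContDiffOn ℝ ∞ Ax cube
  s_zero : ∀ s ∈ Icc (0 : ℝ) 1, ∀ x ∈ Icc (0 : ℝ) 1, As (0, s, x) = 0
  x_zero : ∀ x ∈ Icc (0 : ℝ) 1, Ax (0, 0, x) = 0
  fake_ts : ∀ z ∈ cube, (derT d : 𝔢 →L[ℝ] 𝔤) (μts z) = fderivWithin ℝ As cube z et
  fake_tx : ∀ z ∈ cube, (derT d : 𝔢 →L[ℝ] 𝔤) (μtx z) = fderivWithin ℝ Ax cube z et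
  fake_sx : ∀ s ∈ Icc (0 : ℝ) 1, ∀ x ∈ Icc (0 : ℝ) 1,
    (derT d : 𝔢 →L[ℝ] 𝔤) (μsx (0, s, x)) = fderivWithin ℝ Ax cube (0, s, x) es
  vol_eq : ∀ z ∈ cube, V z = fderivWithin ℝ μts cube z ex + actDer 𝔤 G 𝔢 E (Ax z) (μts z)
    + fderivWithin ℝ μsx cube z et
    - (fderivWithin ℝ μtx cube z es + actDer 𝔤 G 𝔢 E (As z) (μtx z))
  derT_vol : ∀ z ∈ cube, (derT d : 𝔢 →L[ℝ] 𝔤) (V z) = 0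

variable {μts μtx μsx : ℝ × ℝ × ℝ → 𝔢} {As Ax : ℝ × ℝ × ℝ → 𝔤} {V : ℝ × ℝ × ℝ → 𝔢} {t s x : ℝ}

theorem IsCubeData.continuousOn_vol (h : IsCubeData d μts μtx μsx As Ax V) :
    ContinuousOn V cube := by
  refine ContinuousOn.congr ?_ h.vol_eq
  have h1 := continuousOn_fderivWithin_apply h.smooth_ts ex
  have h2 := continuousOn_fderivWithin_apply h.smooth_sx et
  have h3 := continuousOn_fderivWithin_apply h.smooth_tx es
  have h4 := h.smooth_x.continuousOn
  have h5 := h.smooth_s.continuousOn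
  have h6 := h.smooth_ts.continuousOn
  have h7 := h.smooth_tx.continuousOn
  exact ((h1.add (((actDer 𝔤 G 𝔢 E).continuous.comp_continuousOn h4).clm_apply h6)).add h2).sub
    (h3.add (((actDer 𝔤 G 𝔢 E).continuous.comp_continuousOn h5).clm_apply h7))

/-- The fake curvature condition, integrated along `t`: `A_s = ∂ ∫₀ᵗ μ_ts`. -/
theorem IsCubeData.s_eq (h : IsCubeData d μts μtx μsx As Ax V) {z : ℝ × ℝ × ℝ} (hz : z ∈ cube) :
    As z = derT d (prim μts z) := by
  have : CompleteSpace 𝔤 := FiniteDimensional.complete ℝ 𝔤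
  have : CompleteSpace 𝔢 := FiniteDimensional.complete ℝ 𝔢
  obtain ⟨t, s, x⟩ := z
  have h1 := prim_fderivWithin h.smooth_s hz.1 hz.2
  rw [h.s_zero s hz.2.1 x hz.2.2, sub_zero] at h1
  rw [map_prim _ h.smooth_ts.continuousOn hz.1 hz.2, ← h1]
  exact intervalIntegral.integral_congr fun τ hτ =>
    (h.fake_ts (τ, s, x) ⟨uIcc_subset_Icc zero_mem_I hz.1 hτ, hz.2⟩).symm

/-- The integral of `m` along the left edge. -/
def leftInt (μsx : ℝ × ℝ × ℝ → 𝔢) (s x : ℝ) : 𝔢 := ∫ σ in (0 : ℝ)..s, μsx (0, σ, x)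

theorem IsCubeData.hasDerivWithinAt_leftInt (h : IsCubeData d μts μtx μsx As Ax V)
    (hs : s ∈ Icc (0 : ℝ) 1) (hx : x ∈ Icc (0 : ℝ) 1) :
    HasDerivWithinAt (fun s => leftInt μsx s x) (μsx (0, s, x)) (Icc (0 : ℝ) 1) s := by
  have : CompleteSpace 𝔢 := FiniteDimensional.complete ℝ 𝔢
  have h1 : ContinuousOn (fun s => μsx (0, s, x)) (Icc (0 : ℝ) 1) :=
    h.smooth_sx.continuousOn.comp (by fun_prop) fun σ hσ => mem_cube zero_mem_I hσ hx
  have : Fact (s ∈ Icc (0 : ℝ) 1) := ⟨hs⟩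
  exact intervalIntegral.integral_hasDerivWithinAt_right
    (intervalIntegrable_I h1 zero_mem_I hs)
    (h1.stronglyMeasurableAtFilter_nhdsWithin measurableSet_Icc s) (h1 s hs)

/-- The fake curvature condition, integrated along `s` on the face `t = 0` and then along `t`:
`A_x = ∂ (∫₀ᵗ μ_tx + ∫₀ˢ μ_sx(0, ·))`. -/
theorem IsCubeData.x_eq (h : IsCubeData d μts μtx μsx As Ax V) (ht : t ∈ Icc (0 : ℝ) 1)
    (hs : s ∈ Icc (0 : ℝ) 1) (hx : x ∈ Icc (0 : ℝ) 1) :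
    Ax (t, s, x) = derT d (prim μtx (t, s, x) + leftInt μsx s x) := by
  have : CompleteSpace 𝔤 := FiniteDimensional.complete ℝ 𝔤
  have : CompleteSpace 𝔢 := FiniteDimensional.complete ℝ 𝔢
  have h1 := prim_fderivWithin h.smooth_x (y := (s, x)) ht ⟨hs, hx⟩
  have h3 : ContinuousOn (fun s => μsx (0, s, x)) (Icc (0 : ℝ) 1) :=
    h.smooth_sx.continuousOn.comp (by fun_prop) fun σ hσ => mem_cube zero_mem_I hσ hx
  have h4 : ContinuousOn (fun s => fderivWithin ℝ Ax cube (0, s, x) es) (Icc (0 : ℝ) 1) :=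
    (continuousOn_fderivWithin_apply h.smooth_x es).comp (by fun_prop)
      fun σ hσ => mem_cube zero_mem_I hσ hx
  have h2 := integral_eq_sub_of_hasDerivWithinAt_I hs (f := fun s => Ax (0, s, x))
    (fun σ hσ => h.smooth_x.hasDerivWithinAt_s zero_mem_I hσ hx) h4
  simp only [h.x_zero x hx, sub_zero] at h2
  rw [map_add, map_prim _ h.smooth_tx.continuousOn ht ⟨hs, hx⟩, leftInt,
    ← ContinuousLinearMap.intervalIntegral_comp_comm _ (intervalIntegrable_I h3 zero_mem_I hs)]
  rw [eq_sub_iff_add_eq, ← h2] at h1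
  rw [← h1]
  congr 1
  · exact intervalIntegral.integral_congr fun τ hτ =>
      (h.fake_tx (τ, s, x) ⟨uIcc_subset_Icc zero_mem_I ht hτ, hs, hx⟩).symm
  · exact intervalIntegral.integral_congr fun σ hσ =>
      (h.fake_sx σ (uIcc_subset_Icc zero_mem_I hs hσ) x hx).symm

/-- The integral of the 2-curvature in the direction of `t`.  As `A_s` and `A_x` are in the image of
`∂`, they act on `𝔢` by brackets with their preimages, and the two terms that involve them add up to
the derivative along `t` of a bracket. -/
theorem IsCubeData.prim_vol (hd : IsLieCrossedModule (𝔤 := 𝔤) (𝔢 := 𝔢) d)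
    (h : IsCubeData d μts μtx μsx As Ax V)
    (hs : s ∈ Icc (0 : ℝ) 1) (hx : x ∈ Icc (0 : ℝ) 1) :
    prim V (1, s, x) = fderivWithin ℝ (prim μts) cube (1, s, x) ex
      + adDer 𝔢 E (prim μtx (1, s, x) + leftInt μsx s x) (prim μts (1, s, x))
      + (μsx (1, s, x) - μsx (0, s, x)) - fderivWithin ℝ (prim μtx) cube (1, s, x) es := by
  have : CompleteSpace 𝔢 := FiniteDimensional.complete ℝ 𝔢
  have hy : (s, x) ∈ Icc (0 : ℝ) 1 ×ˢ Icc (0 : ℝ) 1 := ⟨hs, hx⟩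
  set p : ℝ × ℝ × ℝ → 𝔢 := prim (fun z => fderivWithin ℝ μts cube z ex) with hp
  set q : ℝ × ℝ × ℝ → 𝔢 := prim (fun z => fderivWithin ℝ μtx cube z es) with hq
  have e1 : fderivWithin ℝ (prim μts) cube (1, s, x) ex = p (1, s, x) :=
    fderivWithin_prim h.smooth_ts one_mem_I hy (0, 1)
  have e2 : fderivWithin ℝ (prim μtx) cube (1, s, x) es = q (1, s, x) :=
    fderivWithin_prim h.smooth_tx one_mem_I hy (1, 0)
  have hder : ∀ t ∈ Icc (0 : ℝ) 1, HasDerivWithinAt (fun t => p (t, s, x)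
      + adDer 𝔢 E (prim μtx (t, s, x) + leftInt μsx s x) (prim μts (t, s, x))
      + μsx (t, s, x) - q (t, s, x)) (V (t, s, x)) (Icc (0 : ℝ) 1) t := by
    intro t ht
    have d1 := hasDerivWithinAt_prim (continuousOn_fderivWithin_apply h.smooth_ts ex) ht hy
    have d2 := hasDerivWithinAt_prim (continuousOn_fderivWithin_apply h.smooth_tx es) ht hy
    have d3 := hasDerivWithinAt_prim h.smooth_tx.continuousOn ht hy
    have d4 := hasDerivWithinAt_prim h.smooth_ts.continuousOn ht hy
    have d5 := h.smooth_sx.hasDerivWithinAt_t ht hs hx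
    have d6 := ((adDer 𝔢 E).hasFDerivAt.comp_hasDerivWithinAt t
      (d3.add_const (leftInt μsx s x))).clm_apply d4
    refine (((d1.add d6).add d5).sub d2).congr_deriv ?_
    rw [h.vol_eq _ (mem_cube ht hs hx), h.s_eq (mem_cube ht hs hx), h.x_eq ht hs hx]
    -- the Peiffer identity: `∂(a)` acts as the bracket with `a`
    have hh : ∀ a, actDer 𝔤 G 𝔢 E (derT d a) = adDer 𝔢 E a := fun a =>
      DFunLike.congr_fun hd.actDer_derT a
    rw [hh, hh, adDer_antisymm (prim μts (t, s, x))]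
    simp only [Function.comp_apply]
    abel
  have h0 := integral_eq_sub_of_hasDerivWithinAt_I one_mem_I hder (h.continuousOn_vol.slice_fst hy)
  have h1 : prim V (1, s, x) = ∫ t in (0 : ℝ)..1, V (t, s, x) := rfl
  rw [h1, h0, e1, e2]
  simp only [hp, hq, prim_zero, map_zero, add_zero, zero_add, sub_zero]
  abel

/-- The derivative of the categorical holonomy in terms of the data on the cube and its faces.  By
`IsCubeData.prim_vol` and with `K = ∫₀¹ μ_ts dt`, `β = ∫₀¹ μ_tx dt + ∫₀ˢ μ_sx(0, ·)`, one has
`∂ₓK = ∫₀¹ V dt - μ_sx(1, ·) + [K, β] + β'`.  The first term is fixed by `Ad(e)`, and the last two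
give the total derivative `(Ad(e) β)'`, whose integral only depends on the end points. -/
theorem IsCubeData.integral_adT (hd : IsLieCrossedModule (𝔤 := 𝔤) (𝔢 := 𝔢) d)
    (h : IsCubeData d μts μtx μsx As Ax V) (hx : x ∈ Icc (0 : ℝ) 1) {e : ℝ → E} (h1 : e 0 = 1)
    (he : IsLogSol e (fun s => prim μts (1, s, x)) 0 1) :
    adT 𝔢 (e 1)⁻¹ (∫ s in (0 : ℝ)..1,
        adT 𝔢 (e s) (fderivWithin ℝ (prim μts) cube (1, s, x) ex)) =
      (∫ s in (0 : ℝ)..1, ∫ t in (0 : ℝ)..1, V (t, s, x)) +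
        ((∫ s in (0 : ℝ)..1, μsx (0, s, x)) + (∫ t in (0 : ℝ)..1, μtx (t, 1, x))
          - (∫ s in (0 : ℝ)..1, adT 𝔢 ((e 1)⁻¹ * e s) (μsx (1, s, x)))
          - ∫ t in (0 : ℝ)..1, adT 𝔢 (e 1)⁻¹ (μtx (t, 0, x))) := by
  have : CompleteSpace 𝔢 := FiniteDimensional.complete ℝ 𝔢
  set β : ℝ → 𝔢 := fun s => prim μtx (1, s, x) + leftInt μsx s x with hβ
  set β' : ℝ → 𝔢 := fun s => fderivWithin ℝ (prim μtx) cube (1, s, x) es + μsx (0, s, x) with hβ'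
  set K : ℝ → 𝔢 := fun s => prim μts (1, s, x) with hK
  have hdβ : ∀ s ∈ Icc (0 : ℝ) 1, HasDerivWithinAt β (β' s) (Icc (0 : ℝ) 1) s := fun s hs =>
    ((contDiffOn_prim h.smooth_tx).hasDerivWithinAt_s one_mem_I hs hx).add
      (h.hasDerivWithinAt_leftInt hs hx)
  have hm : ∀ t ∈ Icc (0 : ℝ) 1, MapsTo (fun s : ℝ => (t, s, x)) (Icc (0 : ℝ) 1) cube :=
    fun t ht s hs => mem_cube ht hs hx
  have hc : ∀ t ∈ Icc (0 : ℝ) 1, ∀ {f : ℝ × ℝ × ℝ → 𝔢}, ContinuousOn f cube →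
      ContinuousOn (fun s => f (t, s, x)) (Icc (0 : ℝ) 1) := fun t ht f hf =>
    hf.comp (by fun_prop) (hm t ht)
  have hAd := he.continuousOn_adT
  have cK := hc 1 one_mem_I (contDiffOn_prim h.smooth_ts).continuousOn
  have cβ : ContinuousOn β (Icc (0 : ℝ) 1) := fun s hs => (hdβ s hs).continuousWithinAt
  have cβ' : ContinuousOn β' (Icc (0 : ℝ) 1) :=
    (hc 1 one_mem_I (continuousOn_fderivWithin_apply (contDiffOn_prim h.smooth_tx) es)).add
      (hc 0 zero_mem_I h.smooth_sx.continuousOn)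
  have cV := hc 1 one_mem_I (continuousOn_prim h.continuousOn_vol)
  have cR : ContinuousOn (fun s => adT 𝔢 (e s) (μsx (1, s, x))) (Icc (0 : ℝ) 1) :=
    hAd.clm_apply (hc 1 one_mem_I h.smooth_sx.continuousOn)
  -- the derivative of `Ad(e) β`
  set ψ : ℝ → 𝔢 := fun s => adT 𝔢 (e s) (adDer 𝔢 E (K s) (β s) + β' s) with hψ
  have cψ : ContinuousOn ψ (Icc (0 : ℝ) 1) :=
    hAd.clm_apply ((((adDer 𝔢 E).continuous.comp_continuousOn cK).clm_apply cβ).add cβ')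
  have hVker : ∀ s ∈ Icc (0 : ℝ) 1, (derT d : 𝔢 →L[ℝ] 𝔤) (prim V (1, s, x)) = 0 := fun s hs => by
    have : CompleteSpace 𝔤 := FiniteDimensional.complete ℝ 𝔤
    rw [map_prim _ h.continuousOn_vol one_mem_I ⟨hs, hx⟩, prim]
    refine (intervalIntegral.integral_congr (g := fun _ => 0) fun t ht => ?_).trans (by simp)
    rw [uIcc_of_le zero_le_one] at ht
    exact h.derT_vol _ (mem_cube ht hs hx)
  have key : ∀ s ∈ Icc (0 : ℝ) 1, adT 𝔢 (e s) (fderivWithin ℝ (prim μts) cube (1, s, x) ex) =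
      prim V (1, s, x) - adT 𝔢 (e s) (μsx (1, s, x)) + ψ s := fun s hs => by
    have h2 := h.prim_vol hd hs hx
    have h3 : fderivWithin ℝ (prim μts) cube (1, s, x) ex = prim V (1, s, x) - μsx (1, s, x) +
        (adDer 𝔢 E (K s) (β s) + β' s) := by
      rw [h2, adDer_antisymm (K s)]
      simp only [hβ, hβ', hK]
      abel
    rw [h3, map_add, map_sub, he.adT_eq_self hd h1 (hVker s hs) hs]
  have i1 : ∫ s in (0 : ℝ)..1, adT 𝔢 (e s) (fderivWithin ℝ (prim μts) cube (1, s, x) ex) =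
      (∫ s in (0 : ℝ)..1, prim V (1, s, x)) - (∫ s in (0 : ℝ)..1, adT 𝔢 (e s) (μsx (1, s, x))) +
        (adT 𝔢 (e 1) (β 1) - β 0) := by
    have h4 := integral_eq_sub_of_hasDerivWithinAt_I one_mem_I
      (fun s hs => he.hasDerivWithinAt_adT hs (hdβ s hs)) cψ
    simp only [h1, adT_one, ContinuousLinearMap.id_apply] at h4
    rw [← h4, ← intervalIntegral.integral_sub (intervalIntegrable_I cV zero_mem_I one_mem_I)
      (intervalIntegrable_I cR zero_mem_I one_mem_I), ← intervalIntegral.integral_add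
      ((intervalIntegrable_I cV zero_mem_I one_mem_I).sub
      (intervalIntegrable_I cR zero_mem_I one_mem_I))
      (intervalIntegrable_I cψ zero_mem_I one_mem_I)]
    refine intervalIntegral.integral_congr fun s hs => ?_
    rw [uIcc_of_le zero_le_one] at hs
    exact key s hs
  have i2 : adT 𝔢 (e 1)⁻¹ (∫ s in (0 : ℝ)..1, prim V (1, s, x)) =
      ∫ s in (0 : ℝ)..1, prim V (1, s, x) := by
    rw [← ContinuousLinearMap.intervalIntegral_comp_comm _
      (intervalIntegrable_I cV zero_mem_I one_mem_I)]
    refine intervalIntegral.integral_congr fun s hs => ?_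
    rw [uIcc_of_le zero_le_one] at hs
    have := he.adT_eq_self hd h1 (hVker s hs) one_mem_I
    change adT 𝔢 (e 1)⁻¹ (prim V (1, s, x)) = prim V (1, s, x)
    nth_rewrite 1 [← this]
    exact adT_inv_apply _ _
  have i3 : β 1 = (∫ t in (0 : ℝ)..1, μtx (t, 1, x)) + ∫ s in (0 : ℝ)..1, μsx (0, s, x) := rfl
  have i4 : β 0 = ∫ t in (0 : ℝ)..1, μtx (t, 0, x) := by
    simp only [hβ, leftInt, intervalIntegral.integral_same, add_zero]; rfl
  have c0 : ContinuousOn (fun t => μtx (t, 0, x)) (Icc (0 : ℝ) 1) :=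
    h.smooth_tx.continuousOn.slice_fst (y := ((0 : ℝ), x)) ⟨zero_mem_I, hx⟩
  rw [i1, map_add, map_sub, map_sub, i2, adT_inv_apply, i3, i4,
    ← ContinuousLinearMap.intervalIntegral_comp_comm _
      (intervalIntegrable_I c0 zero_mem_I one_mem_I),
    ← ContinuousLinearMap.intervalIntegral_comp_comm _
      (intervalIntegrable_I cR zero_mem_I one_mem_I)]
  simp only [adT_mul, ContinuousLinearMap.comp_apply, prim]
  abel

end Core

/-! ### The forms on a lifted cube -/
section CubeLiftData

variable {𝔤 : Type*} [NormedAddCommGroup 𝔤] [NormedSpace ℝ 𝔤] [FiniteDimensional ℝ 𝔤]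
  {G : Type*} [TopologicalSpace G] [ChartedSpace 𝔤 G] [Group G]
  {𝔢 : Type*} [NormedAddCommGroup 𝔢] [NormedSpace ℝ 𝔢] [FiniteDimensional ℝ 𝔢]
  {E : Type*} [TopologicalSpace E] [ChartedSpace 𝔢 E] [Group E]
  {EM : Type*} [NormedAddCommGroup EM] [NormedSpace ℝ EM]
  {M : Type*} [TopologicalSpace M] [ChartedSpace EM M]
  {EP : Type*} [NormedAddCommGroup EP] [NormedSpace ℝ EP]
  {P : Type*} [TopologicalSpace P] [ChartedSpace EP P]
  [MulAction Gᵐᵒᵖ P] [MulDistribMulAction G E] {d : E →* G}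
  [LieGroup 𝓘(ℝ, 𝔤) ∞ G] [LieGroup 𝓘(ℝ, 𝔢) ∞ E] [IsManifold 𝓘(ℝ, EP) ∞ P]
  [IsManifold 𝓘(ℝ, EM) ∞ M]
  {π : P → M} {η : PreForm EP P 1 𝔤} {m : PreForm EP P 2 𝔢} {J : ℝ × ℝ × ℝ → M} {u : P}
  {F : ℝ × ℝ × ℝ → P} {t s x : ℝ}

theorem pull_two_swap {X V : Type*} [NormedAddCommGroup X] [NormedSpace ℝ X]
    [NormedAddCommGroup V] [NormedSpace ℝ V] (α : PreForm EP P 2 V) (F : X → P) (D : Set X)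
    (z v w : X) : pull α F D z ![w, v] = -pull α F D z ![v, w] := by
  refine Eq.trans ?_
    ((pull α F D z).toAlternatingMap.map_swap ![v, w] (i := 0) (j := 1) (by decide))
  exact congrArg (pull α F D z) (by ext1 i; fin_cases i <;> rfl)

/-- The lift of a cube supplies cube data.  The face and edge conditions are horizontality of the
lift; on the cube the component of the connection form along `t` vanishes, on the face `t = 0` also
that along `s`, so there is no bracket in the components of the fake curvature condition. -/
theorem IsCubeLift.isCubeData (hF : IsCubeLift π η J u F)
    (hπ : IsPrincipalBundle (𝔤 := 𝔤) (EM := EM) (EP := EP) G π)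
    (hd : IsLieCrossedModule (𝔤 := 𝔤) (𝔢 := 𝔢) d) (hc : IsCategoricalConnection d η m) :
    IsCubeData d (fun z => pull m F cube z ![et, es]) (fun z => pull m F cube z ![et, ex])
      (fun z => pull m F cube z ![es, ex]) (fun z => pull η F cube z ![es])
      (fun z => pull η F cube z ![ex]) (fun z => pullHor G η m F cube z ex et es) := by
  obtain ⟨B, hB⟩ := exists_bracketCLM 𝔤 G
  have hu := uniqueDiffOn_cube
  have hηs := hc.connection.smooth
  have hA := contDiffOn_pull hηs hF.smooth hu
  have hfc : ∀ z ∈ cube, ∀ v w, (derT d : 𝔢 →L[ℝ] 𝔤) (pull m F cube z ![v, w]) =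
      fderivWithin ℝ (fun z => pull η F cube z ![w]) cube z v -
      fderivWithin ℝ (fun z => pull η F cube z ![v]) cube z w +
      (1 / 2 : ℝ) • (B (pull η F cube z ![v]) (pull η F cube z ![w]) -
        B (pull η F cube z ![w]) (pull η F cube z ![v])) := fun z hz v w => by
    rw [hc.derT_pull hF.smooth hu cube_subset_closure hz, extDerivWithin_one_apply
      (hA.differentiableOn (by simp) z hz) (hu z hz), hB, hB]
  have ht0 : ∀ z ∈ cube, ∀ v, fderivWithin ℝ (fun z => pull η F cube z ![et]) cube z v = 0 :=
    fun z hz v => by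
      rw [fderivWithin_congr (f := fun _ => (0 : 𝔤)) (fun z hz => hF.pull_t hz) (hF.pull_t hz)]
      simp
  have hft : ∀ z ∈ cube, ∀ w, (derT d : 𝔢 →L[ℝ] 𝔤) (pull m F cube z ![et, w]) =
      fderivWithin ℝ (fun z => pull η F cube z ![w]) cube z et := fun z hz w => by
    rw [hfc z hz, ht0 z hz, hF.pull_t hz]
    simp
  refine ⟨contDiffOn_pull_apply hc.smooth hF.smooth hu _,
    contDiffOn_pull_apply hc.smooth hF.smooth hu _,
    contDiffOn_pull_apply hc.smooth hF.smooth hu _,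
    contDiffOn_pull_apply hηs hF.smooth hu _, contDiffOn_pull_apply hηs hF.smooth hu _,
    fun s hs x hx => hF.pull_s hs hx, fun x hx => hF.pull_x hx, fun z hz => hft z hz es,
    fun z hz => hft z hz ex, fun s hs x hx => ?_, fun z hz => ?_, fun z hz => ?_⟩
  · have hz := mem_cube zero_mem_I hs hx
    have h1 := (contDiffOn_pull_apply hηs hF.smooth hu ![es]).hasDerivWithinAt_x zero_mem_I hs hx
    have h2 : HasDerivWithinAt (fun x' => pull η F cube (0, s, x') ![es]) 0 (Icc (0 : ℝ) 1) x :=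
      (hasDerivWithinAt_const x _ (0 : 𝔤)).congr (fun x' hx' => hF.pull_s hs hx')
        (hF.pull_s hs hx)
    have h3 := (uniqueDiffOn_I x hx).eq_deriv _ h1 h2
    rw [hfc _ hz, h3, hF.pull_s hs hx]
    simp
  · rw [(hc.pullHor_eq hπ hd hF.smooth hu cube_subset_closure hz ex et es).1, hF.pull_t hz]
    have e1 : (fun z => pull m F cube z ![ex, es]) = -(fun z => pull m F cube z ![es, ex]) := by
      ext z; exact pull_two_swap m F cube z es ex
    have e2 : (fun z => pull m F cube z ![ex, et]) = -(fun z => pull m F cube z ![et, ex]) := by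
      ext z; exact pull_two_swap m F cube z et ex
    rw [e1, e2, pull_two_swap m F cube z et ex, fderivWithin_neg (hu z hz),
      fderivWithin_neg (hu z hz)]
    simp only [map_zero, zero_apply, neg_apply, map_neg, add_zero]
    abel
  · exact (hc.pullHor_eq hπ hd hF.smooth hu cube_subset_closure hz ex et es).2

end CubeLiftData

/-! ### The categorical holonomy as a solution of a differential equation -/
section HolonomyFamily

variable {𝔢 : Type*} [NormedAddCommGroup 𝔢] [NormedSpace ℝ 𝔢] [FiniteDimensional ℝ 𝔢]
  {E : Type*} [TopologicalSpace E] [T2Space E] [ChartedSpace 𝔢 E] [Group E]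
  [LieGroup 𝓘(ℝ, 𝔢) ∞ E]

theorem hasVelocityAt_leftMul_iff {e : ℝ → E} {s : ℝ} {k : 𝔢} :
    HasVelocityAt e s (leftMul (e s) k) ↔
      HasLog e (Icc (0 : ℝ) 1) s ((1 : ℝ →L[ℝ] ℝ).smulRight k) := by
  have : (leftT 𝔢 (e s)).comp ((1 : ℝ →L[ℝ] ℝ).smulRight k) =
      (1 : ℝ →L[ℝ] ℝ).smulRight (leftT 𝔢 (e s) k) := by ext; simp
  rw [HasLog, this]
  rfl

/-- The solutions of `e' = e K(1, ·, x)`, `e(0) = 1`, and the derivative of their end points with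
respect to `x`. -/
theorem exists_holonomyFamily {K : ℝ × ℝ × ℝ → 𝔢} (hK : ContDiffOn ℝ ∞ K cube) :
    ∃ g : ℝ → ℝ → E, ∀ x ∈ Icc (0 : ℝ) 1, g x 0 = 1 ∧
      IsLogSol (g x) (fun s => K (1, s, x)) 0 1 ∧
      HasLog (fun x => g x 1) (Icc (0 : ℝ) 1) x ((1 : ℝ →L[ℝ] ℝ).smulRight
        (adT 𝔢 (g x 1)⁻¹ (∫ s in (0 : ℝ)..1,
          adT 𝔢 (g x s) (fderivWithin ℝ K cube (1, s, x) ex)))) := by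
  have : CompleteSpace 𝔢 := FiniteDimensional.complete ℝ 𝔢
  set K₁ : ℝ × ℝ → 𝔢 := fun z => K (1, z) with hK₁
  have hs : ContDiffOn ℝ ∞ K₁ (Icc (0 : ℝ) 1 ×ˢ Icc (0 : ℝ) 1) :=
    hK.comp (by fun_prop) fun z hz => mem_cube one_mem_I hz.1 hz.2
  obtain ⟨g, hg1, -, hg⟩ := exists_contMDiffOn_isLogSol (G := E) zero_lt_one isCompact_Icc
    (convex_Icc (0 : ℝ) 1) interior_I_nonempty hs
  have hsol : ∀ x ∈ Icc (0 : ℝ) 1, IsLogSol (fun s => g (s, x)) (fun s => K (1, s, x)) 0 1 :=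
    fun x hx s hs => by
      refine (HasLog.comp_hasFDerivWithinAt (φ := fun s : ℝ => (s, x)) (hg (s, x) ⟨hs, hx⟩)
        (hasFDerivAt_prodMk_left s x).hasFDerivWithinAt fun _ hs => ⟨hs, hx⟩).congr_deriv ?_
      ext
      simp [duhamel, hK₁]
  refine ⟨fun x s => g (s, x), fun x hx => ⟨hg1 x hx, hsol x hx, ?_⟩⟩
  refine (HasLog.comp_hasFDerivWithinAt (φ := fun x : ℝ => ((1 : ℝ), x))
    (hg (1, x) ⟨one_mem_I, hx⟩) (hasFDerivAt_prodMk_right (1 : ℝ) x).hasFDerivWithinAt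
    fun _ hx => ⟨one_mem_I, hx⟩).congr_deriv ?_
  have hcK : ContinuousOn (fun z => (fderivWithin ℝ K₁ (Icc (0 : ℝ) 1 ×ˢ Icc (0 : ℝ) 1) z).comp
      (ContinuousLinearMap.inr ℝ ℝ ℝ)) (Icc (0 : ℝ) 1 ×ˢ Icc (0 : ℝ) 1) :=
    (hs.continuousOn_fderivWithin (uniqueDiffOn_Icc_prod zero_lt_one (convex_Icc (0 : ℝ) 1)
      interior_I_nonempty) (by simp)).clm_comp continuousOn_const
  have hc := (hsol x hx).continuousOn_adT.clm_comp (hcK.slice_fst hx)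
  -- the partial derivatives with respect to `x` on the face and on the cube agree
  have hder : ∀ s ∈ Icc (0 : ℝ) 1, fderivWithin ℝ K₁ (Icc (0 : ℝ) 1 ×ˢ Icc (0 : ℝ) 1) (s, x)
      ((0 : ℝ), (1 : ℝ)) = fderivWithin ℝ K cube (1, s, x) ex := fun s hs' => by
    have h1 := hK.hasDerivWithinAt_x one_mem_I hs' hx
    have h2 := (HasFDerivWithinAt.slice_snd
      ((hs.differentiableOn (by simp) (s, x) ⟨hs', hx⟩).hasFDerivWithinAt) hs').hasDerivWithinAt
    simpa using (uniqueDiffOn_I x hx).eq_deriv _ h2 h1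
  ext
  simp only [duhamel, ContinuousLinearMap.comp_apply, ContinuousLinearMap.inr_apply, add_apply,
    ContinuousLinearMap.smulRight_apply, ContinuousLinearMap.coe_fst', zero_smul, zero_add,
    ContinuousLinearMap.coe_snd', one_apply_eq_self, one_smul]
  congr 1
  refine (ContinuousLinearMap.intervalIntegral_apply
    (intervalIntegrable_I hc zero_mem_I one_mem_I) (1 : ℝ)).trans ?_
  refine intervalIntegral.integral_congr fun s hs' => ?_
  rw [uIcc_of_le zero_le_one] at hs'
  simp only [ContinuousLinearMap.comp_apply, ContinuousLinearMap.inr_apply, hder s hs']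

variable {EM : Type*} [NormedAddCommGroup EM] [NormedSpace ℝ EM]
  {M : Type*} [TopologicalSpace M] [ChartedSpace EM M]
  {EP : Type*} [NormedAddCommGroup EP] [NormedSpace ℝ EP]
  {P : Type*} [TopologicalSpace P] [ChartedSpace EP P]
  {𝔤 : Type*} [NormedAddCommGroup 𝔤] [NormedSpace ℝ 𝔤]
  {π : P → M} {η : PreForm EP P 1 𝔤} {m : PreForm EP P 2 𝔢} {Γ : ℝ → ℝ → M} {u : P}

/-- The categorical holonomy solves `e' = e K`, where `K` is the integral of the
integrand along `t`. -/
theorem isCatHolonomy_iff {e : ℝ → E} {K : ℝ → 𝔢} (hK : ∀ s ∈ Icc (0 : ℝ) 1,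
      ∫ t in (0 : ℝ)..1, surfIntegrand (EM := EM) π η m Γ u t s = K s) :
    IsCatHolonomy (EM := EM) π η m Γ u e ↔ e 0 = 1 ∧ IsLogSol e K 0 1 := by
  constructor
  · intro h
    refine ⟨h.start, fun s hs => ?_⟩
    rw [← hK s hs]
    exact hasVelocityAt_leftMul_iff.1 (h.hasVelocity s hs)
  · intro h
    refine ⟨h.1, fun s hs => hasVelocityAt_leftMul_iff.2 ?_⟩
    rw [hK s hs]
    exact h.2 s hs

/-- The chosen holonomy has the defining properties as soon as there is a holonomy. -/
theorem IsCatHolonomy.catHolonomy {e : ℝ → E}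
    (he : IsCatHolonomy (EM := EM) π η m Γ u e) :
    IsCatHolonomy (EM := EM) π η m Γ u (catHolonomy (EM := EM) E π η m Γ u) :=
  Classical.epsilon_spec (p := fun e : ℝ → E => IsCatHolonomy (EM := EM) π η m Γ u e) ⟨e, he⟩

theorem IsCatHolonomy.eqOn {e e' : ℝ → E} (he : IsCatHolonomy (EM := EM) π η m Γ u e)
    (he' : IsCatHolonomy (EM := EM) π η m Γ u e') : EqOn e e' (Icc (0 : ℝ) 1) :=
  (((isCatHolonomy_iff fun _ _ => rfl).1 he).2).eqOn ((isCatHolonomy_iff fun _ _ => rfl).1 he').2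
    zero_mem_I (he.start.trans he'.start.symm)

end HolonomyFamily

/-! ### Parallel transport along the boundary -/
section Boundary

variable {𝔤 : Type*} [NormedAddCommGroup 𝔤] [NormedSpace ℝ 𝔤] [FiniteDimensional ℝ 𝔤]
  {G : Type*} [TopologicalSpace G] [ChartedSpace 𝔤 G] [Group G]
  {𝔢 : Type*} [NormedAddCommGroup 𝔢] [NormedSpace ℝ 𝔢] [FiniteDimensional ℝ 𝔢]
  {E : Type*} [TopologicalSpace E] [ChartedSpace 𝔢 E] [Group E]
  {EM : Type*} [NormedAddCommGroup EM] [NormedSpace ℝ EM]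
  {M : Type*} [TopologicalSpace M] [ChartedSpace EM M]
  {EP : Type*} [NormedAddCommGroup EP] [NormedSpace ℝ EP]
  {P : Type*} [TopologicalSpace P] [ChartedSpace EP P]
  [MulAction Gᵐᵒᵖ P] [MulDistribMulAction G E] {d : E →* G}
  [LieGroup 𝓘(ℝ, 𝔤) ∞ G] [LieGroup 𝓘(ℝ, 𝔢) ∞ E] [IsManifold 𝓘(ℝ, EP) ∞ P]
  [IsManifold 𝓘(ℝ, EM) ∞ M]
  {π : P → M} {η : PreForm EP P 1 𝔤} {m : PreForm EP P 2 𝔢} {J : ℝ × ℝ × ℝ → M} {u : P}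
  {F : ℝ × ℝ × ℝ → P} {t s x : ℝ}

/-- The form `m`, evaluated at `p g` on horizontal lifts, is the translate by `g⁻¹` of its value
at `p`. -/
theorem IsCategoricalConnection.formAt_hLift_act (hc : IsCategoricalConnection d η m)
    (hπ : IsPrincipalBundle (𝔤 := 𝔤) (EM := EM) (EP := EP) G π) (p : P) (g : G) (v w : EP) :
    formAt m (p <• g) ![hLift π η (p <• g) (tmap EP EM π p v),
      hLift π η (p <• g) (tmap EP EM π p w)] = actT 𝔢 E g⁻¹ (formAt m p ![v, w]) := by
  rw [← hπ.tmap_proj_rightT p g, ContinuousLinearMap.comp_apply, ContinuousLinearMap.comp_apply,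
    hc.connection.hLift_tmap hπ, hc.connection.hLift_tmap hπ, hc.formAt_horProj]
  have := hc.formAt_act p g v w 0 0
  rwa [map_zero, add_zero, add_zero] at this

theorem pull_two_smul {X V : Type*} [NormedAddCommGroup X] [NormedSpace ℝ X]
    [NormedAddCommGroup V] [NormedSpace ℝ V] (α : PreForm EP P 2 V) (F : X → P) (D : Set X)
    (z v w : X) (c : ℝ) : pull α F D z ![c • v, w] = c • pull α F D z ![v, w] :=
  (pull α F D z).toAlternatingMap.map_vecCons_smul ![w] c v

/-- The horizontal lift of the reversed right edge of the square with end point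
`F(1,0,x) ∂(e(1))`. -/
theorem IsCubeLift.isHorizontal_right (hF : IsCubeLift π η J u F)
    (hπ : IsPrincipalBundle (𝔤 := 𝔤) (EM := EM) (EP := EP) G π)
    (hd : IsLieCrossedModule (𝔤 := 𝔤) (𝔢 := 𝔢) d) (hc : IsCategoricalConnection d η m)
    (hx : x ∈ Icc (0 : ℝ) 1) {e : ℝ → E}
    (he : IsLogSol e (fun s => prim (fun z => pull m F cube z ![et, es]) (1, s, x)) 0 1) :
    IsHorizontal η (fun r => F (1, 1 - r, x) <• ((d (e (1 - r)))⁻¹ * d (e 1)))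
      (Icc (0 : ℝ) 1) := by
  -- `s ↦ F(1, s, x) ∂(e(s))⁻¹` is horizontal, since the connection form takes the value `∂(K)` on
  -- `∂ₛF(1, s, x)`, which is the logarithmic derivative of `∂(e)`
  have h : IsHorizontal η (fun s => F (1, s, x) <• (d (e s))⁻¹) (Icc (0 : ℝ) 1) := by
    intro s hs
    have hz := mem_cube one_mem_I hs hx
    refine ⟨rightT EP (d (e s))⁻¹ (F (1, s, x)) (tmapWithin EP F cube (1, s, x) es) +
      fundT 𝔤 G EP (F (1, s, x) <• (d (e s))⁻¹) (-adT 𝔤 (d (e s)) (derT d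
        (prim (fun z => pull m F cube z ![et, es]) (1, s, x)))),
      (((hF.hasTDeriv hz).line_s one_mem_I hx).act hπ
        ((he s hs).map_crossed hd).inv).congr_deriv ?_, ?_⟩
    · ext; simp
    · rw [hc.connection.oneForm_act, inv_inv, ← pull_one, (hF.isCubeData hπ hd hc).s_eq hz,
        add_neg_cancel]
  refine ((h.reverse).act hc.connection hπ (d (e 1))).congr fun r hr => ?_
  exact smul_op_mul _ _ _

section Transport

variable (hF : IsCubeLift π η J u F)
  (hπ : IsPrincipalBundle (𝔤 := 𝔤) (EM := EM) (EP := EP) G π)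
  (hd : IsLieCrossedModule (𝔤 := 𝔤) (𝔢 := 𝔢) d) (hc : IsCategoricalConnection d η m)
  (hx : x ∈ Icc (0 : ℝ) 1) {e : ℝ → E} {n : ℝ}

include hF hπ hc hx

theorem IsCubeLift.boundaryTransport_left (h0 : 0 ≤ n) (h1 : n ≤ 1 / 4) :
    boundaryTransport (EM := EM) π η (slice J x) n (basePt (EM := EM) π η J u x) =
      F (0, 4 * n, x) := by
  simp only [boundaryTransport, if_pos h1]
  exact hF.parTransport_left hc.connection hπ ⟨by linarith, by linarith⟩ hx

theorem IsCubeLift.boundaryTransport_top (h0 : 1 / 4 < n) (h1 : n ≤ 1 / 2) :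
    boundaryTransport (EM := EM) π η (slice J x) n (basePt (EM := EM) π η J u x) =
      F (4 * n - 1, 1, x) := by
  simp only [boundaryTransport, if_neg h0.not_ge, if_pos h1]
  rw [hF.parTransport_left hc.connection hπ one_mem_I hx]
  exact hF.parTransport_t hc.connection hπ ⟨by linarith, by linarith⟩ one_mem_I hx

variable (h1 : e 0 = 1)
  (he : IsLogSol e (fun s => prim (fun z => pull m F cube z ![et, es]) (1, s, x)) 0 1)

include hd he

theorem IsCubeLift.parTransport_right {r : ℝ} (hr : r ∈ Icc (0 : ℝ) 1) :
    parTransport (EM := EM) π η (fun r => slice J x 1 (1 - r)) r (F (1, 1, x)) =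
      F (1, 1 - r, x) <• ((d (e (1 - r)))⁻¹ * d (e 1)) := by
  refine (hF.isHorizontal_right hπ hd hc hx he).parTransport_eq hc.connection hπ ?_ ?_ hr
  · simp only [sub_zero, inv_mul_cancel, smul_op_one]
  · intro r hr
    rw [hπ.proj_act]
    exact hF.lies_over _ (mem_cube one_mem_I ⟨by linarith [hr.2], by linarith [hr.1]⟩ hx)

theorem IsCubeLift.boundaryTransport_right (h0 : 1 / 2 < n) (h1 : n ≤ 3 / 4) :
    boundaryTransport (EM := EM) π η (slice J x) n (basePt (EM := EM) π η J u x) =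
      F (1, 3 - 4 * n, x) <• ((d (e (3 - 4 * n)))⁻¹ * d (e 1)) := by
  have h4 : ¬ n ≤ 1 / 4 := by linarith
  simp only [boundaryTransport, if_neg h4, if_neg h0.not_ge, if_pos h1]
  rw [hF.parTransport_left hc.connection hπ one_mem_I hx,
    hF.parTransport_t hc.connection hπ one_mem_I one_mem_I hx,
    hF.parTransport_right hπ hd hc hx he ⟨by linarith, by linarith⟩]
  have : 1 - (4 * n - 2) = 3 - 4 * n := by ring
  rw [this]

include h1

theorem IsCubeLift.boundaryTransport_bottom (h0 : 3 / 4 < n) (hn : n ≤ 1) :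
    boundaryTransport (EM := EM) π η (slice J x) n (basePt (EM := EM) π η J u x) =
      F (4 - 4 * n, 0, x) <• d (e 1) := by
  have h4 : ¬ n ≤ 1 / 4 := by linarith
  have h5 : ¬ n ≤ 1 / 2 := by linarith
  simp only [boundaryTransport, if_neg h4, if_neg h5, if_neg h0.not_ge]
  rw [hF.parTransport_left hc.connection hπ one_mem_I hx,
    hF.parTransport_t hc.connection hπ one_mem_I one_mem_I hx,
    hF.parTransport_right hπ hd hc hx he one_mem_I]
  simp only [sub_self, h1, map_one, inv_one, one_mul]
  have h6 := ((hF.horizontal_t 0 zero_mem_I x hx).reverse.act hc.connection hπ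
    (d (e 1))).parTransport_eq (γ := fun r => slice J x (1 - r) 0) (t := 4 * n - 3)
    hc.connection hπ rfl (fun r hr => by
      rw [hπ.proj_act]
      exact hF.lies_over _ (mem_cube ⟨by linarith [hr.2], by linarith [hr.1]⟩ zero_mem_I hx))
    ⟨by linarith, by linarith⟩
  simp only [sub_zero] at h6
  rw [h6]
  have : 1 - (4 * n - 3) = 4 - 4 * n := by ring
  rw [this]

end Transport

/-- The boundary integrand on the interior of an edge of the square, where the boundary loop is the
image of the affine path `φ`, with velocity `w`. -/
theorem IsCubeLift.bdryIntegrand_eq (hF : IsCubeLift π η J u F)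
    (hπ : IsPrincipalBundle (𝔤 := 𝔤) (EM := EM) (EP := EP) G π)
    (hc : IsCategoricalConnection d η m) {φ : ℝ → ℝ × ℝ} {a b n : ℝ} {w : ℝ × ℝ} (ha : 0 ≤ a)
    (hb : b ≤ 1) (hn : n ∈ Ioo a b) (hx : x ∈ Icc (0 : ℝ) 1)
    (hφ : HasDerivAt φ w n)
    (hφm : MapsTo φ (Ioo a b) (Icc (0 : ℝ) 1 ×ˢ Icc (0 : ℝ) 1))
    (hloop : ∀ x, ∀ n ∈ Ioo a b, boundaryLoop (slice J x) n = J ((φ n).1, (φ n).2, x)) {g : G}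
    (ht : boundaryTransport (EM := EM) π η (slice J x) n (basePt (EM := EM) π η J u x) =
      F ((φ n).1, (φ n).2, x) <• g) :
    bdryIntegrand (EM := EM) π η m J u x n =
      actT 𝔢 E g⁻¹ (pull m F cube ((φ n).1, (φ n).2, x) ![(w.1, w.2, 0), ex]) := by
  have hz : ((φ n).1, (φ n).2, x) ∈ cube := ⟨(hφm hn).1, (hφm hn).2, hx⟩
  have hnI : n ∈ Icc (0 : ℝ) 1 := ⟨ha.trans hn.1.le, hn.2.le.trans hb⟩
  have hnhds : Ioo a b ∈ nhds n := Ioo_mem_nhds hn.1 hn.2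
  have hT := hF.hasTDeriv hz
  have hψ : HasDerivAt (fun n => ((φ n).1, (φ n).2, x)) (w.1, w.2, (0 : ℝ)) n :=
    hφ.fst.prodMk (hφ.snd.prodMk (hasDerivAt_const n x))
  have hcurve : HasTDeriv (fun n => F ((φ n).1, (φ n).2, x)) (Icc (0 : ℝ) 1) n
      ((1 : ℝ →L[ℝ] ℝ).smulRight (tmapWithin EP F cube ((φ n).1, (φ n).2, x) (w.1, w.2, 0))) := by
    refine HasTDeriv.mono_of_mem ((HasTDeriv.comp_hasFDerivWithinAt
      (φ := fun n => ((φ n).1, (φ n).2, x)) (t := Ioo a b) hT hψ.hasFDerivAt.hasFDerivWithinAt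
      fun n hn => ⟨(hφm hn).1, (hφm hn).2, hx⟩).congr_deriv ?_) (mem_nhdsWithin_of_mem_nhds hnhds)
    ext; simp
  have e1 := hcurve.vel_eq_of_eventuallyEq hπ (γ := fun n => boundaryLoop (slice J x) n)
    (Filter.eventually_of_mem (mem_nhdsWithin_of_mem_nhds hnhds) fun n hn =>
      (hloop x n hn).trans (hF.lies_over _ ⟨(hφm hn).1, (hφm hn).2, hx⟩).symm) hnI
  have e2 := (hT.line_x (hφm hn).1 (hφm hn).2).vel_eq hπ
    (γ := fun x => boundaryLoop (slice J x) n) (fun x' hx' => by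
      rw [hloop x' n hn, hF.lies_over _ ⟨(hφm hn).1, (hφm hn).2, hx'⟩]) hx
  have h : bdryIntegrand (EM := EM) π η m J u x n = formAt m
      (boundaryTransport (EM := EM) π η (slice J x) n (basePt (EM := EM) π η J u x))
      ![hLift π η (boundaryTransport (EM := EM) π η (slice J x) n (basePt (EM := EM) π η J u x))
          (vel EM (fun n => boundaryLoop (slice J x) n) n),
        hLift π η (boundaryTransport (EM := EM) π η (slice J x) n (basePt (EM := EM) π η J u x))
          (vel EM (fun x => boundaryLoop (slice J x) n) x)] := rfl
  rw [h, ht, e1, e2, hc.formAt_hLift_act hπ, pull_two]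

/-- The integral over one quarter of the boundary loop, by an affine substitution; the integrand is
only prescribed in the interior, where the loop is smooth. -/
theorem integral_edge {V : Type*} [NormedAddCommGroup V] [NormedSpace ℝ V] {f β : ℝ → V}
    (hf : ContinuousOn f (Icc (0 : ℝ) 1)) {a b c k : ℝ} (hab : a ≤ b)
    (hm : MapsTo (fun n => c * n + k) (Icc a b) (Icc (0 : ℝ) 1))
    (hβ : ∀ n ∈ Ioo a b, β n = c • f (c * n + k)) :
    IntervalIntegrable β volume a b ∧
      ∫ n in a..b, β n = ∫ r in (c * a + k)..(c * b + k), f r := by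
  have he : EqOn (fun n => c • f (c * n + k)) β (uIoo a b) := fun n hn => by
    rw [uIoo_of_le hab] at hn
    exact (hβ n hn).symm
  constructor
  · refine IntervalIntegrable.congr_uIoo (ContinuousOn.intervalIntegrable ?_) he
    rw [uIcc_of_le hab]
    exact continuousOn_const.smul (hf.comp (by fun_prop) hm)
  · rw [← intervalIntegral.integral_congr_uIoo he, intervalIntegral.integral_smul,
      intervalIntegral.smul_integral_comp_mul_add]

end Boundary

/-! ### The integral along the boundary loop -/
section BoundaryIntegral

variable {𝔤 : Type*} [NormedAddCommGroup 𝔤] [NormedSpace ℝ 𝔤] [FiniteDimensional ℝ 𝔤]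
  {G : Type*} [TopologicalSpace G] [ChartedSpace 𝔤 G] [Group G]
  {𝔢 : Type*} [NormedAddCommGroup 𝔢] [NormedSpace ℝ 𝔢] [FiniteDimensional ℝ 𝔢]
  {E : Type*} [TopologicalSpace E] [ChartedSpace 𝔢 E] [Group E]
  {EM : Type*} [NormedAddCommGroup EM] [NormedSpace ℝ EM]
  {M : Type*} [TopologicalSpace M] [ChartedSpace EM M]
  {EP : Type*} [NormedAddCommGroup EP] [NormedSpace ℝ EP]
  {P : Type*} [TopologicalSpace P] [ChartedSpace EP P]
  [MulAction Gᵐᵒᵖ P] [MulDistribMulAction G E] {d : E →* G}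
  [LieGroup 𝓘(ℝ, 𝔤) ∞ G] [LieGroup 𝓘(ℝ, 𝔢) ∞ E] [IsManifold 𝓘(ℝ, EP) ∞ P]
  [IsManifold 𝓘(ℝ, EM) ∞ M]
  {π : P → M} {η : PreForm EP P 1 𝔤} {m : PreForm EP P 2 𝔢} {J : ℝ × ℝ × ℝ → M} {u : P}
  {F : ℝ × ℝ × ℝ → P} {x : ℝ}

/-- The integral of `m` along the boundary loop is the sum of the contributions of the four edges of
the square.  Along the left and the top edge the parallel transport agrees with the lift of the
cube; along the right and the bottom edge it differs from it by `∂(e(s))⁻¹ ∂(e(1))` and `∂(e(1))`,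
which act on `m` by the adjoint action of `E`. -/
theorem IsCubeLift.integral_bdryIntegrand (hF : IsCubeLift π η J u F)
    (hπ : IsPrincipalBundle (𝔤 := 𝔤) (EM := EM) (EP := EP) G π)
    (hd : IsLieCrossedModule (𝔤 := 𝔤) (𝔢 := 𝔢) d) (hc : IsCategoricalConnection d η m)
    (hx : x ∈ Icc (0 : ℝ) 1) {e : ℝ → E} (h1 : e 0 = 1)
    (he : IsLogSol e (fun s => prim (fun z => pull m F cube z ![et, es]) (1, s, x)) 0 1) :
    IntervalIntegrable (bdryIntegrand (EM := EM) π η m J u x) volume 0 1 ∧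
      ∫ n in (0 : ℝ)..1, bdryIntegrand (EM := EM) π η m J u x n =
        (∫ s in (0 : ℝ)..1, pull m F cube (0, s, x) ![es, ex]) +
        (∫ t in (0 : ℝ)..1, pull m F cube (t, 1, x) ![et, ex])
        - (∫ s in (0 : ℝ)..1, adT 𝔢 ((e 1)⁻¹ * e s) (pull m F cube (1, s, x) ![es, ex]))
        - ∫ t in (0 : ℝ)..1, adT 𝔢 (e 1)⁻¹ (pull m F cube (t, 0, x) ![et, ex]) := by
  have hD := hF.isCubeData hπ hd hc
  have hsx := hD.smooth_sx.continuousOn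
  have htx := hD.smooth_tx.continuousOn
  have cL : ContinuousOn (fun s => pull m F cube (0, s, x) ![es, ex]) (Icc (0 : ℝ) 1) :=
    hsx.comp (by fun_prop) fun s hs => mem_cube zero_mem_I hs hx
  have cT : ContinuousOn (fun t => pull m F cube (t, 1, x) ![et, ex]) (Icc (0 : ℝ) 1) :=
    htx.comp (by fun_prop) fun t ht => mem_cube ht one_mem_I hx
  have cR : ContinuousOn (fun s => adT 𝔢 ((e 1)⁻¹ * e s) (pull m F cube (1, s, x) ![es, ex]))
      (Icc (0 : ℝ) 1) :=
    (he.const_mul (e 1)⁻¹).continuousOn_adT.clm_apply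
      (hsx.comp (by fun_prop) fun s hs => mem_cube one_mem_I hs hx)
  have cB : ContinuousOn (fun t => adT 𝔢 (e 1)⁻¹ (pull m F cube (t, 0, x) ![et, ex]))
      (Icc (0 : ℝ) 1) :=
    continuousOn_const.clm_apply (htx.comp (by fun_prop) fun t ht => mem_cube ht zero_mem_I hx)
  have hs : ∀ c : ℝ, ((0 : ℝ), c, (0 : ℝ)) = c • es := fun c => by simp [es]
  have ht : ∀ c : ℝ, (c, (0 : ℝ), (0 : ℝ)) = c • et := fun c => by simp [et]
  have hid : ∀ c k n : ℝ, HasDerivAt (fun n => c * n + k) c n := fun c k n => by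
    simpa using ((hasDerivAt_id n).const_mul c).add_const k
  -- left, top, right and bottom edge, parametrized by `φ`
  have bL := integral_edge (β := bdryIntegrand (EM := EM) π η m J u x) cL (a := 0) (b := 1 / 4)
    (c := 4) (k := 0) (by norm_num)
    (fun n hn => ⟨by linarith [hn.1], by linarith [hn.2]⟩) fun n hn => by
      rw [hF.bdryIntegrand_eq hπ hc (φ := fun n => (0, 4 * n + 0)) (w := (0, 4)) (g := 1)
        le_rfl (by norm_num) hn hx ((hasDerivAt_const n (0 : ℝ)).prodMk (hid 4 0 n))
        (fun n hn => ⟨zero_mem_I, by linarith [hn.1], by linarith [hn.2]⟩)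
        (fun x n hn => by simp only [boundaryLoop, if_pos hn.2.le, slice, add_zero])
        (by rw [hF.boundaryTransport_left hπ hc hx hn.1.le hn.2.le, smul_op_one, add_zero]),
        hs, pull_two_smul, inv_one, actT_one]
      rfl
  have bT := integral_edge (β := bdryIntegrand (EM := EM) π η m J u x) cT (a := 1 / 4)
    (b := 1 / 2) (c := 4) (k := -1) (by norm_num)
    (fun n hn => ⟨by linarith [hn.1], by linarith [hn.2]⟩) fun n hn => by
      rw [hF.bdryIntegrand_eq hπ hc (φ := fun n => (4 * n + -1, 1)) (w := (4, 0)) (g := 1)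
        (by norm_num) (by norm_num) hn hx ((hid 4 (-1) n).prodMk (hasDerivAt_const n (1 : ℝ)))
        (fun n hn => ⟨⟨by linarith [hn.1], by linarith [hn.2]⟩, one_mem_I⟩)
        (fun x n hn => by
          simp only [boundaryLoop, if_neg hn.1.not_ge, if_pos hn.2.le, slice, sub_eq_add_neg])
        (by rw [hF.boundaryTransport_top hπ hc hx hn.1 hn.2.le, smul_op_one, sub_eq_add_neg]),
        ht, pull_two_smul, inv_one, actT_one]
      rfl
  have bR := integral_edge (β := bdryIntegrand (EM := EM) π η m J u x) cR (a := 1 / 2)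
    (b := 3 / 4) (c := -4) (k := 3) (by norm_num)
    (fun n hn => ⟨by linarith [hn.2], by linarith [hn.1]⟩) fun n hn => by
      have e1 : ∀ n : ℝ, 3 - 4 * n = -4 * n + 3 := fun n => by ring
      rw [hF.bdryIntegrand_eq hπ hc (φ := fun n => (1, -4 * n + 3)) (w := (0, -4))
        (g := (d (e (-4 * n + 3)))⁻¹ * d (e 1))
        (by norm_num) (by norm_num) hn hx ((hasDerivAt_const n (1 : ℝ)).prodMk (hid (-4) 3 n))
        (fun n hn => ⟨one_mem_I, by linarith [hn.2], by linarith [hn.1]⟩)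
        (fun x n hn => by
          have h4 : ¬ n ≤ 1 / 4 := by linarith [hn.1]
          simp only [boundaryLoop, if_neg h4, if_neg hn.1.not_ge, if_pos hn.2.le, slice, e1])
        (by rw [hF.boundaryTransport_right hπ hd hc hx he hn.1 hn.2.le, e1]),
        hs, pull_two_smul, mul_inv_rev, inv_inv, ← map_inv, ← map_mul, hd.actT_map, map_smul]
  have bB := integral_edge (β := bdryIntegrand (EM := EM) π η m J u x) cB (a := 3 / 4)
    (b := 1) (c := -4) (k := 4) (by norm_num)
    (fun n hn => ⟨by linarith [hn.2], by linarith [hn.1]⟩) fun n hn => by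
      have e1 : ∀ n : ℝ, 4 - 4 * n = -4 * n + 4 := fun n => by ring
      rw [hF.bdryIntegrand_eq hπ hc (φ := fun n => (-4 * n + 4, 0)) (w := (-4, 0))
        (g := d (e 1))
        (by norm_num) (by norm_num) hn hx ((hid (-4) 4 n).prodMk (hasDerivAt_const n (0 : ℝ)))
        (fun n hn => ⟨⟨by linarith [hn.2], by linarith [hn.1]⟩, zero_mem_I⟩)
        (fun x n hn => by
          have h4 : ¬ n ≤ 1 / 4 := by linarith [hn.1]
          have h5 : ¬ n ≤ 1 / 2 := by linarith [hn.1]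
          simp only [boundaryLoop, if_neg h4, if_neg h5, if_neg hn.1.not_ge, slice, e1])
        (by rw [hF.boundaryTransport_bottom hπ hd hc hx h1 he hn.1 hn.2.le, e1]),
        ht, pull_two_smul, ← map_inv, hd.actT_map, map_smul]
  refine ⟨((bL.1.trans bT.1).trans bR.1).trans bB.1, ?_⟩
  rw [← intervalIntegral.integral_add_adjacent_intervals ((bL.1.trans bT.1).trans bR.1) bB.1,
    ← intervalIntegral.integral_add_adjacent_intervals (bL.1.trans bT.1) bR.1,
    ← intervalIntegral.integral_add_adjacent_intervals bL.1 bT.1, bL.2, bT.2, bR.2, bB.2]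
  norm_num
  rw [intervalIntegral.integral_symm 0 1, intervalIntegral.integral_symm 0 1]
  abel

end BoundaryIntegral

end

/-! ### The derivative of the categorical holonomy -/

theorem mainTheorem2
    -- the Lie groups `G`, `E`, with their Lie algebras as model spaces
    {𝔤 : Type*} [NormedAddCommGroup 𝔤] [NormedSpace ℝ 𝔤] [FiniteDimensional ℝ 𝔤]
    {G : Type*} [TopologicalSpace G] [T2Space G] [ChartedSpace 𝔤 G] [Group G]
    [LieGroup 𝓘(ℝ, 𝔤) ∞ G]
    {𝔢 : Type*} [NormedAddCommGroup 𝔢] [NormedSpace ℝ 𝔢] [FiniteDimensional ℝ 𝔢]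
    {E : Type*} [TopologicalSpace E] [T2Space E] [ChartedSpace 𝔢 E] [Group E]
    [LieGroup 𝓘(ℝ, 𝔢) ∞ E]
    -- the Lie crossed module
    [MulDistribMulAction G E] (d : E →* G)
    (hd : IsLieCrossedModule (𝔤 := 𝔤) (𝔢 := 𝔢) d)
    -- the principal bundle
    {EM : Type*} [NormedAddCommGroup EM] [NormedSpace ℝ EM] [FiniteDimensional ℝ EM]
    {M : Type*} [TopologicalSpace M] [T2Space M] [ChartedSpace EM M] [IsManifold 𝓘(ℝ, EM) ∞ M]
    {EP : Type*} [NormedAddCommGroup EP] [NormedSpace ℝ EP] [FiniteDimensional ℝ EP]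
    {P : Type*} [TopologicalSpace P] [T2Space P] [ChartedSpace EP P] [IsManifold 𝓘(ℝ, EP) ∞ P]
    [MulAction Gᵐᵒᵖ P] (π : P → M)
    (hπ : IsPrincipalBundle (𝔤 := 𝔤) (EM := EM) (EP := EP) G π)
    -- the categorical connection
    (η : PreForm EP P 1 𝔤) (m : PreForm EP P 2 𝔢)
    (hconn : IsCategoricalConnection d η m)
    -- the smooth family of squares
    (J : ℝ × ℝ × ℝ → M)
    (hJ : ContMDiffOn 𝓘(ℝ, ℝ × ℝ × ℝ) 𝓘(ℝ, EM) ∞ J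
      (Icc (0 : ℝ) 1 ×ˢ Icc (0 : ℝ) 1 ×ˢ Icc (0 : ℝ) 1))
    (u : P) (hu : π u = J (0, 0, 0)) :
    ∀ x ∈ Icc (0 : ℝ) 1,
      -- `e_{Γ^x}` solves its defining initial value problem
      IsCatHolonomy (EM := EM) π η m (slice J x) (basePt (EM := EM) π η J u x)
        (catHolFamily (EM := EM) E π η m J u x) ∧
      -- the integrals below exist
      ContinuousOn (fun z : ℝ × ℝ => volIntegrand (EM := EM) G π η m J u x z.1 z.2)
        (Icc (0 : ℝ) 1 ×ˢ Icc (0 : ℝ) 1) ∧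
      IntervalIntegrable (bdryIntegrand (EM := EM) π η m J u x) volume 0 1 ∧
      -- the derivative of `e_{Γ^x} = e_{Γ^x}(1)` with respect to `x`
      HasVelocityAt (fun x' => catHolFamily (EM := EM) E π η m J u x' 1) x
        (leftMul (catHolFamily (EM := EM) E π η m J u x 1)
          ((∫ s in (0 : ℝ)..1, ∫ t in (0 : ℝ)..1, volIntegrand (EM := EM) G π η m J u x t s) +
            ∫ n in (0 : ℝ)..1, bdryIntegrand (EM := EM) π η m J u x n)) := by
  have hη := hconn.connection
  obtain ⟨F, hF⟩ := exists_isCubeLift hη hπ hJ hu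
  have hD := hF.isCubeData hπ hd hconn
  obtain ⟨g, hg⟩ := exists_holonomyFamily (E := E) (contDiffOn_prim hD.smooth_ts)
  have hhol : ∀ x ∈ Icc (0 : ℝ) 1, IsCatHolonomy (EM := EM) π η m (slice J x)
      (basePt (EM := EM) π η J u x) (g x) := fun x hx => by
    refine (isCatHolonomy_iff fun s hs => ?_).2 ⟨(hg x hx).1, (hg x hx).2.1⟩
    refine intervalIntegral.integral_congr fun t ht => ?_
    rw [uIcc_of_le zero_le_one] at ht
    exact hF.surfIntegrand_eq hconn hπ ht hs hx
  have hcat : ∀ x ∈ Icc (0 : ℝ) 1, IsCatHolonomy (EM := EM) π η m (slice J x)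
      (basePt (EM := EM) π η J u x) (catHolFamily (EM := EM) E π η m J u x) := fun x hx =>
    (hhol x hx).catHolonomy
  have heq : ∀ x ∈ Icc (0 : ℝ) 1, catHolFamily (EM := EM) E π η m J u x 1 = g x 1 :=
    fun x hx => (hcat x hx).eqOn (hhol x hx) one_mem_I
  intro x hx
  obtain ⟨hg0, hgs, hgx⟩ := hg x hx
  obtain ⟨hb, hbi⟩ := hF.integral_bdryIntegrand hπ hd hconn hx hg0 hgs
  refine ⟨hcat x hx, ?_, hb, ?_⟩
  · refine (hD.continuousOn_vol.comp (f := fun z : ℝ × ℝ => (z.1, z.2, x)) (by fun_prop)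
      fun z hz => mem_cube hz.1 hz.2 hx).congr fun z hz => ?_
    exact hF.volIntegrand_eq hconn hπ hz.1 hz.2 hx
  · have hvol : ∫ s in (0 : ℝ)..1, ∫ t in (0 : ℝ)..1, volIntegrand (EM := EM) G π η m J u x t s =
        ∫ s in (0 : ℝ)..1, ∫ t in (0 : ℝ)..1, pullHor G η m F cube (t, s, x) ex et es := by
      refine intervalIntegral.integral_congr fun s hs => ?_
      refine intervalIntegral.integral_congr fun t ht => ?_
      rw [uIcc_of_le zero_le_one] at hs ht
      exact hF.volIntegrand_eq hconn hπ ht hs hx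
    rw [hasVelocityAt_leftMul_iff, hvol, hbi, ← hD.integral_adT hd hx hg0 hgs]
    exact hgx.congr (fun x' hx' => heq x' hx') hx
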